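/- **Setting.** Let $\Omega\subset\mathbb R^n$ be open, $1<p<\infty$, $p'=p/(p-1)$, and let $Q(x)$, $x\in\Omega$, be symmetric nonnegative semidefinite $n\times n$ matrices with $|Q|\in L^{p/2}_{loc}(\Omega)$. For measurable $S\subset\mathbb R^n$ write $\|f\|_{\alpha,S}=\left(\int_S|f|^\alpha dx\right)^{1/\alpha}$ and $\|f\|_{\alpha,S;\,av}=\left(\frac1{|S|}\int_S|f|^\alpha dx\right)^{1/\alpha}$ (essential supremum if $\alpha=\infty$). *Spaces.* $W^{1,p}_Q(\Omega)$ is the set of pairs $(w,\nabla w)$, with $w$ real-valued and $\nabla w$ $\mathbb R^n$-valued, measurable on $\Omega$, for which there are locally Lipschitz $w_k$ on $\Omega$ with $\|w_k\|_{W^{1,p}_Q(\Omega)}:=\left(\int_\Omega|w_k|^p+\int_\Omega|\sqrt Q\,\nabla w_k|^p\right)^{1/p}<\infty$ such that $w_k\to w$ in $L^p(\Omega)$ and $\int_\Omega|\sqrt Q(\nabla w_k-\nabla w)|^p\to0$. The space $(W^{1,p}_Q)_0(S)$, $S\subset\Omega$, is defined in the same way on $S$ with Lipschitz $w_k$ of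 compact support in $S$. *Quasimetric.* Let $\rho:\Omega\times\Omega\to[0,\infty)$ be a symmetric quasimetric: $\rho(x,y)=0$ iff $x=y$, and $\rho(x,y)\le\kappa[\rho(x,z)+\rho(y,z)]$ for some constant $\kappa\ge1$. Assume that the balls $B(x,r)=\{y\in\Omega:\rho(x,y)<r\}$ are Lebesgue measurable and that, for every $x\in\Omega$, $|x-y|\to0$ if $\rho(x,y)\to0$. Let $r_1:\Omega\to(0,\infty)$ be such that for all $y\in\Omega$ and $0<r<r_1(y)$ the Euclidean closure of $B(y,r)$ is compact and contained in $\Omega$. *Axioms.* Let $\sigma>1$, $\sigma'=\sigma/(\sigma-1)$, and let $p\sigma'<s^*\le\infty$. Write $s^*=s'p$ and $\frac1s+\frac1{s'}=1$ (so $1\le s<\sigma$). Let $0<\tau<1$ and let $C_S,N,C_{s^*},c_0,q^*>0$ be constants, and let $t,t'\in[1,\infty]$ with $\frac1t+\frac1{t'}=1$. Assume that for all $y\in\Omega$, $0<r<r_1(y)$, and $B=B(y,r)$: 1. (Sobolev) $\|w\|_{p\sigma,B;\,av}\le C_S\left[r\,\|\sqrt Q\,\nabla w\|_{p,B;\,av}+\|w\|_{p,B;\,av}\right]$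 for all $(w,\nabla w)\in(W^{1,p}_Q)_0(B)$; 2. (cutoff functions) there are Lipschitz functions $\eta_j$, $j\ge1$, with $\operatorname{supp}\eta_1\subset B$, $0\le\eta_j\le1$, $B(y,\tau r)\subset\{x\in B:\eta_j(x)=1\}$, $\operatorname{supp}\eta_{j+1}\subset\{x\in B:\eta_j(x)=1\}$, $\|\sqrt Q\,\nabla\eta_j\|_{s^*,B;\,av}\le C_{s^*}N^j/r$, and $\|\sqrt Q\,\nabla\eta_j\|_{tp,B}<\infty$ for all $j\ge1$; 3. there is a constant $c_2=c_2(B)$ with $\|f\|_{pt',B}\le c_2\|f\|_{W^{1,p}_Q(\Omega)}$ for all locally Lipschitz $f$ on $\Omega$; 4. (condition $D_{q^*}$, with $q^*\le p\sigma'$) $|B|\ge c_0r^{q^*}$ whenever $r<\min\{1,r_1(y)\}$. *Equation.* Let $A:\Omega\times\mathbb R\times\mathbb R^n\to\mathbb R^n$ and $B:\Omega\times\mathbb R\times\mathbb R^n\to\mathbb R$. Assume that for some constant $a>1$, nonnegative functions $b,c,d,e,f,g,h$ on $\Omega$ and some $\tilde A:\Omega\times\mathbb R\times\mathbb R^n\to\mathbb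 R^n$, for a.e. $x\in\Omega$ and all $(z,\xi)\in\mathbb R\times\mathbb R^n$, $$A(x,z,\xi)=\sqrt{Q(x)}\,\tilde A(x,z,\xi),\qquad \xi\cdot A(x,z,\xi)\ge a^{-1}|\sqrt{Q(x)}\,\xi|^p-h|z|^p-g,$$ $$|\tilde A(x,z,\xi)|\le a|\sqrt{Q(x)}\,\xi|^{p-1}+b|z|^{p-1}+e,\qquad |B(x,z,\xi)|\le c|\sqrt{Q(x)}\,\xi|^{p-1}+d|z|^{p-1}+f.$$ Let $(u,\nabla u)\in W^{1,p}_Q(\Omega)$ be a weak solution of $\operatorname{div}A(x,u,\nabla u)=B(x,u,\nabla u)$: for every Lipschitz function $\varphi$ with compact support in $\Omega$ the following integral exists and $$\int_\Omega\left[\nabla\varphi\cdot A(x,u,\nabla u)+\varphi\,B(x,u,\nabla u)\right]dx=0.$$ **Corollary 1.6.** Let $y\in\Omega$, $0<r<\tau r_1(y)$, $r\le1$. Suppose that for some $\epsilon>0$, on $B(y,r)$, one has $b,e\in L^{p'\sigma'}$, $c\in L^{p\sigma'(1+\epsilon)}$ and $d,f,g,h\in L^{\sigma'(1+\epsilon)}$.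 Then $u\in L^{sp}(B(y,r))$ and $$\|u\|_{L^\infty(B(y,\tau r))}\le C\left\{\left(\frac1{|B(y,r)|}\int_{B(y,r)}|u|^{sp}dx\right)^{\frac1{sp}}+K(y,r)\right\},$$ where $$K(y,r)=r^{1-\frac{q^*}{p\sigma'}}\Big(\|e\|_{p'\sigma',B(y,r)}^{\frac1{p-1}}+r^{\left\{1-\frac{q^*}{p\sigma'}+\frac{q^*}{\sigma'}\frac{\epsilon}{1+\epsilon}\right\}\frac1{p-1}}\|f\|_{\sigma'(1+\epsilon),B(y,r)}^{\frac1{p-1}}+r^{\frac{q^*}{p\sigma'}\frac{\epsilon}{1+\epsilon}}\|g\|_{\sigma'(1+\epsilon),B(y,r)}^{\frac1p}\Big).$$ Here $C$ depends only on $n,p,\sigma,a,\tau,N,C_S,C_{s^*},s^*,q^*,c_0,\epsilon$ and an upper bound for $$\|b\|_{p'\sigma',B(y,r)}+\|c\|_{p\sigma'(1+\epsilon),B(y,r)}+\|d\|_{\sigma'(1+\epsilon),B(y,r)}+\|h\|_{\sigma'(1+\epsilon),B(y,r)};$$ in particular it does not depend on $u$, $B(y,r)$, $e$, $f$ or $g$.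 In particular, if $s=1$, i.e. $s^*=\infty$, then with the same $C$ and $K$ $$\|u\|_{L^\infty(B(y,\tau r))}\le C\left\{\left(\frac1{|B(y,r)|}\int_{B(y,r)}|u|^{p}dx\right)^{\frac1{p}}+K(y,r)\right\}.$$ -/

import Mathlib

open MeasureTheory Filter Topology
open scoped ENNReal NNReal Gradient

/-- Euclidean space `ℝⁿ`. -/
abbrev Eucl (n : ℕ) := EuclideanSpace ℝ (Fin n)

open scoped MatrixOrder in
/-- `√M`: the unique positive semidefinite square root of a positive semidefinite matrix. -/
noncomputable def sqrtMat {n : ℕ} (M : Matrix (Fin n) (Fin n) ℝ) : Matrix (Fin n) (Fin n) ℝ :=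
  CFC.sqrt M

/-- The vector `√M ξ`; for `M` positive semidefinite `|√M ξ|² = ⟨Mξ, ξ⟩`. -/
noncomputable def sqrtApply {n : ℕ} (M : Matrix (Fin n) (Fin n) ℝ) (ξ : Eucl n) : Eucl n :=
  Matrix.toEuclideanLin (sqrtMat M) ξ

/-- The unnormalized norm `‖f‖_{L^α(S)}` as a real number (used for functions in `L^α(S)`). -/
noncomputable def lpNormOn {n : ℕ} (f : Eucl n → ℝ) (α : ℝ) (S : Set (Eucl n)) : ℝ :=
  (eLpNorm f (ENNReal.ofReal α) (volume.restrict S)).toReal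

/-- The normalized norm `(|S|⁻¹ ∫_S |f|^α)^{1/α}`; for `α = ∞` it is the essential supremum. -/
noncomputable def avgNorm {n : ℕ} {F : Type*} [NormedAddCommGroup F] (f : Eucl n → F)
    (α : ℝ≥0∞) (S : Set (Eucl n)) : ℝ≥0∞ :=
  eLpNorm f α ((volume S)⁻¹ • volume.restrict S)

/-! ### Quasimetric balls -/

/-- The quasimetric ball `B(x,r) = {y ∈ Ω : ρ(x,y) < r}`. -/
def qBall {n : ℕ} (Ω : Set (Eucl n)) (ρ : Eucl n → Eucl n → ℝ) (x : Eucl n) (r : ℝ) :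
    Set (Eucl n) :=
  {y | y ∈ Ω ∧ ρ x y < r}

/-- `ρ` is a symmetric quasimetric on `Ω` with Lebesgue measurable balls. -/
structure IsQuasimetric {n : ℕ} (Ω : Set (Eucl n)) (ρ : Eucl n → Eucl n → ℝ) : Prop where
  nonneg : ∀ x ∈ Ω, ∀ y ∈ Ω, 0 ≤ ρ x y
  eq_zero_iff : ∀ x ∈ Ω, ∀ y ∈ Ω, (ρ x y = 0 ↔ x = y)
  symm : ∀ x ∈ Ω, ∀ y ∈ Ω, ρ x y = ρ y x
  triangle : ∃ κ : ℝ, 1 ≤ κ ∧ ∀ x ∈ Ω, ∀ y ∈ Ω, ∀ z ∈ Ω, ρ x y ≤ κ * (ρ x z + ρ y z)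
  measurable_ball : ∀ x ∈ Ω, ∀ r : ℝ, 0 < r → NullMeasurableSet (qBall Ω ρ x r) volume

/-- For all `x ∈ Ω`: `|x - y| → 0` if `ρ(x,y) → 0`. -/
def EuclidFiner {n : ℕ} (Ω : Set (Eucl n)) (ρ : Eucl n → Eucl n → ℝ) : Prop :=
  ∀ x ∈ Ω, ∀ ε : ℝ, 0 < ε → ∃ δ : ℝ, 0 < δ ∧ ∀ y ∈ Ω, ρ x y < δ → ‖x - y‖ < ε

/-- `r₁ > 0` on `Ω`, and every ball `B(y,r)` with `r < r₁(y)` has compact Euclidean closure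
contained in `Ω`. -/
def AdmissibleRadius {n : ℕ} (Ω : Set (Eucl n)) (ρ : Eucl n → Eucl n → ℝ)
    (r₁ : Eucl n → ℝ) : Prop :=
  ∀ y ∈ Ω, 0 < r₁ y ∧ ∀ r : ℝ, 0 < r → r < r₁ y →
    IsCompact (closure (qBall Ω ρ y r)) ∧ closure (qBall Ω ρ y r) ⊆ Ω

/-- Condition `D_q` with constant `c₀`: `|B(y,r)| ≥ c₀ r^q` whenever `r < min {1, r₁(y)}`. -/
def DCond {n : ℕ} (Ω : Set (Eucl n)) (ρ : Eucl n → Eucl n → ℝ) (r₁ : Eucl n → ℝ)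
    (q c₀ : ℝ) : Prop :=
  ∀ y ∈ Ω, ∀ r : ℝ, 0 < r → r < min 1 (r₁ y) →
    ENNReal.ofReal (c₀ * r ^ q) ≤ volume (qBall Ω ρ y r)

/-! ### Degenerate Sobolev spaces -/

/-- `Q` is a symmetric nonnegative semidefinite matrix function on `Ω` with
`|Q| ∈ L^{p/2}_loc(Ω)` (stated entrywise). -/
def IsDegenerateForm {n : ℕ} (Ω : Set (Eucl n)) (p : ℝ)
    (Q : Eucl n → Matrix (Fin n) (Fin n) ℝ) : Prop :=
  (∀ x ∈ Ω, (Q x).PosSemidef) ∧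
  ∀ K : Set (Eucl n), IsCompact K → K ⊆ Ω → ∀ i j : Fin n,
    MemLp (fun x => Q x i j) (ENNReal.ofReal (p / 2)) (volume.restrict K)

/-- Lipschitz functions with compact support in `S`. -/
def IsLipCompact {n : ℕ} (S : Set (Eucl n)) (φ : Eucl n → ℝ) : Prop :=
  (∃ K : ℝ≥0, LipschitzWith K φ) ∧ HasCompactSupport φ ∧ tsupport φ ⊆ S

/-- `(∫_S |w|^p + ∫_S |√Q v|^p)^{1/p}`; for `v = ∇w` this is the `W^{1,p}_Q(S)` norm. -/
noncomputable def wNorm {n : ℕ} (Q : Eucl n → Matrix (Fin n) (Fin n) ℝ) (p : ℝ)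
    (S : Set (Eucl n)) (w : Eucl n → ℝ) (v : Eucl n → Eucl n) : ℝ≥0∞ :=
  (eLpNorm w (ENNReal.ofReal p) (volume.restrict S) ^ p +
    eLpNorm (fun x => sqrtApply (Q x) (v x)) (ENNReal.ofReal p) (volume.restrict S) ^ p) ^ (1 / p)

/-- `(w, v)` is the limit of `(f k, ∇ f k)` in `L^p(S) × 𝓛^p(S,Q)`. -/
def IsQLimit {n : ℕ} (Q : Eucl n → Matrix (Fin n) (Fin n) ℝ) (p : ℝ) (S : Set (Eucl n))
    (f : ℕ → Eucl n → ℝ) (w : Eucl n → ℝ) (v : Eucl n → Eucl n) : Prop :=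
  AEStronglyMeasurable w (volume.restrict S) ∧
  AEStronglyMeasurable v (volume.restrict S) ∧
  Tendsto (fun k => eLpNorm (fun x => f k x - w x) (ENNReal.ofReal p) (volume.restrict S))
    atTop (𝓝 0) ∧
  Tendsto (fun k => eLpNorm (fun x => sqrtApply (Q x) (∇ (f k) x - v x)) (ENNReal.ofReal p)
    (volume.restrict S)) atTop (𝓝 0)

/-- The pair `(w, v)` belongs to `W^{1,p}_Q(Ω)`: it is represented by a sequence of locally
Lipschitz functions on `Ω` with finite norm (`v` plays the role of `∇w`). -/
def MemWQ {n : ℕ} (Q : Eucl n → Matrix (Fin n) (Fin n) ℝ) (p : ℝ) (Ω : Set (Eucl n))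
    (w : Eucl n → ℝ) (v : Eucl n → Eucl n) : Prop :=
  ∃ f : ℕ → Eucl n → ℝ,
    (∀ k, LocallyLipschitzOn Ω (f k) ∧ wNorm Q p Ω (f k) (∇ (f k)) < ⊤) ∧ IsQLimit Q p Ω f w v

/-- The pair `(w, v)` belongs to `(W^{1,p}_Q)_0(B)`: it is represented by a sequence of
Lipschitz functions with compact support in `B`. -/
def MemWQZero {n : ℕ} (Q : Eucl n → Matrix (Fin n) (Fin n) ℝ) (p : ℝ) (B : Set (Eucl n))
    (w : Eucl n → ℝ) (v : Eucl n → Eucl n) : Prop :=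
  ∃ f : ℕ → Eucl n → ℝ, (∀ k, IsLipCompact B (f k)) ∧ IsQLimit Q p B f w v

/-! ### The axiomatic framework -/

/-- The Sobolev estimate with gain `σ` and constant `CS` on all balls `B(y,r)`, `r < r₁(y)`. -/
def SobolevEstimate {n : ℕ} (Ω : Set (Eucl n)) (Q : Eucl n → Matrix (Fin n) (Fin n) ℝ)
    (ρ : Eucl n → Eucl n → ℝ) (r₁ : Eucl n → ℝ) (p σ CS : ℝ) : Prop :=
  ∀ y ∈ Ω, ∀ r : ℝ, 0 < r → r < r₁ y →
    ∀ (w : Eucl n → ℝ) (v : Eucl n → Eucl n), MemWQZero Q p (qBall Ω ρ y r) w v →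
      avgNorm w (ENNReal.ofReal (p * σ)) (qBall Ω ρ y r) ≤
        ENNReal.ofReal CS *
          (ENNReal.ofReal r *
              avgNorm (fun x => sqrtApply (Q x) (v x)) (ENNReal.ofReal p) (qBall Ω ρ y r) +
            avgNorm w (ENNReal.ofReal p) (qBall Ω ρ y r))

/-- `η 1, η 2, …` is an accumulating sequence of Lipschitz cutoff functions for `B(y,r)`
(the value `η 0` plays no role). -/
structure IsCutoffSeq {n : ℕ} (Ω : Set (Eucl n)) (Q : Eucl n → Matrix (Fin n) (Fin n) ℝ)
    (ρ : Eucl n → Eucl n → ℝ) (τ N Ccut : ℝ) (sStar : ℝ≥0∞) (y : Eucl n) (r : ℝ)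
    (η : ℕ → Eucl n → ℝ) : Prop where
  lipschitz : ∀ j, 1 ≤ j → ∃ K : ℝ≥0, LipschitzWith K (η j)
  supp_one : tsupport (η 1) ⊆ qBall Ω ρ y r
  nonneg : ∀ j, 1 ≤ j → ∀ x, 0 ≤ η j x
  le_one : ∀ j, 1 ≤ j → ∀ x, η j x ≤ 1
  eq_one : ∀ j, 1 ≤ j → ∀ x ∈ qBall Ω ρ y (τ * r), x ∈ qBall Ω ρ y r ∧ η j x = 1
  supp_succ : ∀ j, 1 ≤ j → ∀ x ∈ tsupport (η (j + 1)), x ∈ qBall Ω ρ y r ∧ η j x = 1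
  grad_bound : ∀ j, 1 ≤ j →
    avgNorm (fun x => sqrtApply (Q x) (∇ (η j) x)) sStar (qBall Ω ρ y r) ≤
      ENNReal.ofReal (Ccut * N ^ j / r)

/-- Every ball `B(y,r)` with `r < r₁(y)` has an accumulating sequence of cutoff functions `η_j`
with `√Q ∇η_j ∈ L^{tp}(B(y,r))` for all `j ≥ 1`. -/
def CutoffCond {n : ℕ} (Ω : Set (Eucl n)) (Q : Eucl n → Matrix (Fin n) (Fin n) ℝ)
    (ρ : Eucl n → Eucl n → ℝ) (r₁ : Eucl n → ℝ) (p τ N Ccut : ℝ) (sStar t : ℝ≥0∞) : Prop :=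
  ∀ y ∈ Ω, ∀ r : ℝ, 0 < r → r < r₁ y → ∃ η : ℕ → Eucl n → ℝ,
    IsCutoffSeq Ω Q ρ τ N Ccut sStar y r η ∧
    ∀ j, 1 ≤ j → eLpNorm (fun x => sqrtApply (Q x) (∇ (η j) x)) (t * ENNReal.ofReal p)
      (volume.restrict (qBall Ω ρ y r)) < ⊤

/-- For every ball `B(y,r)` with `r < r₁(y)` there is a constant `c₂` such that
`‖f‖_{L^{pt'}(B(y,r))} ≤ c₂ ‖f‖_{W^{1,p}_Q(Ω)}` for all locally Lipschitz `f` on `Ω`. -/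
def LocalIntegrabilityCond {n : ℕ} (Ω : Set (Eucl n))
    (Q : Eucl n → Matrix (Fin n) (Fin n) ℝ) (ρ : Eucl n → Eucl n → ℝ) (r₁ : Eucl n → ℝ)
    (p : ℝ) (t' : ℝ≥0∞) : Prop :=
  ∀ y ∈ Ω, ∀ r : ℝ, 0 < r → r < r₁ y → ∃ c₂ : ℝ≥0,
    ∀ f : Eucl n → ℝ, LocallyLipschitzOn Ω f →
      eLpNorm f (t' * ENNReal.ofReal p) (volume.restrict (qBall Ω ρ y r)) ≤
        c₂ * wNorm Q p Ω f (∇ f)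

/-! ### The equation `div A(x,u,∇u) = B(x,u,∇u)` -/

/-- The structural conditions on `A` and `B`. -/
def StructuralCond {n : ℕ} (Ω : Set (Eucl n)) (Q : Eucl n → Matrix (Fin n) (Fin n) ℝ)
    (p a γ ψ δ : ℝ) (b c d e f g h : Eucl n → ℝ)
    (A : Eucl n → ℝ → Eucl n → Eucl n) (B : Eucl n → ℝ → Eucl n → ℝ) : Prop :=
  (∀ x ∈ Ω, 0 ≤ b x ∧ 0 ≤ c x ∧ 0 ≤ d x ∧ 0 ≤ e x ∧ 0 ≤ f x ∧ 0 ≤ g x ∧ 0 ≤ h x) ∧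
  ∃ A' : Eucl n → ℝ → Eucl n → Eucl n,
    ∀ᵐ x ∂(volume.restrict Ω), ∀ (z : ℝ) (ξ : Eucl n),
      A x z ξ = sqrtApply (Q x) (A' x z ξ) ∧
      a⁻¹ * ‖sqrtApply (Q x) ξ‖ ^ p - h x * |z| ^ γ - g x ≤ inner ℝ ξ (A x z ξ) ∧
      ‖A' x z ξ‖ ≤ a * ‖sqrtApply (Q x) ξ‖ ^ (p - 1) + b x * |z| ^ (γ - 1) + e x ∧
      |B x z ξ| ≤ c x * ‖sqrtApply (Q x) ξ‖ ^ (ψ - 1) + d x * |z| ^ (δ - 1) + f x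

/-- The pair `(u, v)`, `v` in the role of `∇u`, belongs to `W^{1,p}_Q(Ω)` and is a weak solution
of `div A(x,u,∇u) = B(x,u,∇u)` in `Ω`. That the integrals exist is part of the notion. -/
def IsWeakSolution {n : ℕ} (Ω : Set (Eucl n)) (Q : Eucl n → Matrix (Fin n) (Fin n) ℝ) (p : ℝ)
    (A : Eucl n → ℝ → Eucl n → Eucl n) (B : Eucl n → ℝ → Eucl n → ℝ)
    (u : Eucl n → ℝ) (v : Eucl n → Eucl n) : Prop :=
  MemWQ Q p Ω u v ∧
  ∀ φ : Eucl n → ℝ, IsLipCompact Ω φ →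
    IntegrableOn (fun x => inner ℝ (∇ φ x) (A x (u x) (v x)) + φ x * B x (u x) (v x)) Ω volume ∧
    ∫ x in Ω, (inner ℝ (∇ φ x) (A x (u x) (v x)) + φ x * B x (u x) (v x)) = 0

/-- The quantity `K(y,r)`, as a function of the exponents, of `r` and of the ball `S = B(y,r)`;
`q` is the order of the `D` condition, and primes denote conjugate exponents. -/
noncomputable def Kterm {n : ℕ} (p σ q ε r : ℝ) (e f g : Eucl n → ℝ) (S : Set (Eucl n)) : ℝ :=
  let p' := p.conjExponent
  let σ' := σ.conjExponent
  r ^ (1 - q / (p * σ')) *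
    (lpNormOn e (p' * σ') S ^ (1 / (p - 1)) +
      r ^ ((1 - q / (p * σ') + q / σ' * (ε / (1 + ε))) * (1 / (p - 1))) *
        lpNormOn f (σ' * (1 + ε)) S ^ (1 / (p - 1)) +
      r ^ (q / (p * σ') * (ε / (1 + ε))) *
        lpNormOn g (σ' * (1 + ε)) S ^ (1 / p))

/-! ### The square root of the degenerate form -/

/-! The proof is Moser iteration for ū = max(|u|, k), where k > 0 and k ≥ K(y,r). Because ū ≥ k, one
has e ≤ k^(1-p) e ū^(p-1), f ≤ k^(1-p) f ū^(p-1) and g ≤ k^(-p) g ū^p. The inhomogeneous terms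
therefore merge into b, d and h. Each summand of K is shaped so that its bound by k makes the
corresponding merged term contribute at most 1 at the natural scale (`Kterm_dominates`). Condition
D_q converts averaged norms into plain ones (`ofReal_rpow_mul_eLpNorm_add_le`), and after that only
c₀, M and exponents enter the constants.

One step of the iteration uses the truncated weight ω = min(ū, l)^(β-1) and two primitives vanishing
at 0: G with G' = ω^p and H with H' = ω. Testing the equation with η^p G(u) bounds ηω|√Q∇u| in L^p
(`energy_pointwise`, `MoserSetup.energy`). The Sobolev inequality for ηH(u), together with ωū ≤
β|H(u)| + k^β, bounds ηωū in L^(pσ) (`truncWeight_mul_le_integral`, `MoserSetup.sobolev_comp`). In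
the lower order terms Hölder's inequality always leaves a positive power of a low norm. For c, d and
h this is where the spare ε is spent; in the b term the low norm is that of the cutoff gradient. The
L^(pσ) norm on the right can thus be absorbed at the price of a fixed power of β
(`le_of_absorption`, `moser_step_of_energy`). As √Q∇η is only known in L^(s'p), the low norm is that
of L^(sp), and the gain per step is from sp to σp. Letting l → ∞ gives `MoserSetup.step`.

With β = χ^j and χ = σ/s > 1 the steps chain together. The j-th constant grows geometrically in j
but enters to the power χ^(-j), so the product converges (`prod_bound_of_recursion`). The L^∞ bound
is the limit of the L^q bounds, and at the end k decreases to K.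

What remains is to justify the test functions, since u is only a limit of locally Lipschitz
functions and the equation is only tested with Lipschitz ones. Cutoffs on the larger ball B(y, r/τ)
and the local integrability condition show that the approximants converge to u in L^(pσ)(B(y,r))
(`exists_local_gain`, `MemWQ.tendsto_of_gain`). That is enough to pass to the limit in ζH(u) and in
the weak formulation (`isQLimit_mul_comp`, `integral_weak_eq_zero`). -/

open scoped MatrixOrder in
theorem inner_sqrtApply {n : ℕ} (M : Matrix (Fin n) (Fin n) ℝ) (x y : Eucl n) :
    inner ℝ x (sqrtApply M y) = inner ℝ (sqrtApply M x) y := by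
  have h : (sqrtMat M).IsHermitian := (Matrix.nonneg_iff_posSemidef.1 (CFC.sqrt_nonneg M)).1
  exact ((Matrix.isSymmetric_toEuclideanLin_iff.2 h) x y).symm

theorem sqrtApply_add {n : ℕ} (M : Matrix (Fin n) (Fin n) ℝ) (x y : Eucl n) :
    sqrtApply M (x + y) = sqrtApply M x + sqrtApply M y := map_add _ _ _

theorem sqrtApply_sub {n : ℕ} (M : Matrix (Fin n) (Fin n) ℝ) (x y : Eucl n) :
    sqrtApply M (x - y) = sqrtApply M x - sqrtApply M y := map_sub _ _ _

theorem sqrtApply_smul {n : ℕ} (M : Matrix (Fin n) (Fin n) ℝ) (c : ℝ) (x : Eucl n) :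
    sqrtApply M (c • x) = c • sqrtApply M x := map_smul _ _ _

theorem sqrtApply_zero {n : ℕ} (M : Matrix (Fin n) (Fin n) ℝ) :
    sqrtApply M 0 = 0 := map_zero _

-- Continuity of the functional calculus in the operator requires a C*-norm, hence the L² operator
-- norm here. Its topology is the entrywise one, so `continuousOn_sqrtMat` can drop the norm.
open scoped Matrix.Norms.L2Operator MatrixOrder in
theorem continuousOn_sqrtMat_l2 {n : ℕ} :
    ContinuousOn (sqrtMat (n := n)) {M | M.PosSemidef} := by
  have : ContinuousOn (fun M : Matrix (Fin n) (Fin n) ℝ => cfcₙ NNReal.sqrt M)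
      {M | M.PosSemidef} := by
    refine ContinuousOn.cfcₙ_nnreal_of_mem_nhdsSet (s := Set.univ) NNReal.sqrt (by simp)
      continuousOn_id ?_ ?_ ?_
    · intro x hx; exact Matrix.nonneg_iff_posSemidef.2 hx
    · exact NNReal.continuous_sqrt.continuousOn
    · simp
  exact this

theorem continuousOn_sqrtMat {n : ℕ} :
    ContinuousOn (sqrtMat (n := n)) {M | M.PosSemidef} := continuousOn_sqrtMat_l2

theorem isClosed_posSemidef (n : ℕ) :
    IsClosed {M : Matrix (Fin n) (Fin n) ℝ | M.PosSemidef} := by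
  simp only [Matrix.posSemidef_iff_dotProduct_mulVec, Set.ofPred_and, Matrix.IsHermitian,
    Set.ofPred_forall]
  refine (isClosed_eq (by fun_prop) continuous_id).inter (isClosed_iInter fun x => ?_)
  exact isClosed_le continuous_const
    (continuous_const.dotProduct (continuous_id.matrix_mulVec continuous_const))

/-- Q is controlled on compact subsets only. An open set is a countable union of such subsets, so
measurability glues. -/
theorem aestronglyMeasurable_of_compact {n : ℕ} {Ω : Set (Eucl n)} (hΩ : IsOpen Ω)
    {f : Eucl n → ℝ} (hf : ∀ K : Set (Eucl n), IsCompact K → K ⊆ Ω →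
      AEStronglyMeasurable f (volume.restrict K)) :
    AEStronglyMeasurable f (volume.restrict Ω) := by
  obtain ⟨F, hFc, hFs, hFu, -⟩ := hΩ.exists_iUnion_isClosed
  have : Ω = ⋃ i : ℕ × ℕ, F i.1 ∩ Metric.closedBall 0 i.2 := by
    rw [← hFu]
    ext x
    simp only [Set.mem_iUnion, Set.mem_inter_iff, Prod.exists]
    constructor
    · rintro ⟨i, hi⟩
      obtain ⟨m, hm⟩ := exists_nat_ge ‖x‖
      exact ⟨i, m, hi, by simpa using hm⟩
    · rintro ⟨i, m, hi, -⟩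
      exact ⟨i, hi⟩
  rw [this, aestronglyMeasurable_iUnion_iff]
  intro i
  refine hf _ ((isCompact_closedBall _ _).inter_left (hFc _)) ?_
  exact Set.inter_subset_left.trans (hFs _)

/-- The square root is known to be continuous on the positive semidefinite cone. The cone is closed,
so extending by zero off it gives a Borel function to compose with Q. -/
theorem aestronglyMeasurable_sqrtMat {n : ℕ} {Ω : Set (Eucl n)} (hΩ : IsOpen Ω) {p : ℝ}
    {Q : Eucl n → Matrix (Fin n) (Fin n) ℝ} (hQ : IsDegenerateForm Ω p Q) (i j : Fin n) :
    AEMeasurable (fun x => sqrtMat (Q x) i j) (volume.restrict Ω) := by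
  classical
  have h1 : ∀ i j, AEMeasurable (fun x => Q x i j) (volume.restrict Ω) := fun i j =>
    (aestronglyMeasurable_of_compact hΩ fun K hK hKΩ => (hQ.2 K hK hKΩ i j).1).aemeasurable
  let Q' : Eucl n → Fin n → Fin n → ℝ := fun x i j => Q x i j
  have h2 : AEMeasurable Q' (volume.restrict Ω) :=
    aemeasurable_pi_lambda _ fun i => aemeasurable_pi_lambda _ fun j => h1 i j
  let S : Set (Fin n → Fin n → ℝ) := {M | Matrix.PosSemidef (M : Matrix (Fin n) (Fin n) ℝ)}
  let F : (Fin n → Fin n → ℝ) → ℝ := fun M => sqrtMat (M : Matrix (Fin n) (Fin n) ℝ) i j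
  have hS' : IsClosed S := isClosed_posSemidef n
  have hS : MeasurableSet S := hS'.measurableSet
  have hF : ContinuousOn F S := by
    have : ContinuousOn (fun M : Matrix (Fin n) (Fin n) ℝ => sqrtMat M i j)
      {M | M.PosSemidef} := by
      have h := continuousOn_sqrtMat (n := n)
      exact ((continuous_id.matrix_elem i j).comp_continuousOn h)
    exact this
  have h3 : Measurable (S.piecewise F 0) :=
    hF.measurable_piecewise continuous_zero.continuousOn hS
  refine (h3.comp_aemeasurable h2).congr ?_
  filter_upwards [ae_restrict_mem hΩ.measurableSet] with x hx
  have : Q' x ∈ S := hQ.1 x hx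
  simp [Function.comp, Set.piecewise, this, F, Q']

theorem aestronglyMeasurable_sqrtApply {n : ℕ} {Ω : Set (Eucl n)} (hΩ : IsOpen Ω) {p : ℝ}
    {Q : Eucl n → Matrix (Fin n) (Fin n) ℝ} (hQ : IsDegenerateForm Ω p Q)
    {S : Set (Eucl n)} (hS : S ⊆ Ω) {v : Eucl n → Eucl n}
    (hv : AEStronglyMeasurable v (volume.restrict S)) :
    AEStronglyMeasurable (fun x => sqrtApply (Q x) (v x)) (volume.restrict S) := by
  apply AEMeasurable.aestronglyMeasurable
  have : (fun x => sqrtApply (Q x) (v x)) =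
      fun x => WithLp.toLp 2 (fun i => ∑ j, sqrtMat (Q x) i j * (v x) j) := by
    ext x i
    simp [sqrtApply, Matrix.toLpLin_apply, Matrix.mulVec, dotProduct]
  rw [this]
  refine (WithLp.measurable_toLp 2 _).comp_aemeasurable (aemeasurable_pi_lambda _ fun i => ?_)
  refine Finset.aemeasurable_fun_sum _ fun j _ => ?_
  refine ((aestronglyMeasurable_sqrtMat hΩ hQ i j).mono_measure
    (Measure.restrict_mono hS le_rfl)).mul ?_
  exact ((EuclideanSpace.proj (𝕜 := ℝ) j).continuous.measurable).comp_aemeasurable hv.aemeasurable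

theorem measurable_gradient {n : ℕ} (f : Eucl n → ℝ) : Measurable (∇ f) := by
  have : ∇ f = fun x => (InnerProductSpace.toDual ℝ (Eucl n)).symm (fderiv ℝ f x) := rfl
  rw [this]
  exact ((InnerProductSpace.toDual ℝ (Eucl n)).symm.continuous.measurable).comp
    (measurable_fderiv ℝ f)

/-! ### Lipschitz functions -/

theorem exists_lipschitzOnWith_nhds {n : ℕ} {Ω : Set (Eucl n)} (hΩ : IsOpen Ω) {f : Eucl n → ℝ}
    (hf : LocallyLipschitzOn Ω f) {x : Eucl n} (hx : x ∈ Ω) :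
    ∃ K : ℝ≥0, ∃ t ∈ 𝓝 x, LipschitzOnWith K f t := by
  obtain ⟨K, t, ht, h⟩ := hf hx
  rw [hΩ.nhdsWithin_eq hx] at ht
  exact ⟨K, t, ht, h⟩

theorem ae_differentiableAt_of_locallyLipschitzOn {n : ℕ} {Ω : Set (Eucl n)} (hΩ : IsOpen Ω)
    {f : Eucl n → ℝ} (hf : LocallyLipschitzOn Ω f) :
    ∀ᵐ x ∂(volume.restrict Ω), DifferentiableAt ℝ f x := by
  rw [ae_restrict_iff' hΩ.measurableSet, ae_iff]
  refine measure_null_of_locally_null _ fun x hx => ?_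
  have hxΩ : x ∈ Ω := by
    by_contra h
    exact hx fun h' => absurd h' h
  obtain ⟨K, t, ht, hK⟩ := exists_lipschitzOnWith_nhds hΩ hf hxΩ
  obtain ⟨U, hUt, hU, hxU⟩ := mem_nhds_iff.1 ht
  refine ⟨{y | ¬(y ∈ Ω → DifferentiableAt ℝ f y)} ∩ U,
    inter_mem self_mem_nhdsWithin (mem_nhdsWithin_of_mem_nhds (hU.mem_nhds hxU)), ?_⟩
  have := (hK.mono hUt).ae_differentiableWithinAt_of_mem (μ := (volume : Measure (Eucl n)))
  refine measure_mono_null ?_ (ae_iff.1 this)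
  rintro y ⟨hy, hyU⟩ h
  exact hy fun _ => (h hyU).differentiableAt (hU.mem_nhds hyU)

/-- Let the support lie in the ball of radius R. On the compact ball of radius R + 1 there is a
uniform constant. A point of the R-ball and a point outside the (R+1)-ball are at distance at least
1, so there sup |φ| serves as a constant. -/
theorem exists_lipschitzWith_of_locally {n : ℕ} {φ : Eucl n → ℝ} (hφ : LocallyLipschitz φ)
    (hc : HasCompactSupport φ) : ∃ K : ℝ≥0, LipschitzWith K φ := by
  obtain ⟨R, hR⟩ := hc.isCompact.isBounded.subset_closedBall (0 : Eucl n)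
  obtain ⟨M, hM⟩ := hc.exists_bound_of_continuous hφ.continuous
  have hM0 : 0 ≤ M := (norm_nonneg _).trans (hM 0)
  obtain ⟨K, hK⟩ := (hφ.locallyLipschitzOn (s := Metric.closedBall (0 : Eucl n)
    (R + 1))).exists_lipschitzOnWith_of_compact (isCompact_closedBall _ _)
  have h0 : ∀ x, x ∉ Metric.closedBall (0 : Eucl n) R → φ x = 0 := fun x hx =>
    image_eq_zero_of_notMem_tsupport fun h => hx (hR h)
  have hsub : Metric.closedBall (0 : Eucl n) R ⊆ Metric.closedBall (0 : Eucl n) (R + 1) :=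
    Metric.closedBall_subset_closedBall (by linarith)
  have key : ∀ x y, x ∈ Metric.closedBall (0 : Eucl n) R →
      dist (φ x) (φ y) ≤ (max K M.toNNReal : ℝ≥0) * dist x y := by
    intro x y hx
    have e : ((max K M.toNNReal : ℝ≥0) : ℝ) = max (K : ℝ) M := by
      rw [NNReal.coe_max, Real.coe_toNNReal _ hM0]
    rw [e]
    by_cases hy : y ∈ Metric.closedBall (0 : Eucl n) (R + 1)
    · exact (hK.dist_le_mul x (hsub hx) y hy).trans
        (mul_le_mul_of_nonneg_right (le_max_left _ _) dist_nonneg)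
    · have h1 : 1 ≤ dist x y := by
        rw [Metric.mem_closedBall, dist_zero_right] at hx hy
        rw [dist_comm, dist_eq_norm]
        have := norm_sub_norm_le y x
        linarith
      rw [h0 y fun h => hy (hsub h), dist_zero_right]
      calc ‖φ x‖ ≤ M * 1 := by simpa using hM x
        _ ≤ max (K : ℝ) M * dist x y :=
          mul_le_mul (le_max_right _ _) h1 zero_le_one (hM0.trans (le_max_right _ _))
  refine ⟨max K M.toNNReal, LipschitzWith.of_dist_le_mul fun x y => ?_⟩
  by_cases hx : x ∈ Metric.closedBall (0 : Eucl n) R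
  · exact key x y hx
  by_cases hy : y ∈ Metric.closedBall (0 : Eucl n) R
  · rw [dist_comm, dist_comm x]
    exact key y x hy
  · rw [h0 x hx, h0 y hy, dist_self]
    positivity

theorem IsLipCompact.mul_locallyLipschitzOn {n : ℕ} {Ω S : Set (Eucl n)} (hΩ : IsOpen Ω)
    (hS : S ⊆ Ω) {ζ f : Eucl n → ℝ} (hζ : IsLipCompact S ζ) (hf : LocallyLipschitzOn Ω f) :
    IsLipCompact S (fun x => ζ x * f x) := by
  obtain ⟨⟨K, hK⟩, hc, hs⟩ := hζ
  have hc' : HasCompactSupport (fun x => ζ x * f x) := hc.mul_right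
  have hs' : tsupport (fun x => ζ x * f x) ⊆ tsupport ζ := tsupport_mul_subset_left
  refine ⟨exists_lipschitzWith_of_locally (fun x => ?_) hc', hc', hs'.trans hs⟩
  by_cases hx : x ∈ tsupport ζ
  · obtain ⟨K', t, ht, hf'⟩ := exists_lipschitzOnWith_nhds hΩ hf (hS (hs hx))
    have hmul : LocallyLipschitz (fun q : ℝ × ℝ => q.1 * q.2) :=
      ContDiff.locallyLipschitz (𝕂 := ℝ) (by fun_prop)
    obtain ⟨K'', u, hu, hm⟩ := hmul (ζ x, f x)
    have hcont : ContinuousAt (fun y => (ζ y, f y)) x :=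
      hK.continuous.continuousAt.prodMk (hf'.continuousOn.continuousAt ht)
    refine ⟨K'' * max K K', t ∩ (fun y => (ζ y, f y)) ⁻¹' u,
      inter_mem ht (hcont.preimage_mem_nhds hu), ?_⟩
    exact hm.comp ((hK.lipschitzOnWith.prodMk (hf'.mono Set.inter_subset_left)))
      (fun y hy => hy.2)
  · refine ⟨0, (tsupport ζ)ᶜ, (isClosed_tsupport ζ).isOpen_compl.mem_nhds hx, ?_⟩
    intro y hy z hz
    simp [image_eq_zero_of_notMem_tsupport hy, image_eq_zero_of_notMem_tsupport hz]

theorem LipschitzWith.comp_locallyLipschitzOn_real {n : ℕ} {Ω : Set (Eucl n)} {K : ℝ≥0} {H : ℝ → ℝ}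
    (hH : LipschitzWith K H) {f : Eucl n → ℝ} (hf : LocallyLipschitzOn Ω f) :
    LocallyLipschitzOn Ω (fun x => H (f x)) := by
  intro x hx
  obtain ⟨K', t, ht, h⟩ := hf hx
  exact ⟨K * K', t, ht, hH.comp_lipschitzOnWith h⟩

theorem LocallyLipschitzOn.sub_real {n : ℕ} {Ω : Set (Eucl n)} {f g : Eucl n → ℝ}
    (hf : LocallyLipschitzOn Ω f) (hg : LocallyLipschitzOn Ω g) :
    LocallyLipschitzOn Ω (fun x => f x - g x) := by
  intro x hx
  obtain ⟨K, t, ht, h⟩ := hf hx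
  obtain ⟨K', t', ht', h'⟩ := hg hx
  exact ⟨K + K', t ∩ t', inter_mem ht ht',
    (h.mono Set.inter_subset_left).sub (h'.mono Set.inter_subset_right)⟩

theorem gradient_mul_comp {n : ℕ} {ζ f : Eucl n → ℝ} {H H' : ℝ → ℝ}
    (hH : ∀ z, HasDerivAt H (H' z) z) {x : Eucl n} (hζ : DifferentiableAt ℝ ζ x)
    (hf : DifferentiableAt ℝ f x) :
    ∇ (fun x => ζ x * H (f x)) x = (ζ x * H' (f x)) • ∇ f x + H (f x) • ∇ ζ x := by
  have h1 := hζ.hasFDerivAt.mul ((hH (f x)).comp_hasFDerivAt x hf.hasFDerivAt)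
  have h2 : HasFDerivAt (fun x => ζ x * H (f x)) _ x := h1
  simp only [gradient, h2.fderiv, map_add, map_smul]
  simp [smul_smul]

theorem gradient_eq_zero_of_notMem_tsupport {n : ℕ} {φ : Eucl n → ℝ} {x : Eucl n}
    (hx : x ∉ tsupport φ) : ∇ φ x = 0 := by
  have : φ =ᶠ[𝓝 x] fun _ => (0 : ℝ) := by
    filter_upwards [(isClosed_tsupport φ).isOpen_compl.mem_nhds hx] with y hy
    exact image_eq_zero_of_notMem_tsupport hy
  rw [this.gradient_eq, gradient_fun_const]

/-! ### Balls, cutoff functions and averaged norms -/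

theorem qBall_subset {n : ℕ} {Ω : Set (Eucl n)} {ρ : Eucl n → Eucl n → ℝ} {x : Eucl n} {r : ℝ} :
    qBall Ω ρ x r ⊆ Ω := fun _ h => h.1

theorem qBall_mono {n : ℕ} {Ω : Set (Eucl n)} {ρ : Eucl n → Eucl n → ℝ} {x : Eucl n} {r r' : ℝ}
    (h : r ≤ r') : qBall Ω ρ x r ⊆ qBall Ω ρ x r' := fun _ hy => ⟨hy.1, hy.2.trans_le h⟩

theorem volume_qBall_lt_top {n : ℕ} {Ω : Set (Eucl n)} {ρ : Eucl n → Eucl n → ℝ}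
    {r₁ : Eucl n → ℝ} (had : AdmissibleRadius Ω ρ r₁) {y : Eucl n} (hy : y ∈ Ω) {r : ℝ}
    (hr : 0 < r) (hr1 : r < r₁ y) : volume (qBall Ω ρ y r) < ⊤ :=
  (measure_mono subset_closure).trans_lt ((had y hy).2 r hr hr1).1.measure_lt_top

/-- Condition D_q speaks of small radii only, but a smaller concentric ball already has positive
measure. -/
theorem volume_qBall_pos {n : ℕ} {Ω : Set (Eucl n)} {ρ : Eucl n → Eucl n → ℝ}
    {r₁ : Eucl n → ℝ} (had : AdmissibleRadius Ω ρ r₁) {q c₀ : ℝ} (hc₀ : 0 < c₀)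
    (hD : DCond Ω ρ r₁ q c₀) {y : Eucl n} (hy : y ∈ Ω) {r : ℝ}
    (hr : 0 < r) : 0 < volume (qBall Ω ρ y r) := by
  have h1 := (had y hy).1
  set t := min r (min 1 (r₁ y)) / 2 with ht
  have hm : 0 < min r (min 1 (r₁ y)) := lt_min hr (lt_min one_pos h1)
  have ht0 : 0 < t := by positivity
  have htm : t < min r (min 1 (r₁ y)) := by rw [ht]; linarith
  refine lt_of_lt_of_le ?_ ((hD y hy t ht0 (htm.trans_le (min_le_right _ _))).trans
    (measure_mono (qBall_mono (htm.le.trans (min_le_left _ _)))))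
  rw [ENNReal.ofReal_pos]
  positivity

theorem IsCutoffSeq.tsupport_subset {n : ℕ} {Ω : Set (Eucl n)}
    {Q : Eucl n → Matrix (Fin n) (Fin n) ℝ} {ρ : Eucl n → Eucl n → ℝ} {τ N Ccut : ℝ}
    {sStar : ℝ≥0∞} {y : Eucl n} {r : ℝ} {η : ℕ → Eucl n → ℝ}
    (h : IsCutoffSeq Ω Q ρ τ N Ccut sStar y r η) {j : ℕ} (hj : 1 ≤ j) :
    tsupport (η j) ⊆ qBall Ω ρ y r := by
  obtain ⟨i, rfl⟩ := Nat.exists_eq_add_of_le' hj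
  rcases Nat.eq_zero_or_pos i with rfl | hi
  · exact h.supp_one
  · exact fun x hx => (h.supp_succ i hi x hx).1

theorem IsCutoffSeq.isLipCompact {n : ℕ} {Ω : Set (Eucl n)}
    {Q : Eucl n → Matrix (Fin n) (Fin n) ℝ} {ρ : Eucl n → Eucl n → ℝ} {τ N Ccut : ℝ}
    {sStar : ℝ≥0∞} {y : Eucl n} {r : ℝ} {η : ℕ → Eucl n → ℝ}
    (h : IsCutoffSeq Ω Q ρ τ N Ccut sStar y r η)
    (hcomp : IsCompact (closure (qBall Ω ρ y r))) {j : ℕ} (hj : 1 ≤ j) :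
    IsLipCompact (qBall Ω ρ y r) (η j) :=
  ⟨h.lipschitz j hj, hcomp.of_isClosed_subset (isClosed_tsupport _)
    ((h.tsupport_subset hj).trans subset_closure), h.tsupport_subset hj⟩

theorem avgNorm_eq {n : ℕ} {F : Type*} [NormedAddCommGroup F] (f : Eucl n → F)
    {α : ℝ≥0∞} (hα : α ≠ ⊤) (S : Set (Eucl n)) :
    avgNorm f α S = (volume S)⁻¹ ^ (1 / α).toReal * eLpNorm f α (volume.restrict S) := by
  rw [avgNorm, eLpNorm_smul_measure_of_ne_top hα, smul_eq_mul]

theorem avgNorm_lt_top_iff {n : ℕ} {F : Type*} [NormedAddCommGroup F] (f : Eucl n → F)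
    (α : ℝ≥0∞) {S : Set (Eucl n)} (h0 : volume S ≠ 0) (h1 : volume S ≠ ⊤) :
    avgNorm f α S < ⊤ ↔ eLpNorm f α (volume.restrict S) < ⊤ := by
  by_cases hα : α = ⊤
  · subst hα
    rw [avgNorm, eLpNorm_exponent_top, eLpNorm_exponent_top,
      eLpNormEssSup_ennreal_smul_measure (ENNReal.inv_ne_zero.2 h1)]
  · rw [avgNorm_eq f hα]
    have h2 : (volume S)⁻¹ ^ (1 / α).toReal ≠ ⊤ :=
      ENNReal.rpow_ne_top_of_nonneg ENNReal.toReal_nonneg (ENNReal.inv_ne_top.2 h0)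
    have h3 : (volume S)⁻¹ ^ (1 / α).toReal ≠ 0 := by
      simp [ENNReal.rpow_eq_zero_iff, h0, h1]
    constructor
    · intro h
      by_contra hc
      rw [not_lt, top_le_iff] at hc
      rw [hc, ENNReal.mul_top h3] at h
      exact lt_irrefl _ h
    · exact fun h => ENNReal.mul_lt_top h2.lt_top h

/-! ### Local gain of integrability -/

theorem aestronglyMeasurable_of_locallyLipschitzOn {n : ℕ} {Ω : Set (Eucl n)} (hΩ : IsOpen Ω)
    {f : Eucl n → ℝ} (hf : LocallyLipschitzOn Ω f) :
    AEStronglyMeasurable f (volume.restrict Ω) :=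
  hf.continuousOn.aestronglyMeasurable hΩ.measurableSet

theorem le_wNorm_left {n : ℕ} (Q : Eucl n → Matrix (Fin n) (Fin n) ℝ) {p : ℝ} (hp : 0 < p)
    (S : Set (Eucl n)) (w : Eucl n → ℝ) (v : Eucl n → Eucl n) :
    eLpNorm w (ENNReal.ofReal p) (volume.restrict S) ≤ wNorm Q p S w v := by
  rw [wNorm, one_div, ENNReal.le_rpow_inv_iff hp]
  exact le_self_add

theorem le_wNorm_right {n : ℕ} (Q : Eucl n → Matrix (Fin n) (Fin n) ℝ) {p : ℝ} (hp : 0 < p)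
    (S : Set (Eucl n)) (w : Eucl n → ℝ) (v : Eucl n → Eucl n) :
    eLpNorm (fun x => sqrtApply (Q x) (v x)) (ENNReal.ofReal p) (volume.restrict S) ≤
      wNorm Q p S w v := by
  rw [wNorm, one_div, ENNReal.le_rpow_inv_iff hp]
  exact le_add_self

theorem wNorm_le_add {n : ℕ} (Q : Eucl n → Matrix (Fin n) (Fin n) ℝ) {p : ℝ} (hp : 1 ≤ p)
    (S : Set (Eucl n)) (w : Eucl n → ℝ) (v : Eucl n → Eucl n) :
    wNorm Q p S w v ≤ eLpNorm w (ENNReal.ofReal p) (volume.restrict S) +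
      eLpNorm (fun x => sqrtApply (Q x) (v x)) (ENNReal.ofReal p) (volume.restrict S) :=
  ENNReal.rpow_add_rpow_le_add _ _ hp

theorem isQLimit_const {n : ℕ} {Q : Eucl n → Matrix (Fin n) (Fin n) ℝ} {p : ℝ}
    {S : Set (Eucl n)} {φ : Eucl n → ℝ} (hφ : IsLipCompact S φ) : MemWQZero Q p S φ (∇ φ) := by
  refine ⟨fun _ => φ, fun _ => hφ, ?_, (measurable_gradient φ).aestronglyMeasurable, ?_, ?_⟩
  · obtain ⟨⟨K, hK⟩, -⟩ := hφ
    exact hK.continuous.aestronglyMeasurable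
  · simp
  · simp [sqrtApply_zero]

theorem holderTriple_mul {t t' P : ℝ≥0∞} (htt : t⁻¹ + t'⁻¹ = 1) (hP0 : P ≠ 0) (hP : P ≠ ⊤) :
    ENNReal.HolderTriple (t * P) (t' * P) P := by
  refine ⟨?_⟩
  rw [ENNReal.mul_inv (Or.inr hP) (Or.inr hP0), ENNReal.mul_inv (Or.inr hP) (Or.inr hP0),
    ← add_mul, htt, one_mul]

/-- The Sobolev inequality requires compact support, so it is applied to η₁f on B(y, r/τ), with η₁ =
1 on B(y,r). This ball is admissible because r < τ r₁(y). The term f √Q∇η₁ is split by Hölder with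
exponents t'p and tp, which is the role of the local integrability condition. The constant is purely
qualitative and does not enter the final estimate. -/
theorem exists_local_gain {n : ℕ} {p σ τ N CS Ccut q c₀ : ℝ} {sStar t t' : ℝ≥0∞}
    {Ω : Set (Eucl n)} {Q : Eucl n → Matrix (Fin n) (Fin n) ℝ}
    {ρ : Eucl n → Eucl n → ℝ} {r₁ : Eucl n → ℝ}
    (hp : 1 < p) (hτ : 0 < τ) (hτ1 : τ < 1) (hc₀ : 0 < c₀)
    (hΩ : IsOpen Ω) (hQ : IsDegenerateForm Ω p Q)
    (hρ : IsQuasimetric Ω ρ) (had : AdmissibleRadius Ω ρ r₁)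
    (hSob : SobolevEstimate Ω Q ρ r₁ p σ CS) (htt : t⁻¹ + t'⁻¹ = 1)
    (hcut : CutoffCond Ω Q ρ r₁ p τ N Ccut sStar t)
    (hloc : LocalIntegrabilityCond Ω Q ρ r₁ p t') (hD : DCond Ω ρ r₁ q c₀)
    {y : Eucl n} (hy : y ∈ Ω) {r : ℝ} (hr : 0 < r) (hrτ : r < τ * r₁ y) :
    ∃ C : ℝ≥0, ∀ f : Eucl n → ℝ, LocallyLipschitzOn Ω f →
      eLpNorm f (ENNReal.ofReal (p * σ)) (volume.restrict (qBall Ω ρ y r)) ≤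
        C * wNorm Q p Ω f (∇ f) := by
  have hp0 : 0 < p := one_pos.trans hp
  have hP0 : ENNReal.ofReal p ≠ 0 := by simpa using hp0
  have hr' : 0 < r / τ := by positivity
  have hr1 : r / τ < r₁ y := by rwa [div_lt_iff₀ hτ, mul_comm]
  have hrr : τ * (r / τ) = r := by field_simp
  obtain ⟨η, hη, hηt⟩ := hcut y hy (r / τ) hr' hr1
  obtain ⟨c₂, hc₂⟩ := hloc y hy (r / τ) hr' hr1
  have hηL := hη.isLipCompact ((had y hy).2 _ hr' hr1).1 le_rfl
  have hsob := hSob y hy (r / τ) hr' hr1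
  set B := qBall Ω ρ y (r / τ) with hB
  have hBm : NullMeasurableSet B volume := hρ.measurable_ball y hy _ hr'
  have hBΩ : B ⊆ Ω := qBall_subset
  have hBB : qBall Ω ρ y r ⊆ B := qBall_mono (by rw [le_div_iff₀ hτ]; nlinarith)
  have h0 : volume B ≠ 0 := (volume_qBall_pos had hc₀ hD hy hr').ne'
  have h1 : volume B ≠ ⊤ := (volume_qBall_lt_top had hy hr' hr1).ne
  set a := (volume B)⁻¹ ^ (1 / ENNReal.ofReal (p * σ)).toReal with ha
  set b := (volume B)⁻¹ ^ (1 / ENNReal.ofReal p).toReal with hb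
  have ha0 : a ≠ 0 := by simp [ha, ENNReal.rpow_eq_zero_iff, h0, h1]
  have haT : a ≠ ⊤ :=
    ENNReal.rpow_ne_top_of_nonneg ENNReal.toReal_nonneg (ENNReal.inv_ne_top.2 h0)
  have hbT : b ≠ ⊤ :=
    ENNReal.rpow_ne_top_of_nonneg ENNReal.toReal_nonneg (ENNReal.inv_ne_top.2 h0)
  set E := eLpNorm (fun x => sqrtApply (Q x) (∇ (η 1) x)) (t * ENNReal.ofReal p)
    (volume.restrict B) with hE
  have hET : E ≠ ⊤ := (hηt 1 le_rfl).ne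
  set C := a⁻¹ * (ENNReal.ofReal CS * (ENNReal.ofReal (r / τ) * (b * (E * c₂ + 1)) + b)) with hC
  have hCT : C ≠ ⊤ := by finiteness
  refine ⟨C.toNNReal, fun f hf => ?_⟩
  rw [ENNReal.coe_toNNReal hCT]
  set W := wNorm Q p Ω f (∇ f) with hW
  have hφ := hηL.mul_locallyLipschitzOn hΩ hBΩ hf
  have key := hsob _ _ (isQLimit_const (Q := Q) (p := p) hφ)
  rw [avgNorm_eq _ ENNReal.ofReal_ne_top, avgNorm_eq _ ENNReal.ofReal_ne_top,
    avgNorm_eq _ ENNReal.ofReal_ne_top, ← ha, ← hb] at key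
  have hfm := (aestronglyMeasurable_of_locallyLipschitzOn hΩ hf).mono_measure
    (Measure.restrict_mono hBΩ le_rfl)
  have hμ : (volume.restrict B : Measure (Eucl n)) ≤ volume.restrict Ω :=
    Measure.restrict_mono hBΩ le_rfl
  have e1 : eLpNorm f (ENNReal.ofReal (p * σ)) (volume.restrict (qBall Ω ρ y r)) ≤
      eLpNorm (fun x => η 1 x * f x) (ENNReal.ofReal (p * σ)) (volume.restrict B) := by
    refine le_trans (eLpNorm_mono_ae ?_) (eLpNorm_mono_measure _ (Measure.restrict_mono hBB le_rfl))
    filter_upwards [ae_restrict_mem₀ (hρ.measurable_ball y hy r hr)] with x hx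
    rw [(hη.eq_one 1 le_rfl x (by rwa [hrr])).2, one_mul]
  have e2 : eLpNorm (fun x => η 1 x * f x) (ENNReal.ofReal p) (volume.restrict B) ≤ W := by
    refine le_trans (eLpNorm_mono fun x => ?_) ((eLpNorm_mono_measure f hμ).trans
      (le_wNorm_left Q hp0 Ω f (∇ f)))
    rw [norm_mul, Real.norm_of_nonneg (hη.nonneg 1 le_rfl x)]
    exact mul_le_of_le_one_left (norm_nonneg _) (hη.le_one 1 le_rfl x)
  have e3 : eLpNorm (fun x => sqrtApply (Q x) (∇ (fun x => η 1 x * f x) x)) (ENNReal.ofReal p)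
      (volume.restrict B) ≤ E * (c₂ * W) + W := by
    have hg : (fun x => sqrtApply (Q x) (∇ (fun x => η 1 x * f x) x)) =ᵐ[volume.restrict B]
        (f • fun x => sqrtApply (Q x) (∇ (η 1) x)) +
          fun x => η 1 x • sqrtApply (Q x) (∇ f x) := by
      obtain ⟨⟨K, hK⟩, -⟩ := hηL
      have d1 := ae_mono hμ (ae_differentiableAt_of_locallyLipschitzOn hΩ hf)
      have d2 : ∀ᵐ x ∂(volume.restrict B), DifferentiableAt ℝ (η 1) x :=
        ae_restrict_of_ae hK.ae_differentiableAt
      filter_upwards [d1, d2] with x hx1 hx2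
      have hG := gradient_mul_comp (H := id) (H' := fun _ => 1) (fun z => hasDerivAt_id z) hx2 hx1
      simp only [id] at hG
      rw [hG]
      simp only [Pi.add_apply, Pi.smul_apply', sqrtApply_add, sqrtApply_smul, mul_one]
      rw [add_comm]
    have m1 := aestronglyMeasurable_sqrtApply hΩ hQ hBΩ
      (measurable_gradient (η 1)).aestronglyMeasurable
    have m2 := aestronglyMeasurable_sqrtApply hΩ hQ hBΩ
      (measurable_gradient f).aestronglyMeasurable
    have m3 : AEStronglyMeasurable (η 1) (volume.restrict B) := by
      obtain ⟨⟨K, hK⟩, -⟩ := hηL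
      exact hK.continuous.aestronglyMeasurable
    rw [eLpNorm_congr_ae hg]
    refine (eLpNorm_add_le (hfm.smul m1) (m3.smul m2)
      (by rw [← ENNReal.ofReal_one]; exact ENNReal.ofReal_le_ofReal hp.le)).trans
      (add_le_add ?_ ?_)
    · have := holderTriple_mul (add_comm t⁻¹ t'⁻¹ ▸ htt) hP0 ENNReal.ofReal_ne_top
      refine (eLpNorm_smul_le_mul_eLpNorm (p := t' * ENNReal.ofReal p)
        (q := t * ENNReal.ofReal p) m1 hfm).trans ?_
      rw [mul_comm]
      exact mul_le_mul' le_rfl (hc₂ f hf)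
    · refine le_trans (eLpNorm_mono fun x => ?_) ((eLpNorm_mono_measure _ hμ).trans
        (le_wNorm_right Q hp0 Ω f (∇ f)))
      rw [Pi.smul_apply', norm_smul, Real.norm_of_nonneg (hη.nonneg 1 le_rfl x)]
      exact mul_le_of_le_one_left (norm_nonneg _) (hη.le_one 1 le_rfl x)
  calc eLpNorm f (ENNReal.ofReal (p * σ)) (volume.restrict (qBall Ω ρ y r))
      ≤ a⁻¹ * (a * eLpNorm (fun x => η 1 x * f x) (ENNReal.ofReal (p * σ))
          (volume.restrict B)) := by
        rw [← mul_assoc, ENNReal.inv_mul_cancel ha0 haT, one_mul]; exact e1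
    _ ≤ a⁻¹ * (ENNReal.ofReal CS * (ENNReal.ofReal (r / τ) * (b * (E * (c₂ * W) + W)) + b * W)) := by
        refine mul_le_mul' le_rfl (key.trans ?_)
        gcongr
    _ = C * W := by rw [hC]; ring

/-- The gain applied to f_k - f_j makes the approximants Cauchy in L^q(B). Fatou's lemma along an
almost everywhere convergent subsequence f_(n_j) then bounds f_k - u. -/
theorem MemWQ.tendsto_of_gain {n : ℕ} {p : ℝ} {Q : Eucl n → Matrix (Fin n) (Fin n) ℝ}
    {Ω B : Set (Eucl n)} (hp : 1 < p) (hΩ : IsOpen Ω) (hQ : IsDegenerateForm Ω p Q)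
    (hB : B ⊆ Ω) {q : ℝ≥0∞} (hq1 : 1 ≤ q) {C : ℝ≥0}
    (hC : ∀ f : Eucl n → ℝ, LocallyLipschitzOn Ω f →
      eLpNorm f q (volume.restrict B) ≤ C * wNorm Q p Ω f (∇ f))
    {f : ℕ → Eucl n → ℝ} {u : Eucl n → ℝ} {v : Eucl n → Eucl n}
    (hf : ∀ k, LocallyLipschitzOn Ω (f k) ∧ wNorm Q p Ω (f k) (∇ (f k)) < ⊤)
    (hlim : IsQLimit Q p Ω f u v) :
    Tendsto (fun k => eLpNorm (fun x => f k x - u x) q (volume.restrict B)) atTop (𝓝 0) ∧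
      eLpNorm u q (volume.restrict B) < ⊤ := by
  have hp0 : 0 < p := one_pos.trans hp
  have hP0 : ENNReal.ofReal p ≠ 0 := by simpa using hp0
  have hP1 : 1 ≤ ENNReal.ofReal p := by
    rw [← ENNReal.ofReal_one]; exact ENNReal.ofReal_le_ofReal hp.le
  obtain ⟨hum, hvm, hl1, hl2⟩ := hlim
  have hμ : (volume.restrict B : Measure (Eucl n)) ≤ volume.restrict Ω :=
    Measure.restrict_mono hB le_rfl
  have hfm : ∀ k, AEStronglyMeasurable (f k) (volume.restrict Ω) := fun k =>
    aestronglyMeasurable_of_locallyLipschitzOn hΩ (hf k).1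
  have hgm : ∀ k, AEStronglyMeasurable (fun x => sqrtApply (Q x) (∇ (f k) x - v x))
      (volume.restrict Ω) := fun k => aestronglyMeasurable_sqrtApply hΩ hQ le_rfl
        ((measurable_gradient (f k)).aestronglyMeasurable.sub hvm)
  set a : ℕ → ℝ≥0∞ := fun k => eLpNorm (fun x => f k x - u x) (ENNReal.ofReal p)
      (volume.restrict Ω) + eLpNorm (fun x => sqrtApply (Q x) (∇ (f k) x - v x))
      (ENNReal.ofReal p) (volume.restrict Ω) with ha
  have hat : Tendsto a atTop (𝓝 0) := by simpa using hl1.add hl2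
  have hd : ∀ k j, eLpNorm (fun x => f k x - f j x) q (volume.restrict B) ≤ C * (a k + a j) := by
    intro k j
    refine (hC _ ((hf k).1.sub_real (hf j).1)).trans (mul_le_mul' le_rfl
      ((wNorm_le_add Q hp.le Ω _ _).trans ?_))
    have g1 : eLpNorm (fun x => f k x - f j x) (ENNReal.ofReal p) (volume.restrict Ω) ≤
        eLpNorm (fun x => f k x - u x) (ENNReal.ofReal p) (volume.restrict Ω) +
        eLpNorm (fun x => f j x - u x) (ENNReal.ofReal p) (volume.restrict Ω) := by
      refine le_trans (le_of_eq ?_) (eLpNorm_sub_le ((hfm k).sub hum) ((hfm j).sub hum) hP1)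
      congr 1; ext x; simp
    have g2 : eLpNorm (fun x => sqrtApply (Q x) (∇ (fun x => f k x - f j x) x))
        (ENNReal.ofReal p) (volume.restrict Ω) ≤
        eLpNorm (fun x => sqrtApply (Q x) (∇ (f k) x - v x)) (ENNReal.ofReal p)
          (volume.restrict Ω) +
        eLpNorm (fun x => sqrtApply (Q x) (∇ (f j) x - v x)) (ENNReal.ofReal p)
          (volume.restrict Ω) := by
      refine le_trans (le_of_eq (eLpNorm_congr_ae ?_)) (eLpNorm_sub_le (hgm k) (hgm j) hP1)
      filter_upwards [ae_differentiableAt_of_locallyLipschitzOn hΩ (hf k).1,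
        ae_differentiableAt_of_locallyLipschitzOn hΩ (hf j).1] with x h1 h2
      have h3 : ∇ (fun x => f k x - f j x) x = ∇ (f k) x - ∇ (f j) x := by
        simp only [gradient]
        rw [fderiv_fun_sub h1 h2, map_sub]
      rw [h3, Pi.sub_apply, ← sqrtApply_sub, sub_sub_sub_cancel_right]
    calc _ ≤ _ := add_le_add g1 g2
      _ = a k + a j := by simp only [ha]; ring
  obtain ⟨ns, hns, hae⟩ := (tendstoInMeasure_of_tendsto_eLpNorm hP0 hfm hum
    (by simpa [Pi.sub_def] using hl1)).exists_seq_tendsto_ae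
  have hk : ∀ k, eLpNorm (fun x => f k x - u x) q (volume.restrict B) ≤ C * a k := by
    intro k
    have h1 : eLpNorm (fun x => f k x - u x) q (volume.restrict B) ≤
        liminf (fun j => eLpNorm (fun x => f k x - f (ns j) x) q (volume.restrict B)) atTop := by
      refine Lp.eLpNorm_lim_le_liminf_eLpNorm (fun j => ((hfm k).sub (hfm _)).mono_measure hμ) _ ?_
      filter_upwards [ae_mono hμ hae] with x hx
      exact hx.const_sub _
    have h2 : Tendsto (fun j => (C : ℝ≥0∞) * (a k + a (ns j))) atTop (𝓝 (C * (a k + 0))) :=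
      ENNReal.Tendsto.const_mul (tendsto_const_nhds.add (hat.comp hns.tendsto_atTop))
        (Or.inr ENNReal.coe_ne_top)
    rw [add_zero] at h2
    rw [← h2.liminf_eq]
    exact h1.trans (liminf_le_liminf (Eventually.of_forall fun j => hd k (ns j)))
  have ht : Tendsto (fun k => eLpNorm (fun x => f k x - u x) q (volume.restrict B))
      atTop (𝓝 0) := by
    have : Tendsto (fun k => (C : ℝ≥0∞) * a k) atTop (𝓝 0) := by
      simpa using ENNReal.Tendsto.const_mul hat (Or.inr (ENNReal.coe_ne_top (r := C)))
    exact tendsto_of_tendsto_of_tendsto_of_le_of_le tendsto_const_nhds this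
      (fun _ => zero_le) hk
  refine ⟨ht, ?_⟩
  obtain ⟨k, hk1⟩ := (ht.eventually_lt_const one_pos).exists
  have : u = fun x => f k x - (f k x - u x) := by ext x; ring
  rw [this]
  refine (eLpNorm_sub_le ((hfm k).mono_measure hμ) (((hfm k).sub hum).mono_measure hμ)
    hq1).trans_lt (ENNReal.add_lt_top.2 ⟨?_, hk1.trans ENNReal.one_lt_top⟩)
  exact (hC _ (hf k).1).trans_lt (ENNReal.mul_lt_top ENNReal.coe_lt_top (hf k).2)

/-! ### Composition with `C¹` functions and products with cutoff functions -/

theorem tendsto_eLpNorm_smul_zero {α : Type*} [MeasurableSpace α] {μ : Measure α} {F : Type*}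
    [NormedAddCommGroup F] [NormedSpace ℝ F] {p : ℝ} (hp : 0 < p) {g : α → F}
    (hgm : AEStronglyMeasurable g μ) (hg : eLpNorm g (ENNReal.ofReal p) μ < ⊤)
    {a : ℕ → α → ℝ} (ham : ∀ k, AEStronglyMeasurable (a k) μ) {M : ℝ}
    (haM : ∀ k x, |a k x| ≤ M) (ha : ∀ᵐ x ∂μ, Tendsto (fun k => a k x) atTop (𝓝 0)) :
    Tendsto (fun k => eLpNorm (fun x => a k x • g x) (ENNReal.ofReal p) μ) atTop (𝓝 0) := by
  have hP0 : ENNReal.ofReal p ≠ 0 := by simpa using hp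
  have hPT : ENNReal.ofReal p ≠ ⊤ := ENNReal.ofReal_ne_top
  simp only [eLpNorm_eq_lintegral_rpow_enorm_toReal hP0 hPT, ENNReal.toReal_ofReal hp.le]
  have key : Tendsto (fun k => ∫⁻ x, ‖a k x • g x‖ₑ ^ p ∂μ) atTop (𝓝 (∫⁻ _, 0 ∂μ)) := by
    refine tendsto_lintegral_of_dominated_convergence'
      (fun x => (ENNReal.ofReal M * ‖g x‖ₑ) ^ p) ?_ ?_ ?_ ?_
    · exact fun k => ((ham k).smul hgm).enorm.pow_const _
    · refine fun k => Eventually.of_forall fun x => ?_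
      simp only [enorm_smul]
      gcongr
      rw [← ofReal_norm]
      exact ENNReal.ofReal_le_ofReal (haM k x)
    · simp_rw [ENNReal.mul_rpow_of_nonneg _ _ hp.le]
      rw [lintegral_const_mul'' _ (hgm.enorm.pow_const _)]
      refine ENNReal.mul_ne_top (by finiteness) ?_
      have := (eLpNorm_lt_top_iff_lintegral_rpow_enorm_lt_top hP0 hPT).1 hg
      rw [ENNReal.toReal_ofReal hp.le] at this
      exact this.ne
    · filter_upwards [ha] with x hx
      have h1 : Tendsto (fun k => a k x • g x) atTop (𝓝 0) := by
        simpa using hx.smul_const (g x)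
      have h2 := (h1.enorm).ennrpow_const p
      simpa [ENNReal.zero_rpow_of_pos hp] using h2
  rw [lintegral_zero] at key
  have h3 := key.ennrpow_const (1 / p)
  rwa [ENNReal.zero_rpow_of_pos (by positivity)] at h3

theorem lipschitzWith_of_hasDerivAt {H H' : ℝ → ℝ} (hH : ∀ z, HasDerivAt H (H' z) z) {L : ℝ≥0}
    (hL : ∀ z, |H' z| ≤ L) : LipschitzWith L H :=
  lipschitzWith_of_nnnorm_deriv_le (fun z => (hH z).differentiableAt) fun z => by
    rw [(hH z).deriv]
    exact_mod_cast hL z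

/-- The difference of gradients has three parts. ζH'(f_k)√Q(∇f_k - v) tends to zero because H' is
bounded. ζ(H'(f_k) - H'(u))√Qv does so by dominated convergence. (H(f_k) - H(u))√Q∇ζ does so by
Hölder with exponents sp and s'p, which is why convergence in L^(sp) is required. -/
theorem isQLimit_mul_comp {n : ℕ} {p : ℝ} {s s' : ℝ≥0∞} (hp : 1 < p) (hss : s⁻¹ + s'⁻¹ = 1)
    {Ω B : Set (Eucl n)} {Q : Eucl n → Matrix (Fin n) (Fin n) ℝ} (hΩ : IsOpen Ω)
    (hQ : IsDegenerateForm Ω p Q) (hB : B ⊆ Ω)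
    {f : ℕ → Eucl n → ℝ} {u : Eucl n → ℝ} {v : Eucl n → Eucl n}
    (hf : ∀ k, LocallyLipschitzOn Ω (f k)) (hlim : IsQLimit Q p Ω f u v)
    (hv : eLpNorm (fun x => sqrtApply (Q x) (v x)) (ENNReal.ofReal p) (volume.restrict B) < ⊤)
    (hae : ∀ᵐ x ∂(volume.restrict B), Tendsto (fun k => f k x) atTop (𝓝 (u x)))
    (hs : Tendsto (fun k => eLpNorm (fun x => f k x - u x) (s * ENNReal.ofReal p)
      (volume.restrict B)) atTop (𝓝 0))
    {ζ : Eucl n → ℝ} (hζ : IsLipCompact B ζ)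
    (hE : eLpNorm (fun x => sqrtApply (Q x) (∇ ζ x)) (s' * ENNReal.ofReal p)
      (volume.restrict B) < ⊤)
    {H H' : ℝ → ℝ} (hH : ∀ z, HasDerivAt H (H' z) z) (hH' : Continuous H') {L : ℝ≥0}
    (hL : ∀ z, |H' z| ≤ L) :
    (∀ k, IsLipCompact B (fun x => ζ x * H (f k x))) ∧
    IsQLimit Q p B (fun k x => ζ x * H (f k x)) (fun x => ζ x * H (u x))
      (fun x => (ζ x * H' (u x)) • v x + H (u x) • ∇ ζ x) := by
  have hHL := lipschitzWith_of_hasDerivAt hH hL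
  have hp0 : 0 < p := one_pos.trans hp
  have hP0 : ENNReal.ofReal p ≠ 0 := by simpa using hp0
  have hP1 : 1 ≤ ENNReal.ofReal p := by
    rw [← ENNReal.ofReal_one]; exact ENNReal.ofReal_le_ofReal hp.le
  have hμ : (volume.restrict B : Measure (Eucl n)) ≤ volume.restrict Ω :=
    Measure.restrict_mono hB le_rfl
  obtain ⟨hum, hvm, hl1, hl2⟩ := hlim
  have hum := hum.mono_measure hμ
  have hvm := hvm.mono_measure hμ
  have hfm : ∀ k, AEStronglyMeasurable (f k) (volume.restrict B) := fun k =>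
    (aestronglyMeasurable_of_locallyLipschitzOn hΩ (hf k)).mono_measure hμ
  obtain ⟨⟨K, hK⟩, hζc, -⟩ := id hζ
  have hζm : AEStronglyMeasurable ζ (volume.restrict B) := hK.continuous.aestronglyMeasurable
  obtain ⟨Z, hZ⟩ := hζc.exists_bound_of_continuous hK.continuous
  have hZ0 : 0 ≤ Z := (norm_nonneg _).trans (hZ 0)
  have hHu : AEStronglyMeasurable (fun x => H (u x)) (volume.restrict B) :=
    hHL.continuous.comp_aestronglyMeasurable hum
  have hHf : ∀ k, AEStronglyMeasurable (fun x => H (f k x)) (volume.restrict B) := fun k =>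
    hHL.continuous.comp_aestronglyMeasurable (hfm k)
  have hH'u : AEStronglyMeasurable (fun x => H' (u x)) (volume.restrict B) :=
    hH'.comp_aestronglyMeasurable hum
  have hH'f : ∀ k, AEStronglyMeasurable (fun x => H' (f k x)) (volume.restrict B) := fun k =>
    hH'.comp_aestronglyMeasurable (hfm k)
  have hsv := aestronglyMeasurable_sqrtApply hΩ hQ hB hvm
  have hsζ := aestronglyMeasurable_sqrtApply hΩ hQ hB (measurable_gradient ζ).aestronglyMeasurable
  have hsd : ∀ k, AEStronglyMeasurable (fun x => sqrtApply (Q x) (∇ (f k) x - v x))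
      (volume.restrict B) := fun k => aestronglyMeasurable_sqrtApply hΩ hQ hB
        ((measurable_gradient (f k)).aestronglyMeasurable.sub hvm)
  have hl1' : Tendsto (fun k => eLpNorm (fun x => f k x - u x) (ENNReal.ofReal p)
      (volume.restrict B)) atTop (𝓝 0) :=
    tendsto_of_tendsto_of_tendsto_of_le_of_le tendsto_const_nhds hl1 (fun _ => zero_le)
      fun k => eLpNorm_mono_measure _ hμ
  have hl2' : Tendsto (fun k => eLpNorm (fun x => sqrtApply (Q x) (∇ (f k) x - v x))
      (ENNReal.ofReal p) (volume.restrict B)) atTop (𝓝 0) :=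
    tendsto_of_tendsto_of_tendsto_of_le_of_le tendsto_const_nhds hl2 (fun _ => zero_le)
      fun k => eLpNorm_mono_measure _ hμ
  have hHd : ∀ a b, |H a - H b| ≤ L * |a - b| := fun a b => by
    simpa [Real.dist_eq] using hHL.dist_le_mul a b
  refine ⟨fun k => hζ.mul_locallyLipschitzOn hΩ hB (hHL.comp_locallyLipschitzOn_real (hf k)),
    hζm.mul hHu, ((hζm.mul hH'u).smul hvm).add
      (hHu.smul (measurable_gradient ζ).aestronglyMeasurable), ?_, ?_⟩
  · have h1 : ∀ k, eLpNorm (fun x => ζ x * H (f k x) - ζ x * H (u x)) (ENNReal.ofReal p)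
        (volume.restrict B) ≤ ENNReal.ofReal (Z * L) *
          eLpNorm (fun x => f k x - u x) (ENNReal.ofReal p) (volume.restrict B) := by
      intro k
      refine eLpNorm_le_mul_eLpNorm_of_ae_le_mul (Eventually.of_forall fun x => ?_) _
      rw [← mul_sub, norm_mul, mul_assoc]
      exact mul_le_mul (hZ x) (hHd _ _) (norm_nonneg _) hZ0
    have h2 := ENNReal.Tendsto.const_mul (a := ENNReal.ofReal (Z * L)) hl1'
      (Or.inr ENNReal.ofReal_ne_top)
    rw [mul_zero] at h2
    exact tendsto_of_tendsto_of_tendsto_of_le_of_le tendsto_const_nhds h2 (fun _ => zero_le) h1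
  · have t1 := ENNReal.Tendsto.const_mul (a := ENNReal.ofReal (Z * L)) hl2'
      (Or.inr ENNReal.ofReal_ne_top)
    have t2 : Tendsto (fun k => eLpNorm (fun x => (ζ x * (H' (f k x) - H' (u x))) •
        sqrtApply (Q x) (v x)) (ENNReal.ofReal p) (volume.restrict B)) atTop (𝓝 0) := by
      refine tendsto_eLpNorm_smul_zero (M := Z * (L + L)) hp0 hsv hv
        (fun k => hζm.mul ((hH'f k).sub hH'u)) (fun k x => ?_) ?_
      · rw [abs_mul]
        exact mul_le_mul (hZ x) ((abs_sub _ _).trans (add_le_add (hL _) (hL _)))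
          (abs_nonneg _) hZ0
      · filter_upwards [hae] with x hx
        have := ((hH'.tendsto _).comp hx).sub_const (H' (u x))
        simpa using this.const_mul (ζ x)
    have t3 := ENNReal.Tendsto.mul_const (b := ENNReal.ofReal L *
      eLpNorm (fun x => sqrtApply (Q x) (∇ ζ x)) (s' * ENNReal.ofReal p) (volume.restrict B)) hs
      (Or.inr (ENNReal.mul_ne_top ENNReal.ofReal_ne_top hE.ne))
    have t4 := (t1.add t2).add t3
    simp only [mul_zero, zero_mul, add_zero] at t4
    refine tendsto_of_tendsto_of_tendsto_of_le_of_le tendsto_const_nhds t4 (fun _ => zero_le)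
      fun k => ?_
    have hg : (fun x => sqrtApply (Q x) (∇ (fun x => ζ x * H (f k x)) x -
        ((ζ x * H' (u x)) • v x + H (u x) • ∇ ζ x))) =ᵐ[volume.restrict B]
        ((fun x => (ζ x * H' (f k x)) • sqrtApply (Q x) (∇ (f k) x - v x)) +
        fun x => (ζ x * (H' (f k x) - H' (u x))) • sqrtApply (Q x) (v x)) +
        ((fun x => H (f k x) - H (u x)) • fun x => sqrtApply (Q x) (∇ ζ x)) := by
      have d1 := ae_mono hμ (ae_differentiableAt_of_locallyLipschitzOn hΩ (hf k))
      have d2 : ∀ᵐ x ∂(volume.restrict B), DifferentiableAt ℝ ζ x :=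
        ae_restrict_of_ae hK.ae_differentiableAt
      filter_upwards [d1, d2] with x hx1 hx2
      rw [gradient_mul_comp hH hx2 hx1]
      simp only [Pi.add_apply, Pi.smul_apply', ← sqrtApply_smul, ← sqrtApply_add]
      congr 1
      module
    rw [eLpNorm_congr_ae hg]
    refine (eLpNorm_add_le (((hζm.mul (hH'f k)).smul (hsd k)).add
      ((hζm.mul ((hH'f k).sub hH'u)).smul hsv)) (((hHf k).sub hHu).smul hsζ) hP1).trans
      (add_le_add ((eLpNorm_add_le ((hζm.mul (hH'f k)).smul (hsd k))
        ((hζm.mul ((hH'f k).sub hH'u)).smul hsv) hP1).trans (add_le_add ?_ le_rfl)) ?_)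
    · refine eLpNorm_le_mul_eLpNorm_of_ae_le_mul (Eventually.of_forall fun x => ?_) _
      rw [Pi.smul_apply', norm_smul]
      gcongr
      rw [Pi.mul_apply, norm_mul]
      exact mul_le_mul (hZ x) (hL _) (norm_nonneg _) hZ0
    · have := holderTriple_mul hss hP0 ENNReal.ofReal_ne_top
      refine (eLpNorm_smul_le_mul_eLpNorm (p := s * ENNReal.ofReal p)
        (q := s' * ENNReal.ofReal p) hsζ ((hHf k).sub hHu)).trans ?_
      rw [← mul_assoc]
      refine mul_le_mul' ?_ le_rfl
      rw [mul_comm (eLpNorm _ _ _)]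
      have hb : ∀ x, ‖H (f k x) - H (u x)‖ ≤ L * ‖f k x - u x‖ := fun x => hHd _ _
      have := eLpNorm_le_mul_eLpNorm_of_ae_le_mul (μ := volume.restrict B)
        (Eventually.of_forall hb) (s * ENNReal.ofReal p)
      simpa only [Pi.sub_def] using this

/-- The weak formulation extends to the test functions `ζ G(u)`. -/
theorem integral_weak_eq_zero {n : ℕ} {p : ℝ} {P' R R' : ℝ≥0∞} (hp : 1 < p)
    [ENNReal.HolderTriple (ENNReal.ofReal p) P' 1] [ENNReal.HolderTriple R R' 1]
    {Ω B : Set (Eucl n)} {Q : Eucl n → Matrix (Fin n) (Fin n) ℝ} (hΩ : IsOpen Ω)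
    (hQ : IsDegenerateForm Ω p Q) (hB : B ⊆ Ω)
    {A A' : Eucl n → ℝ → Eucl n → Eucl n} {Bf : Eucl n → ℝ → Eucl n → ℝ}
    {u : Eucl n → ℝ} {v : Eucl n → Eucl n} (hu : IsWeakSolution Ω Q p A Bf u v)
    (hA : ∀ᵐ x ∂(volume.restrict B), A x (u x) (v x) = sqrtApply (Q x) (A' x (u x) (v x)))
    {D₁ D₂ : Eucl n → ℝ} (hD₁ : MemLp D₁ P' (volume.restrict B))
    (hD₂ : MemLp D₂ R' (volume.restrict B))
    (hA' : ∀ᵐ x ∂(volume.restrict B), ‖A' x (u x) (v x)‖ ≤ D₁ x)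
    (hBf : ∀ᵐ x ∂(volume.restrict B), |Bf x (u x) (v x)| ≤ D₂ x)
    {φ : ℕ → Eucl n → ℝ} {w : Eucl n → ℝ} {X : Eucl n → Eucl n}
    (hφ : ∀ k, IsLipCompact B (φ k)) (hlim : IsQLimit Q p B φ w X)
    (hae : ∀ᵐ x ∂(volume.restrict B), Tendsto (fun k => φ k x) atTop (𝓝 (w x)))
    (hR : Tendsto (fun k => eLpNorm (fun x => φ k x - w x) R (volume.restrict B)) atTop (𝓝 0)) :
    Integrable (fun x => inner ℝ (sqrtApply (Q x) (X x)) (A' x (u x) (v x)) +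
      w x * Bf x (u x) (v x)) (volume.restrict B) ∧
    ∫ x in B, (inner ℝ (sqrtApply (Q x) (X x)) (A' x (u x) (v x)) +
      w x * Bf x (u x) (v x)) = 0 := by
  have hp0 : 0 < p := one_pos.trans hp
  have hP0 : ENNReal.ofReal p ≠ 0 := by simpa using hp0
  obtain ⟨hwm, hXm, -, hl⟩ := hlim
  have hφm : ∀ k, AEStronglyMeasurable (φ k) (volume.restrict B) := fun k => by
    obtain ⟨⟨K, hK⟩, -⟩ := hφ k
    exact hK.continuous.aestronglyMeasurable
  set m := volume.restrict B with hm
  set I : Eucl n → ℝ := fun x => inner ℝ (sqrtApply (Q x) (X x)) (A' x (u x) (v x)) +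
    w x * Bf x (u x) (v x) with hI
  set J : ℕ → Eucl n → ℝ := fun k x => inner ℝ (∇ (φ k) x) (A x (u x) (v x)) +
    φ k x * Bf x (u x) (v x) with hJ
  have hJ1 : ∀ k, Integrable (J k) m ∧ ∫ x, J k x ∂m = 0 := by
    intro k
    have h := hu.2 (φ k) ⟨(hφ k).1, (hφ k).2.1, (hφ k).2.2.trans hB⟩
    refine ⟨h.1.mono_set hB, ?_⟩
    rw [← h.2, hm]
    refine (setIntegral_eq_of_subset_of_ae_sdiff_eq_zero hΩ.measurableSet.nullMeasurableSet hB
      (Eventually.of_forall fun x hx => ?_)).symm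
    have h1 : x ∉ tsupport (φ k) := fun h => hx.2 ((hφ k).2.2 h)
    simp only [hJ]
    rw [gradient_eq_zero_of_notMem_tsupport h1, image_eq_zero_of_notMem_tsupport h1]
    simp
  have hJ2 : ∀ k, ∀ᵐ x ∂m, J k x = inner ℝ (sqrtApply (Q x) (∇ (φ k) x)) (A' x (u x) (v x)) +
      φ k x * Bf x (u x) (v x) := by
    intro k
    filter_upwards [hA] with x hx
    simp only [hJ]
    rw [hx, inner_sqrtApply]
  have hXs := aestronglyMeasurable_sqrtApply hΩ hQ hB hXm
  have hφs : ∀ k, AEStronglyMeasurable (fun x => sqrtApply (Q x) (∇ (φ k) x)) m := fun k =>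
    aestronglyMeasurable_sqrtApply hΩ hQ hB (measurable_gradient (φ k)).aestronglyMeasurable
  have hl' : Tendsto (fun k => eLpNorm ((fun x => sqrtApply (Q x) (∇ (φ k) x)) -
      fun x => sqrtApply (Q x) (X x)) (ENNReal.ofReal p) m) atTop (𝓝 0) := by
    refine hl.congr fun k => ?_
    congr 1
    ext1 x
    rw [Pi.sub_apply, sqrtApply_sub]
  -- No measurability of A, A' or B is assumed. It is recovered from the integrands of Lipschitz
  -- test functions, which are integrable by the definition of weak solution and converge almost
  -- everywhere to I along a subsequence.
  have hIm : AEStronglyMeasurable I m := by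
    obtain ⟨ns, hns, h⟩ := (tendstoInMeasure_of_tendsto_eLpNorm hP0 hφs hXs
      hl').exists_seq_tendsto_ae
    refine aestronglyMeasurable_of_tendsto_ae atTop (f := fun k => J (ns k))
      (fun k => (hJ1 (ns k)).1.aestronglyMeasurable) ?_
    filter_upwards [h, hae, ae_all_iff.2 hJ2] with x h1 h2 h3
    simp only [h3]
    exact (h1.inner tendsto_const_nhds).add ((h2.comp hns.tendsto_atTop).mul_const _)
  have hbound : ∀ k, ∫⁻ x, ‖J k x - I x‖ₑ ∂m ≤
      eLpNorm ((fun x => sqrtApply (Q x) (∇ (φ k) x)) - fun x => sqrtApply (Q x) (X x))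
        (ENNReal.ofReal p) m * eLpNorm D₁ P' m +
      eLpNorm (fun x => φ k x - w x) R m * eLpNorm D₂ R' m := by
    intro k
    set Y : Eucl n → ℝ := fun x => ‖sqrtApply (Q x) (∇ (φ k) x) - sqrtApply (Q x) (X x)‖ with hY
    have hYm : AEStronglyMeasurable Y m := ((hφs k).sub hXs).norm
    calc ∫⁻ x, ‖J k x - I x‖ₑ ∂m
        ≤ ∫⁻ x, (‖(Y • D₁) x‖ₑ + ‖((fun x => φ k x - w x) • D₂) x‖ₑ) ∂m := by
          refine lintegral_mono_ae ?_
          filter_upwards [hJ2 k, hA', hBf] with x h1 h2 h3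
          have e : J k x - I x = inner ℝ (sqrtApply (Q x) (∇ (φ k) x) - sqrtApply (Q x) (X x))
              (A' x (u x) (v x)) + (φ k x - w x) * Bf x (u x) (v x) := by
            rw [h1, hI, inner_sub_left]; ring
          rw [e]
          refine (enorm_add_le _ _).trans (add_le_add ?_ ?_)
          · rw [enorm_le_iff_norm_le]
            refine (norm_inner_le_norm _ _).trans ?_
            simp only [Pi.smul_apply', smul_eq_mul, norm_mul, hY, norm_norm]
            gcongr
            exact h2.trans (le_abs_self _)
          · rw [enorm_le_iff_norm_le]
            simp only [Pi.smul_apply', smul_eq_mul, norm_mul]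
            gcongr
            exact h3.trans (le_abs_self _)
      _ = eLpNorm (Y • D₁) 1 m + eLpNorm ((fun x => φ k x - w x) • D₂) 1 m := by
          rw [lintegral_add_left' (hYm.smul hD₁.1).enorm, eLpNorm_one_eq_lintegral_enorm,
            eLpNorm_one_eq_lintegral_enorm]
      _ ≤ _ := by
          refine add_le_add ((eLpNorm_smul_le_mul_eLpNorm (p := ENNReal.ofReal p) (q := P')
            hD₁.1 hYm).trans (mul_le_mul' (le_of_eq ?_) le_rfl))
            (eLpNorm_smul_le_mul_eLpNorm (p := R) (q := R') hD₂.1 ((hφm k).sub hwm))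
          exact eLpNorm_norm ((fun x => sqrtApply (Q x) (∇ (φ k) x)) - fun x => sqrtApply (Q x) (X x))
  have hL1 : Tendsto (fun k => ∫⁻ x, ‖J k x - I x‖ₑ ∂m) atTop (𝓝 0) := by
    have h1 := ENNReal.Tendsto.mul_const (b := eLpNorm D₁ P' m) hl' (Or.inr hD₁.2.ne)
    have h2 := ENNReal.Tendsto.mul_const (b := eLpNorm D₂ R' m) hR (Or.inr hD₂.2.ne)
    have h3 := h1.add h2
    simp only [zero_mul, add_zero] at h3
    exact tendsto_of_tendsto_of_tendsto_of_le_of_le tendsto_const_nhds h3 (fun _ => zero_le)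
      hbound
  have hIi : Integrable I m := by
    obtain ⟨k, hk⟩ := (hL1.eventually_lt_const one_pos).exists
    have h1 : Integrable (fun x => J k x - I x) m :=
      ⟨(hJ1 k).1.aestronglyMeasurable.sub hIm, hk.trans ENNReal.one_lt_top⟩
    exact ((hJ1 k).1.sub h1).congr (Eventually.of_forall fun x => by simp)
  refine ⟨hIi, ?_⟩
  have h1 := tendsto_integral_of_L1 I hIm (Eventually.of_forall fun k => (hJ1 k).1) hL1
  simp only [(hJ1 _).2] at h1
  exact tendsto_nhds_unique h1 tendsto_const_nhds

/-! ### Truncated powers -/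

/-- The weight `min(max(|z|, k), l)^(β - 1)`. -/
noncomputable def truncWeight (k l β z : ℝ) : ℝ := (min (max |z| k) l) ^ (β - 1)

section TruncWeight

variable {k l β : ℝ} (hk : 0 < k) (hl : k ≤ l) (hβ : 1 ≤ β)
include hk hl

theorem truncBase_pos (z : ℝ) : 0 < min (max |z| k) l :=
  lt_min (hk.trans_le (le_max_right _ _)) (hk.trans_le hl)

theorem truncWeight_pos (z : ℝ) : 0 < truncWeight k l β z :=
  Real.rpow_pos_of_pos (truncBase_pos hk hl z) _

theorem continuous_truncWeight : Continuous (truncWeight k l β) := by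
  unfold truncWeight
  exact (by fun_prop : Continuous fun z : ℝ => min (max |z| k) l).rpow_const
    fun z => Or.inl (truncBase_pos hk hl z).ne'

include hβ

theorem truncWeight_le (z : ℝ) : truncWeight k l β z ≤ l ^ (β - 1) :=
  Real.rpow_le_rpow (truncBase_pos hk hl z).le (min_le_right _ _) (by linarith)

theorem truncWeight_mono {z w : ℝ} (h : |z| ≤ |w|) :
    truncWeight k l β z ≤ truncWeight k l β w :=
  Real.rpow_le_rpow (truncBase_pos hk hl z).le (min_le_min (max_le_max h le_rfl) le_rfl)
    (by linarith)

theorem truncWeight_mul_le (z : ℝ) :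
    truncWeight k l β z * max |z| k ≤ max |z| k ^ β := by
  have h0 : 0 < max |z| k := hk.trans_le (le_max_right _ _)
  have : truncWeight k l β z ≤ max |z| k ^ (β - 1) :=
    Real.rpow_le_rpow (truncBase_pos hk hl z).le (min_le_left _ _) (by linarith)
  calc truncWeight k l β z * max |z| k ≤ max |z| k ^ (β - 1) * max |z| k := by gcongr
    _ = max |z| k ^ β := by rw [← Real.rpow_add_one h0.ne']; congr 1; ring

end TruncWeight

theorem hasDerivAt_integral_zero {w : ℝ → ℝ} (hw : Continuous w) (z : ℝ) :
    HasDerivAt (fun z => ∫ s in (0 : ℝ)..z, w s) (w z) z :=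
  intervalIntegral.integral_hasDerivAt_right (hw.intervalIntegrable _ _)
    (hw.stronglyMeasurableAtFilter _ _) hw.continuousAt

/-- Between 0 and z the weight is largest at z. Applied to ω and ω^p, this gives the upper bounds
for H and G, with no factor depending on β. -/
theorem abs_integral_zero_le {w : ℝ → ℝ} (h0 : ∀ z, 0 ≤ w z)
    (hm : ∀ z z', |z| ≤ |z'| → w z ≤ w z') (z : ℝ) :
    |∫ s in (0 : ℝ)..z, w s| ≤ |z| * w z := by
  have := intervalIntegral.norm_integral_le_of_norm_le_const (a := 0) (b := z) (f := w)
    (C := w z) fun s hs => by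
      rw [Real.norm_of_nonneg (h0 s)]
      refine hm _ _ ?_
      rcases le_total 0 z with hz | hz
      · rw [Set.uIoc_of_le hz] at hs
        rw [abs_of_pos hs.1, abs_of_nonneg hz]; exact hs.2
      · rw [Set.uIoc_of_ge hz] at hs
        rw [abs_of_nonpos hs.2, abs_of_nonpos hz]; linarith [hs.1]
  rw [sub_zero, mul_comm] at this
  exact this

/-- The converse comparison costs a factor β. For 0 ≤ s ≤ z one has min(z,l)·s/z ≤ min(max(s,k),l);
integrating the (β-1)-th power of the left side gives z·min(z,l)^(β-1)/β. Negative z follow by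
evenness. The summand k^β covers |z| ≤ k, where the integral may vanish. -/
theorem truncWeight_mul_le_integral {k l β : ℝ} (hk : 0 < k) (hl : k ≤ l) (hβ : 1 ≤ β) (z : ℝ) :
    truncWeight k l β z * max |z| k ≤
      β * |∫ s in (0 : ℝ)..z, truncWeight k l β s| + k ^ β := by
  have hβ0 : 0 < β := by linarith
  have hcw := continuous_truncWeight (β := β) hk hl
  have hpos : ∀ z, 0 < z → z * min z l ^ (β - 1) ≤
      β * |∫ s in (0 : ℝ)..z, truncWeight k l β s| := by
    intro z hz
    have hm : 0 < min z l := lt_min hz (hk.trans_le hl)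
    have h1 : ∫ s in (0 : ℝ)..z, (min z l / z) ^ (β - 1) * s ^ (β - 1) ≤
        ∫ s in (0 : ℝ)..z, truncWeight k l β s := by
      refine intervalIntegral.integral_mono_on hz.le ?_ (hcw.intervalIntegrable _ _) ?_
      · exact (intervalIntegral.intervalIntegrable_rpow' (by linarith)).const_mul _
      · intro s hs
        rw [← Real.mul_rpow (by positivity) hs.1]
        refine Real.rpow_le_rpow (mul_nonneg (by positivity) hs.1) ?_ (by linarith)
        refine le_min ((?_ : _ ≤ s).trans ((le_abs_self s).trans (le_max_left _ _))) ?_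
        · have : min z l / z ≤ 1 := (div_le_one hz).2 (min_le_left _ _)
          exact mul_le_of_le_one_left hs.1 this
        · have : s / z ≤ 1 := (div_le_one hz).2 hs.2
          calc min z l / z * s = min z l * (s / z) := by ring
            _ ≤ min z l := mul_le_of_le_one_right hm.le this
            _ ≤ l := min_le_right _ _
    rw [intervalIntegral.integral_const_mul, integral_rpow (Or.inl (by linarith)),
      sub_add_cancel, Real.zero_rpow hβ0.ne', sub_zero, Real.div_rpow hm.le hz.le] at h1
    have h2 : z ^ β = z ^ (β - 1) * z := by rw [← Real.rpow_add_one hz.ne']; congr 1; ring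
    have h3 : 0 < z ^ (β - 1) := Real.rpow_pos_of_pos hz _
    have h4 : min z l ^ (β - 1) / z ^ (β - 1) * (z ^ β / β) = z * min z l ^ (β - 1) / β := by
      rw [h2]; field_simp
    rw [h4, div_le_iff₀' hβ0] at h1
    exact h1.trans (mul_le_mul_of_nonneg_left (le_abs_self _) hβ0.le)
  have hne : ∀ z, z ≠ 0 → |z| * min |z| l ^ (β - 1) ≤
      β * |∫ s in (0 : ℝ)..z, truncWeight k l β s| := by
    intro z hz
    rcases lt_or_gt_of_ne hz with h | h
    · have h1 := hpos (-z) (by linarith)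
      have h2 : ∫ s in (0 : ℝ)..(-z), truncWeight k l β s =
          -∫ s in (0 : ℝ)..z, truncWeight k l β s := by
        rw [← intervalIntegral.integral_symm]
        have := intervalIntegral.integral_comp_neg (a := 0) (b := -z) (truncWeight k l β)
        simp only [neg_neg, neg_zero] at this
        rw [← this]
        refine intervalIntegral.integral_congr fun s _ => ?_
        simp [truncWeight]
      rw [h2, abs_neg] at h1
      rwa [abs_of_neg h]
    · rw [abs_of_pos h]; exact hpos z h
  have hkβ : 0 < k ^ β := Real.rpow_pos_of_pos hk _
  rcases le_total k |z| with h | h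
  · have hz : z ≠ 0 := by rintro rfl; rw [abs_zero] at h; linarith
    rw [truncWeight, max_eq_left h, mul_comm]
    linarith [hne z hz]
  · rw [truncWeight, max_eq_right h, min_eq_left hl, ← Real.rpow_add_one hk.ne',
      sub_add_cancel]
    have : 0 ≤ β * |∫ s in (0 : ℝ)..z, truncWeight k l β s| := by positivity
    linarith

/-! ### Elementary inequalities -/

/-- Young's inequality with a crude constant: if y ≤ δV the first term alone dominates, otherwise
the second. -/
theorem mul_rpow_le_add {p δ y V : ℝ} (hp : 1 < p) (hδ : 0 < δ) (hy : 0 ≤ y) (hV : 0 ≤ V) :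
    y * V ^ (p - 1) ≤ δ * V ^ p + (δ⁻¹) ^ (p - 1) * y ^ p := by
  have e : ∀ t : ℝ, 0 ≤ t → t ^ p = t * t ^ (p - 1) := fun t ht => by
    rcases ht.eq_or_lt with rfl | ht
    · rw [Real.zero_rpow (by linarith), zero_mul]
    · rw [mul_comm, ← Real.rpow_add_one ht.ne']; congr 1; ring
  have h1 : 0 ≤ δ * V ^ p := by positivity
  have h2 : 0 ≤ (δ⁻¹) ^ (p - 1) * y ^ p := by positivity
  rcases le_total y (δ * V) with h | h
  · have : y * V ^ (p - 1) ≤ δ * V * V ^ (p - 1) := by gcongr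
    rw [e V hV]
    rw [e V hV] at h1
    linarith
  · have h3 : V ≤ δ⁻¹ * y := by rw [← div_eq_inv_mul, le_div_iff₀ hδ]; linarith
    have : y * V ^ (p - 1) ≤ y * (δ⁻¹ * y) ^ (p - 1) := by gcongr
    rw [Real.mul_rpow (by positivity) hy] at this
    rw [e y hy]
    rw [e y hy] at h2
    linarith

/-- Absorption: the exponents with which `Y` enters on the right are smaller than those on the
left. -/
theorem le_of_absorption {p lam C₁ C₂ β Y A W K : ℝ} (hp : 1 < p) (hlam : 0 < lam)
    (hC₁ : 0 ≤ C₁) (hC₂ : 1 ≤ C₂) (hβ : 1 ≤ β) (hY : 0 ≤ Y) (hA : 0 ≤ A)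
    (hW : 0 ≤ W) (hK : 0 ≤ K)
    (h1 : W ^ p ≤ C₁ * (A ^ p + A ^ (p * lam) * Y ^ (p * (1 - lam)) + A * Y ^ (p - 1)))
    (h2 : Y ≤ β * C₂ * (A + W + A) + K) :
    Y ≤ (2 * (β * C₂ * (2 + (3 * C₁) ^ (1 / p)))) ^ (p / min 1 (p * lam)) * A + 2 * K := by
  have hp0 : 0 < p := by linarith
  have hm : 0 < min 1 (p * lam) := lt_min one_pos (by positivity)
  set D := 2 * (β * C₂ * (2 + (3 * C₁) ^ (1 / p))) with hD
  have h3C : 0 ≤ (3 * C₁) ^ (1 / p) := by positivity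
  have hβC : 1 ≤ β * C₂ := one_le_mul_of_one_le_of_one_le hβ hC₂
  have hD1 : 1 ≤ D := by rw [hD]; nlinarith
  have hD0 : 0 < D := by linarith
  -- The least power of A in `h1` is min(1, pλ), and Λ is chosen so that Λ^(-min(1, pλ)) = D^(-p).
  -- If the conclusion failed, A ≤ Y/Λ would make each term of `h1` at most D^(-p) Y^p. The first
  -- part of `h2` would then be at most Y/2, leaving Y ≤ 2K, a contradiction.
  set Λ := D ^ (p / min 1 (p * lam)) with hΛ
  have hΛ1 : 1 ≤ Λ := Real.one_le_rpow hD1 (by positivity)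
  have hΛ0 : 0 < Λ := by linarith
  have hΛD : Λ ^ (min 1 (p * lam) / p) = D := by
    rw [hΛ, ← Real.rpow_mul hD0.le, div_mul_div_cancel₀ hm.ne', div_self hp0.ne', Real.rpow_one]
  by_contra hcon
  push Not at hcon
  have hAY : A ≤ Λ⁻¹ * Y := by
    rw [← div_eq_inv_mul, le_div_iff₀ hΛ0]; nlinarith
  have hY0 : 0 < Y := by
    have : 0 ≤ Λ * A := by positivity
    linarith
  set θ := Λ ^ (-min 1 (p * lam)) with hθ
  have hi : ∀ x, min 1 (p * lam) ≤ x → (Λ⁻¹) ^ x ≤ θ := by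
    intro x hx
    rw [Real.inv_rpow hΛ0.le, ← Real.rpow_neg hΛ0.le]
    exact Real.rpow_le_rpow_of_exponent_le hΛ1 (by linarith)
  have hYp : ∀ x y : ℝ, x + y = p → Y ^ x * Y ^ y = Y ^ p := fun x y h => by
    rw [← Real.rpow_add hY0, h]
  have b1 : A ^ p ≤ θ * Y ^ p := by
    calc A ^ p ≤ (Λ⁻¹ * Y) ^ p := by gcongr
      _ = (Λ⁻¹) ^ p * Y ^ p := Real.mul_rpow (by positivity) hY
      _ ≤ θ * Y ^ p := by gcongr; exact hi p ((min_le_left _ _).trans hp.le)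
  have b2 : A ^ (p * lam) * Y ^ (p * (1 - lam)) ≤ θ * Y ^ p := by
    calc A ^ (p * lam) * Y ^ (p * (1 - lam)) ≤ (Λ⁻¹ * Y) ^ (p * lam) * Y ^ (p * (1 - lam)) := by
          gcongr
      _ = (Λ⁻¹) ^ (p * lam) * Y ^ p := by
          rw [Real.mul_rpow (by positivity) hY, mul_assoc, hYp _ _ (by ring)]
      _ ≤ θ * Y ^ p := by gcongr; exact hi _ (min_le_right _ _)
  have b3 : A * Y ^ (p - 1) ≤ θ * Y ^ p := by
    calc A * Y ^ (p - 1) ≤ (Λ⁻¹ * Y) * Y ^ (p - 1) := by gcongr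
      _ = (Λ⁻¹) ^ (1 : ℝ) * (Y ^ (1 : ℝ) * Y ^ (p - 1)) := by
          rw [Real.rpow_one, Real.rpow_one]; ring
      _ = (Λ⁻¹) ^ (1 : ℝ) * Y ^ p := by rw [hYp _ _ (by ring)]
      _ ≤ θ * Y ^ p := by gcongr; exact hi _ (min_le_left _ _)
  have hθ0 : 0 ≤ θ := by positivity
  have hWb : W ≤ (3 * C₁) ^ (1 / p) * D⁻¹ * Y := by
    have h3 : W ^ p ≤ (3 * C₁) * θ * Y ^ p := by
      refine h1.trans ?_
      nlinarith
    have h4 := Real.rpow_le_rpow (by positivity) h3 (by positivity : (0 : ℝ) ≤ 1 / p)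
    rw [← Real.rpow_mul hW, mul_one_div_cancel hp0.ne', Real.rpow_one,
      Real.mul_rpow (by positivity) (by positivity), Real.mul_rpow (by positivity) hθ0,
      ← Real.rpow_mul hY, mul_one_div_cancel hp0.ne', Real.rpow_one, hθ,
      ← Real.rpow_mul hΛ0.le] at h4
    have h5 : Λ ^ (-min 1 (p * lam) * (1 / p)) = D⁻¹ := by
      rw [← hΛD, ← Real.rpow_neg hΛ0.le]; congr 1; ring
    rwa [h5] at h4
  have hAb : A ≤ D⁻¹ * Y := by
    refine hAY.trans ?_
    gcongr
    rw [← hΛD]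
    calc Λ ^ (min 1 (p * lam) / p) ≤ Λ ^ (1 : ℝ) := by
          refine Real.rpow_le_rpow_of_exponent_le hΛ1 ?_
          rw [div_le_one hp0]
          exact (min_le_left _ _).trans hp.le
      _ = Λ := Real.rpow_one _
  have hfin : β * C₂ * (A + W + A) ≤ Y / 2 := by
    calc β * C₂ * (A + W + A)
        ≤ β * C₂ * (D⁻¹ * Y + (3 * C₁) ^ (1 / p) * D⁻¹ * Y + D⁻¹ * Y) := by gcongr
      _ = (D * D⁻¹) * Y / 2 := by rw [hD]; ring
      _ = Y / 2 := by rw [mul_inv_cancel₀ hD0.ne', one_mul]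
  have : 0 ≤ Λ * A := by positivity
  have h6 : Y ≤ 2 * K := by linarith
  linarith

/-- Hölder's inequality for three powers. -/
theorem lintegral_three_holder {α : Type*} [MeasurableSpace α] {μ : Measure α}
    {f g h : α → ℝ} (hf : AEStronglyMeasurable f μ) (hg : AEStronglyMeasurable g μ)
    (hh : AEStronglyMeasurable h μ) {q₁ q₂ q₃ θ₁ θ₂ θ₃ : ℝ} (hq₁ : 0 < q₁) (hq₂ : 0 < q₂)
    (hq₃ : 0 < q₃) (hθ₁ : 0 ≤ θ₁) (hθ₂ : 0 ≤ θ₂) (hθ₃ : 0 ≤ θ₃)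
    (hsum : θ₁ / q₁ + θ₂ / q₂ + θ₃ / q₃ = 1) :
    ∫⁻ x, ‖f x‖ₑ ^ θ₁ * ‖g x‖ₑ ^ θ₂ * ‖h x‖ₑ ^ θ₃ ∂μ ≤
      eLpNorm f (ENNReal.ofReal q₁) μ ^ θ₁ * eLpNorm g (ENNReal.ofReal q₂) μ ^ θ₂ *
        eLpNorm h (ENNReal.ofReal q₃) μ ^ θ₃ := by
  have key := ENNReal.lintegral_prod_norm_pow_le (μ := μ) (Finset.univ : Finset (Fin 3))
    (f := ![fun x => ‖f x‖ₑ ^ q₁, fun x => ‖g x‖ₑ ^ q₂, fun x => ‖h x‖ₑ ^ q₃])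
    (p := ![θ₁ / q₁, θ₂ / q₂, θ₃ / q₃])
    (by
      intro i _
      fin_cases i
      · exact hf.enorm.pow_const _
      · exact hg.enorm.pow_const _
      · exact hh.enorm.pow_const _)
    (by simpa [Fin.sum_univ_three] using hsum)
    (by
      intro i _
      fin_cases i
      · exact div_nonneg hθ₁ hq₁.le
      · exact div_nonneg hθ₂ hq₂.le
      · exact div_nonneg hθ₃ hq₃.le)
  have e : ∀ {q θ : ℝ} (t : ℝ≥0∞), 0 < q → (t ^ q) ^ (θ / q) = t ^ θ := by
    intro q θ t hq
    rw [← ENNReal.rpow_mul, mul_div_cancel₀ _ hq.ne']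
  have e' : ∀ {q θ : ℝ} (f : α → ℝ), 0 < q →
      (∫⁻ x, ‖f x‖ₑ ^ q ∂μ) ^ (θ / q) = eLpNorm f (ENNReal.ofReal q) μ ^ θ := by
    intro q θ f hq
    rw [eLpNorm_eq_lintegral_rpow_enorm_toReal (by simpa using hq) ENNReal.ofReal_ne_top,
      ENNReal.toReal_ofReal hq.le, ← ENNReal.rpow_mul]
    congr 1
    ring
  simp only [Fin.prod_univ_three, Matrix.cons_val_zero, Matrix.cons_val_one,
    Matrix.cons_val] at key
  simpa only [e _ hq₁, e _ hq₂, e _ hq₃, e' _ hq₁, e' _ hq₂, e' _ hq₃] using key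

/-! ### The energy estimate -/

/-- The constant of the energy estimate. -/
noncomputable def energyConst (p a : ℝ) : ℝ :=
  2 * a * ((4 * a) ^ (p - 1) * (p * a) ^ p + (4 * a) ^ (p - 1) + p + 1)

theorem rpow_eq_mul_rpow_sub_one {p t : ℝ} (hp : 1 < p) (ht : 0 ≤ t) :
    t ^ p = t * t ^ (p - 1) := by
  rcases ht.eq_or_lt with rfl | ht
  · rw [Real.zero_rpow (by linarith), zero_mul]
  · rw [mul_comm, ← Real.rpow_add_one ht.ne']; congr 1; ring

/-- This is the integrand for the test function η^p G(u). Here ξ and ν stand for √Q∇u and √Q∇η, A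
for Ã, z for the value of B, ω for the weight and ub for max(|u|, k). Coercivity produces W^p, and
the remaining terms are sorted by their power of W. -/
theorem energy_pointwise {V : Type*} [NormedAddCommGroup V] [InnerProductSpace ℝ V]
    {p a η ω ub G b c d h z : ℝ} {ξ ν A : V} (hp : 1 < p) (ha : 1 < a) (hη : 0 ≤ η) (hω : 0 ≤ ω)
    (hub : 0 ≤ ub) (hb : 0 ≤ b) (hc : 0 ≤ c) (hd : 0 ≤ d) (hh : 0 ≤ h)
    (hG : |G| ≤ ub * ω ^ p) (h1 : a⁻¹ * ‖ξ‖ ^ p - h * ub ^ p ≤ inner ℝ ξ A)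
    (h2 : ‖A‖ ≤ a * ‖ξ‖ ^ (p - 1) + b * ub ^ (p - 1))
    (h3 : |z| ≤ c * ‖ξ‖ ^ (p - 1) + d * ub ^ (p - 1)) :
    (η * ω * ‖ξ‖) ^ p ≤
      2 * a * (inner ℝ ((η ^ p * ω ^ p) • ξ + (G * (p * η ^ (p - 1))) • ν) A + η ^ p * G * z) +
      energyConst p a * ((‖ν‖ * (ω * ub)) ^ p + c ^ p * (η * (ω * ub)) ^ p +
        d * (η * (ω * ub)) ^ p + h * (η * (ω * ub)) ^ p +
        b * (‖ν‖ * (ω * ub)) * (η * (ω * ub)) ^ (p - 1)) := by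
  have hp0 : 0 < p := by linarith
  have ha0 : 0 < a := by linarith
  set X := η * (ω * ub) with hX
  set F := ‖ν‖ * (ω * ub) with hF
  set W := η * ω * ‖ξ‖ with hW
  have hX0 : 0 ≤ X := by positivity
  have hF0 : 0 ≤ F := by positivity
  have hW0 : 0 ≤ W := by positivity
  have eη := rpow_eq_mul_rpow_sub_one hp hη
  have eω := rpow_eq_mul_rpow_sub_one hp hω
  have eub := rpow_eq_mul_rpow_sub_one hp hub
  have eX : X ^ p = η ^ p * ω ^ p * ub ^ p := by
    rw [hX, Real.mul_rpow hη (by positivity), Real.mul_rpow hω hub]; ring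
  have eX1 : X ^ (p - 1) = η ^ (p - 1) * ω ^ (p - 1) * ub ^ (p - 1) := by
    rw [hX, Real.mul_rpow hη (by positivity), Real.mul_rpow hω hub]; ring
  have eW : W ^ p = η ^ p * ω ^ p * ‖ξ‖ ^ p := by
    rw [hW, Real.mul_rpow (by positivity) (norm_nonneg _), Real.mul_rpow hη hω]
  have eW1 : W ^ (p - 1) = η ^ (p - 1) * ω ^ (p - 1) * ‖ξ‖ ^ (p - 1) := by
    rw [hW, Real.mul_rpow (by positivity) (norm_nonneg _), Real.mul_rpow hη hω]
  have t1 : a⁻¹ * W ^ p - h * X ^ p ≤ η ^ p * ω ^ p * inner ℝ ξ A := by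
    have := mul_le_mul_of_nonneg_left h1 (by positivity : 0 ≤ η ^ p * ω ^ p)
    rw [eW, eX]
    linarith
  have t2 : |G * (p * η ^ (p - 1)) * inner ℝ ν A| ≤
      p * a * F * W ^ (p - 1) + p * (b * F * X ^ (p - 1)) := by
    rw [abs_mul, abs_mul, abs_of_nonneg (by positivity : 0 ≤ p * η ^ (p - 1))]
    calc |G| * (p * η ^ (p - 1)) * |inner ℝ ν A|
        ≤ ub * ω ^ p * (p * η ^ (p - 1)) *
          (‖ν‖ * (a * ‖ξ‖ ^ (p - 1) + b * ub ^ (p - 1))) := by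
          gcongr
          exact (abs_real_inner_le_norm _ _).trans (by gcongr)
      _ = _ := by rw [eW1, eX1, hF, eω]; ring
  have t3 : |η ^ p * G * z| ≤ (c * X) * W ^ (p - 1) + d * X ^ p := by
    rw [abs_mul, abs_mul, abs_of_nonneg (by positivity : 0 ≤ η ^ p)]
    calc η ^ p * |G| * |z|
        ≤ η ^ p * (ub * ω ^ p) * (c * ‖ξ‖ ^ (p - 1) + d * ub ^ (p - 1)) := by gcongr
      _ = _ := by rw [eW1, eX, hX, eω, eη, eub]; ring
  -- Two terms carry W^(p-1). Each is allowed a quarter of a⁻¹W^p, so half of the coercive term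
  -- survives.
  have y1 := mul_rpow_le_add (δ := (4 * a)⁻¹) hp (by positivity)
    (by positivity : 0 ≤ p * a * F) hW0
  have y2 := mul_rpow_le_add (δ := (4 * a)⁻¹) hp (by positivity) (by positivity : 0 ≤ c * X) hW0
  rw [inv_inv, Real.mul_rpow (by positivity) hF0] at y1
  rw [inv_inv, Real.mul_rpow hc hX0] at y2
  set κ := (4 * a) ^ (p - 1) with hκ
  have hκ0 : 0 ≤ κ := by positivity
  set J := inner ℝ ((η ^ p * ω ^ p) • ξ + (G * (p * η ^ (p - 1))) • ν) A + η ^ p * G * z with hJ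
  have eJ : J = η ^ p * ω ^ p * inner ℝ ξ A + G * (p * η ^ (p - 1)) * inner ℝ ν A +
      η ^ p * G * z := by
    rw [hJ, inner_add_left, real_inner_smul_left, real_inner_smul_left]
  have z1 := neg_abs_le (G * (p * η ^ (p - 1)) * inner ℝ ν A)
  have z2 := neg_abs_le (η ^ p * G * z)
  have ei : a⁻¹ * W ^ p = 2 * ((4 * a)⁻¹ * W ^ p) + (2 * a)⁻¹ * W ^ p := by
    field_simp; ring
  have main : (2 * a)⁻¹ * W ^ p ≤ J + (κ * ((p * a) ^ p * F ^ p) + κ * (c ^ p * X ^ p) +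
      d * X ^ p + h * X ^ p + p * (b * F * X ^ (p - 1))) := by
    rw [eJ]; linarith
  have m2 : W ^ p ≤ 2 * a * (J + (κ * ((p * a) ^ p * F ^ p) + κ * (c ^ p * X ^ p) +
      d * X ^ p + h * X ^ p + p * (b * F * X ^ (p - 1)))) := by
    rw [inv_mul_le_iff₀ (by positivity)] at main
    exact main
  refine m2.trans ?_
  rw [mul_add]
  refine add_le_add le_rfl ?_
  rw [energyConst, mul_assoc (2 * a)]
  refine mul_le_mul_of_nonneg_left ?_ (by positivity)
  have q1 : 0 ≤ F ^ p := by positivity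
  have q2 : 0 ≤ c ^ p * X ^ p := by positivity
  have q3 : 0 ≤ d * X ^ p := by positivity
  have q4 : 0 ≤ h * X ^ p := by positivity
  have q5 : 0 ≤ b * F * X ^ (p - 1) := by positivity
  have q6 : 0 ≤ (p * a) ^ p := by positivity
  set k := κ * (p * a) ^ p + κ + p + 1 with hk
  have k6 : 0 ≤ κ * (p * a) ^ p := by positivity
  have k1 : κ * (p * a) ^ p ≤ k := by linarith
  have k2 : κ ≤ k := by linarith
  have k3 : 1 ≤ k := by linarith
  have k4 : p ≤ k := by linarith
  have r1 := mul_le_mul_of_nonneg_right k1 q1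
  have r2 := mul_le_mul_of_nonneg_right k2 q2
  have r3 := mul_le_mul_of_nonneg_right k3 q3
  have r4 := mul_le_mul_of_nonneg_right k3 q4
  have r5 := mul_le_mul_of_nonneg_right k4 q5
  linarith

/-- If the integral of R is infinite there is nothing to prove. Otherwise F is dominated by an
integrable function, and the vanishing integral of I drops out. Finiteness of the lower order terms
thus need not be known beforehand. -/
theorem lintegral_le_of_le_add {α : Type*} [MeasurableSpace α] {m : Measure α}
    {F I R : α → ℝ} (hI : Integrable I m) (hI0 : ∫ x, I x ∂m = 0)
    (hFm : AEStronglyMeasurable F m) (hRm : AEStronglyMeasurable R m) (hF : ∀ x, 0 ≤ F x)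
    (hR : ∀ᵐ x ∂m, 0 ≤ R x) (h : ∀ᵐ x ∂m, F x ≤ I x + R x) :
    ∫⁻ x, ENNReal.ofReal (F x) ∂m ≤ ∫⁻ x, ENNReal.ofReal (R x) ∂m := by
  by_cases hT : ∫⁻ x, ENNReal.ofReal (R x) ∂m = ⊤
  · rw [hT]; exact le_top
  have hRi : Integrable R m := by
    refine ⟨hRm, ?_⟩
    rw [hasFiniteIntegral_iff_ofReal hR]
    exact lt_top_iff_ne_top.2 hT
  have hFi : Integrable F m := by
    refine (hI.add hRi).mono' hFm ?_
    filter_upwards [h] with x hx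
    rw [Real.norm_of_nonneg (hF x)]; exact hx
  rw [← ofReal_integral_eq_lintegral_ofReal hFi (Eventually.of_forall hF),
    ← ofReal_integral_eq_lintegral_ofReal hRi hR]
  refine ENNReal.ofReal_le_ofReal ?_
  calc ∫ x, F x ∂m ≤ ∫ x, (I x + R x) ∂m := integral_mono_ae hFi (hI.add hRi) h
    _ = ∫ x, R x ∂m := by rw [integral_add hI hRi, hI0, zero_add]

theorem eLpNorm_ofReal_rpow {α : Type*} [MeasurableSpace α] {μ : Measure α} {F : Type*}
    [NormedAddCommGroup F] (f : α → F) {p : ℝ} (hp : 0 < p) :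
    eLpNorm f (ENNReal.ofReal p) μ ^ p = ∫⁻ x, ‖f x‖ₑ ^ p ∂μ := by
  rw [eLpNorm_eq_lintegral_rpow_enorm_toReal (by simpa using hp) ENNReal.ofReal_ne_top,
    ENNReal.toReal_ofReal hp.le, ← ENNReal.rpow_mul, one_div_mul_cancel hp.ne', ENNReal.rpow_one]

/-- The constant of one step of the iteration. -/
noncomputable def stepConst (p a CS M₁ : ℝ) : ℝ :=
  2 * (max 1 CS * (2 + (3 * (energyConst p a * (1 + M₁ ^ p + 3 * M₁))) ^ (1 / p)))

/-- The exponent of one step of the iteration. -/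
noncomputable def stepExp (p ε : ℝ) : ℝ := p / min 1 (p * (ε / (1 + ε)))

theorem energyConst_nonneg {p a : ℝ} (hp : 1 < p) (ha : 1 < a) : 0 ≤ energyConst p a := by
  unfold energyConst
  positivity

/-- Combination of the energy estimate, Hölder's inequality and the Sobolev inequality. -/
theorem moser_step_of_energy {α : Type*} [MeasurableSpace α] {μ : Measure α}
    {p σ a ε CS M₁ M₂ r β K : ℝ} (hp : 1 < p) (hσ : 1 < σ) (ha : 1 < a) (hε : 0 < ε)
    (hM₁ : 0 ≤ M₁) (hr : 0 < r) (hβ : 1 ≤ β) (hK : 0 ≤ K)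
    {X F V b c d h : α → ℝ} (hX : AEStronglyMeasurable X μ) (hF : AEStronglyMeasurable F μ)
    (hb : AEStronglyMeasurable b μ) (hc : AEStronglyMeasurable c μ)
    (hd : AEStronglyMeasurable d μ) (hh : AEStronglyMeasurable h μ)
    {T : ℝ≥0∞} (hT : T ≠ ⊤) (hXT : eLpNorm X (ENNReal.ofReal p) μ ≤ T)
    (hFT : ENNReal.ofReal r * eLpNorm F (ENNReal.ofReal p) μ ≤ ENNReal.ofReal M₂ * T)
    (hY : eLpNorm X (ENNReal.ofReal (p * σ)) μ ≠ ⊤)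
    (hV : eLpNorm V (ENNReal.ofReal p) μ ≠ ⊤)
    (hen : ∫⁻ x, ‖V x‖ₑ ^ p ∂μ ≤ ENNReal.ofReal (energyConst p a) *
      (∫⁻ x, ‖F x‖ₑ ^ p ∂μ + ∫⁻ x, ‖c x‖ₑ ^ p * ‖X x‖ₑ ^ p ∂μ + ∫⁻ x, ‖d x‖ₑ * ‖X x‖ₑ ^ p ∂μ +
        ∫⁻ x, ‖h x‖ₑ * ‖X x‖ₑ ^ p ∂μ + ∫⁻ x, ‖b x‖ₑ * ‖F x‖ₑ * ‖X x‖ₑ ^ (p - 1) ∂μ))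
    (hsob : eLpNorm X (ENNReal.ofReal (p * σ)) μ ≤ ENNReal.ofReal β * (ENNReal.ofReal CS *
      (ENNReal.ofReal r * (eLpNorm F (ENNReal.ofReal p) μ + eLpNorm V (ENNReal.ofReal p) μ) +
        eLpNorm X (ENNReal.ofReal p) μ)) + ENNReal.ofReal K)
    (hbM : ENNReal.ofReal (r ^ (p - 1)) *
      eLpNorm b (ENNReal.ofReal (p.conjExponent * σ.conjExponent)) μ ≤ ENNReal.ofReal M₁)
    (hcM : ENNReal.ofReal r *
      eLpNorm c (ENNReal.ofReal (p * σ.conjExponent * (1 + ε))) μ ≤ ENNReal.ofReal M₁)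
    (hdM : ENNReal.ofReal (r ^ p) *
      eLpNorm d (ENNReal.ofReal (σ.conjExponent * (1 + ε))) μ ≤ ENNReal.ofReal M₁)
    (hhM : ENNReal.ofReal (r ^ p) *
      eLpNorm h (ENNReal.ofReal (σ.conjExponent * (1 + ε))) μ ≤ ENNReal.ofReal M₁) :
    eLpNorm X (ENNReal.ofReal (p * σ)) μ ≤
      ENNReal.ofReal ((β * stepConst p a CS M₁) ^ stepExp p ε * max 1 M₂) * T +
        ENNReal.ofReal (2 * K) := by
  have hp0 : 0 < p := by linarith
  have hσ0 : 0 < σ := by linarith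
  have hσ1 : 0 < σ - 1 := by linarith
  have hp1 : 0 < p - 1 := by linarith
  set σ' := σ.conjExponent with hσ'
  set p' := p.conjExponent with hp'
  have eσ' : σ' = σ / (σ - 1) := rfl
  have ep' : p' = p / (p - 1) := rfl
  have hσ'0 : 0 < σ' := by rw [eσ']; positivity
  have hp'0 : 0 < p' := by rw [ep']; positivity
  set lam := ε / (1 + ε) with hlam
  have hlam0 : 0 < lam := by positivity
  have hlam1 : lam ≤ 1 := by rw [hlam, div_le_one (by linarith)]; linarith
  -- A = max(1, M₂)·T dominates both low norms, that of X and r times that of F, so a single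
  -- quantity enters the absorption.
  set m := ENNReal.ofReal (max 1 M₂) with hm
  set A := m * T with hA
  have hAT : A ≠ ⊤ := ENNReal.mul_ne_top ENNReal.ofReal_ne_top hT
  set Y := eLpNorm X (ENNReal.ofReal (p * σ)) μ with hYd
  set x := eLpNorm X (ENNReal.ofReal p) μ with hx
  set e := eLpNorm F (ENNReal.ofReal p) μ with he
  set W := ENNReal.ofReal r * eLpNorm V (ENNReal.ofReal p) μ with hWd
  have hWT : W ≠ ⊤ := ENNReal.mul_ne_top ENNReal.ofReal_ne_top hV
  have hm1 : 1 ≤ m := by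
    rw [hm, ← ENNReal.ofReal_one]; exact ENNReal.ofReal_le_ofReal (le_max_left _ _)
  have hxA : x ≤ A := hXT.trans (le_mul_of_one_le_left' hm1)
  have heA : ENNReal.ofReal r * e ≤ A :=
    hFT.trans (mul_le_mul' (ENNReal.ofReal_le_ofReal (le_max_right _ _)) le_rfl)
  -- With λ = ε/(1+ε) the exponents balance: 1/(σ'(1+ε)) + λ + (1-λ)/σ = 1. The spare ε in the
  -- coefficients thus becomes the power pλ > 0 of the low norm.
  have hXsplit : ∀ t, ‖X t‖ₑ ^ p = ‖X t‖ₑ ^ (p * lam) * ‖X t‖ₑ ^ (p * (1 - lam)) := fun t => by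
    rw [← ENNReal.rpow_add_of_nonneg _ _ (by positivity) (mul_nonneg hp0.le (by linarith))]
    congr 1; ring
  have i2 : ∫⁻ t, ‖c t‖ₑ ^ p * ‖X t‖ₑ ^ p ∂μ ≤
      eLpNorm c (ENNReal.ofReal (p * σ' * (1 + ε))) μ ^ p * x ^ (p * lam) *
        Y ^ (p * (1 - lam)) := by
    refine le_trans (le_of_eq ?_) (lintegral_three_holder hc hX hX
      (by positivity : 0 < p * σ' * (1 + ε)) hp0 (by positivity : 0 < p * σ) hp0.le
      (by positivity) (mul_nonneg hp0.le (by linarith : 0 ≤ 1 - lam)) ?_)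
    · simp_rw [hXsplit, mul_assoc]
    · rw [hlam, eσ']; field_simp; ring
  have i3 : ∀ w : α → ℝ, AEStronglyMeasurable w μ → ∫⁻ t, ‖w t‖ₑ * ‖X t‖ₑ ^ p ∂μ ≤
      eLpNorm w (ENNReal.ofReal (σ' * (1 + ε))) μ * x ^ (p * lam) * Y ^ (p * (1 - lam)) := by
    intro w hw
    have := lintegral_three_holder hw hX hX
      (by positivity : 0 < σ' * (1 + ε)) hp0 (by positivity : 0 < p * σ) (θ₁ := 1) zero_le_one
      (by positivity : 0 ≤ p * lam) (mul_nonneg hp0.le (by linarith : 0 ≤ 1 - lam))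
      (by rw [hlam, eσ']; field_simp; ring)
    simp only [ENNReal.rpow_one] at this
    refine le_trans (le_of_eq ?_) this
    simp_rw [hXsplit, mul_assoc]
  -- Here 1/(p'σ') + 1/p + (p-1)/(pσ) = 1 without any spare ε. The factor F already supplies one
  -- power of a low norm.
  have i5 : ∫⁻ t, ‖b t‖ₑ * ‖F t‖ₑ * ‖X t‖ₑ ^ (p - 1) ∂μ ≤
      eLpNorm b (ENNReal.ofReal (p' * σ')) μ * e * Y ^ (p - 1) := by
    have := lintegral_three_holder hb hF hX
      (by positivity : 0 < p' * σ') hp0 (by positivity : 0 < p * σ) (θ₁ := 1) zero_le_one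
      (θ₂ := 1) zero_le_one hp1.le (by rw [ep', eσ']; field_simp; ring)
    simpa only [ENNReal.rpow_one] using this
  have erp : ENNReal.ofReal (r ^ p) = ENNReal.ofReal r ^ p :=
    (ENNReal.ofReal_rpow_of_pos hr).symm
  have erp1 : ENNReal.ofReal r ^ p = ENNReal.ofReal (r ^ (p - 1)) * ENNReal.ofReal r := by
    rw [← erp, ← ENNReal.ofReal_mul (by positivity), ← Real.rpow_add_one hr.ne', sub_add_cancel]
  have hMp : ENNReal.ofReal M₁ ^ p = ENNReal.ofReal (M₁ ^ p) :=
    ENNReal.ofReal_rpow_of_nonneg hM₁ hp0.le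
  set B := A ^ (p * lam) * Y ^ (p * (1 - lam)) with hB
  have j1 : ENNReal.ofReal r ^ p * ∫⁻ t, ‖F t‖ₑ ^ p ∂μ ≤ A ^ p := by
    rw [← eLpNorm_ofReal_rpow F hp0, ← ENNReal.mul_rpow_of_nonneg _ _ hp0.le]
    gcongr
  have j2 : ENNReal.ofReal r ^ p * ∫⁻ t, ‖c t‖ₑ ^ p * ‖X t‖ₑ ^ p ∂μ ≤
      ENNReal.ofReal (M₁ ^ p) * B := by
    refine (mul_le_mul' le_rfl i2).trans ?_
    rw [mul_assoc, ← mul_assoc, ← ENNReal.mul_rpow_of_nonneg _ _ hp0.le, ← hMp]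
    exact mul_le_mul' (by gcongr) (by rw [hB]; gcongr)
  have j3 : ∀ w : α → ℝ, AEStronglyMeasurable w μ → ENNReal.ofReal (r ^ p) *
      eLpNorm w (ENNReal.ofReal (σ' * (1 + ε))) μ ≤ ENNReal.ofReal M₁ →
      ENNReal.ofReal r ^ p * ∫⁻ t, ‖w t‖ₑ * ‖X t‖ₑ ^ p ∂μ ≤ ENNReal.ofReal M₁ * B := by
    intro w hw hwM
    refine (mul_le_mul' le_rfl (i3 w hw)).trans ?_
    rw [mul_assoc, ← mul_assoc, ← erp]
    exact mul_le_mul' hwM (by rw [hB]; gcongr)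
  have j5 : ENNReal.ofReal r ^ p * ∫⁻ t, ‖b t‖ₑ * ‖F t‖ₑ * ‖X t‖ₑ ^ (p - 1) ∂μ ≤
      ENNReal.ofReal M₁ * (A * Y ^ (p - 1)) := by
    refine (mul_le_mul' le_rfl i5).trans ?_
    calc ENNReal.ofReal r ^ p * (eLpNorm b (ENNReal.ofReal (p' * σ')) μ * e * Y ^ (p - 1))
        = (ENNReal.ofReal (r ^ (p - 1)) * eLpNorm b (ENNReal.ofReal (p' * σ')) μ) *
          ((ENNReal.ofReal r * e) * Y ^ (p - 1)) := by rw [erp1]; ring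
      _ ≤ _ := mul_le_mul' hbM (mul_le_mul' heA le_rfl)
  set C₁ := energyConst p a * (1 + M₁ ^ p + 3 * M₁) with hC₁
  have hen0 := energyConst_nonneg hp ha
  have hMp0 : 0 ≤ M₁ ^ p := by positivity
  have hC₁0 : 0 ≤ C₁ := by positivity
  have hW : W ^ p ≤ ENNReal.ofReal C₁ * (A ^ p + B + A * Y ^ (p - 1)) := by
    have h0 : W ^ p = ENNReal.ofReal r ^ p * ∫⁻ t, ‖V t‖ₑ ^ p ∂μ := by
      rw [hWd, ENNReal.mul_rpow_of_nonneg _ _ hp0.le, eLpNorm_ofReal_rpow V hp0]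
    rw [h0]
    refine (mul_le_mul' le_rfl hen).trans ?_
    rw [mul_left_comm, hC₁, ENNReal.ofReal_mul hen0, mul_assoc]
    refine mul_le_mul' le_rfl ?_
    rw [mul_add, mul_add, mul_add, mul_add]
    refine (add_le_add (add_le_add (add_le_add (add_le_add j1 j2) (j3 d hd hdM)) (j3 h hh hhM))
      j5).trans ?_
    rw [ENNReal.ofReal_add (by positivity) (by positivity),
      ENNReal.ofReal_add (by positivity) (by positivity), ENNReal.ofReal_one,
      ENNReal.ofReal_mul (by norm_num)]
    set N := ENNReal.ofReal M₁
    set N' := ENNReal.ofReal (M₁ ^ p)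
    set Z := A * Y ^ (p - 1)
    have h3 : ENNReal.ofReal 3 = 3 := by norm_num
    rw [h3]
    -- The missing nonnegative products are added to obtain a single constant times the sum.
    calc A ^ p + N' * B + N * B + N * B + N * Z
        ≤ (A ^ p + N' * B + N * B + N * B + N * Z) +
          ((N' + 3 * N) * A ^ p + (1 + N) * B + (1 + N' + 2 * N) * Z) := le_self_add
      _ = (1 + N' + 3 * N) * (A ^ p + B + Z) := by ring
  have hBT : B ≠ ⊤ := ENNReal.mul_ne_top
    (ENNReal.rpow_ne_top_of_nonneg (by positivity) hAT)
    (ENNReal.rpow_ne_top_of_nonneg (mul_nonneg hp0.le (by linarith)) hY)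
  have hZT : A * Y ^ (p - 1) ≠ ⊤ :=
    ENNReal.mul_ne_top hAT (ENNReal.rpow_ne_top_of_nonneg hp1.le hY)
  have hApT : A ^ p ≠ ⊤ := ENNReal.rpow_ne_top_of_nonneg hp0.le hAT
  have h1 : W.toReal ^ p ≤ C₁ * (A.toReal ^ p + A.toReal ^ (p * lam) *
      Y.toReal ^ (p * (1 - lam)) + A.toReal * Y.toReal ^ (p - 1)) := by
    have := ENNReal.toReal_mono (ENNReal.mul_ne_top ENNReal.ofReal_ne_top
      (ENNReal.add_ne_top.2 ⟨ENNReal.add_ne_top.2 ⟨hApT, hBT⟩, hZT⟩)) hW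
    rwa [ENNReal.toReal_mul, ENNReal.toReal_ofReal hC₁0,
      ENNReal.toReal_add (ENNReal.add_ne_top.2 ⟨hApT, hBT⟩) hZT,
      ENNReal.toReal_add hApT hBT, hB, ENNReal.toReal_mul, ENNReal.toReal_mul,
      ← ENNReal.toReal_rpow, ← ENNReal.toReal_rpow, ← ENNReal.toReal_rpow,
      ← ENNReal.toReal_rpow, ← ENNReal.toReal_rpow] at this
  have h2 : Y.toReal ≤ β * max 1 CS * (A.toReal + W.toReal + A.toReal) + K := by
    have : Y ≤ ENNReal.ofReal (β * max 1 CS) * (A + W + A) + ENNReal.ofReal K := by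
      refine hsob.trans (add_le_add ?_ le_rfl)
      rw [ENNReal.ofReal_mul (by linarith), mul_assoc]
      refine mul_le_mul' le_rfl (mul_le_mul' (ENNReal.ofReal_le_ofReal (le_max_right _ _)) ?_)
      rw [mul_add]
      exact add_le_add (add_le_add heA le_rfl) hxA
    have h3 := ENNReal.toReal_mono (ENNReal.add_ne_top.2 ⟨ENNReal.mul_ne_top
      ENNReal.ofReal_ne_top (ENNReal.add_ne_top.2 ⟨ENNReal.add_ne_top.2 ⟨hAT, hWT⟩, hAT⟩),
      ENNReal.ofReal_ne_top⟩) this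
    rwa [ENNReal.toReal_add (ENNReal.mul_ne_top
      ENNReal.ofReal_ne_top (ENNReal.add_ne_top.2 ⟨ENNReal.add_ne_top.2 ⟨hAT, hWT⟩, hAT⟩))
      ENNReal.ofReal_ne_top, ENNReal.toReal_mul, ENNReal.toReal_ofReal (by positivity),
      ENNReal.toReal_ofReal hK, ENNReal.toReal_add (ENNReal.add_ne_top.2 ⟨hAT, hWT⟩) hAT,
      ENNReal.toReal_add hAT hWT] at h3
  have h3 := le_of_absorption hp hlam0 hC₁0 (le_max_left 1 CS) hβ ENNReal.toReal_nonneg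
    ENNReal.toReal_nonneg ENNReal.toReal_nonneg hK h1 h2
  have eD : 2 * (β * max 1 CS * (2 + (3 * C₁) ^ (1 / p))) = β * stepConst p a CS M₁ := by
    rw [stepConst, hC₁]; ring
  have eE : p / min 1 (p * lam) = stepExp p ε := rfl
  rw [eD, eE] at h3
  have hs0 : 0 ≤ stepConst p a CS M₁ := by unfold stepConst; positivity
  have hD0 : 0 ≤ (β * stepConst p a CS M₁) ^ stepExp p ε := by positivity
  rw [← ENNReal.ofReal_toReal hY]
  refine (ENNReal.ofReal_le_ofReal h3).trans ?_
  rw [ENNReal.ofReal_add (mul_nonneg hD0 ENNReal.toReal_nonneg) (by positivity),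
    ENNReal.ofReal_mul hD0, ENNReal.ofReal_toReal hAT, ENNReal.ofReal_mul hD0, hA, hm, mul_assoc]

/-! ### The basic step of the iteration on a fixed ball -/

/-- The normalized Lebesgue measure of `B`. -/
noncomputable def avgMeasure {n : ℕ} (B : Set (Eucl n)) : Measure (Eucl n) :=
  (volume B)⁻¹ • volume.restrict B

/-- The data of the iteration on a fixed set `B`, with the lower order terms of the structural
conditions already expressed through `max |u| k`. -/
structure MoserSetup {n : ℕ} (Ω B : Set (Eucl n)) (Q : Eucl n → Matrix (Fin n) (Fin n) ℝ)
    (p σ a ε k r CS M₁ : ℝ) (s s' : ℝ≥0∞) (A A' : Eucl n → ℝ → Eucl n → Eucl n)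
    (Bf : Eucl n → ℝ → Eucl n → ℝ) (u : Eucl n → ℝ) (v : Eucl n → Eucl n)
    (f : ℕ → Eucl n → ℝ) (b c d h : Eucl n → ℝ) : Prop where
  hp : 1 < p
  hσ : 1 < σ
  ha : 1 < a
  hε : 0 < ε
  hk : 0 < k
  hr : 0 < r
  hM₁ : 0 ≤ M₁
  hss : s⁻¹ + s'⁻¹ = 1
  hsσ : s * ENNReal.ofReal p ≤ ENNReal.ofReal (p * σ)
  isOpen : IsOpen Ω
  form : IsDegenerateForm Ω p Q
  subset : B ⊆ Ω
  vol_ne_zero : volume B ≠ 0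
  vol_ne_top : volume B ≠ ⊤
  sobolev : ∀ (w : Eucl n → ℝ) (g : Eucl n → Eucl n), MemWQZero Q p B w g →
    avgNorm w (ENNReal.ofReal (p * σ)) B ≤ ENNReal.ofReal CS *
      (ENNReal.ofReal r * avgNorm (fun x => sqrtApply (Q x) (g x)) (ENNReal.ofReal p) B +
        avgNorm w (ENNReal.ofReal p) B)
  sol : IsWeakSolution Ω Q p A Bf u v
  lip : ∀ i, LocallyLipschitzOn Ω (f i)
  lim : IsQLimit Q p Ω f u v
  lim_ae : ∀ᵐ x ∂(volume.restrict B), Tendsto (fun i => f i x) atTop (𝓝 (u x))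
  lim_gain : Tendsto (fun i => eLpNorm (fun x => f i x - u x) (ENNReal.ofReal (p * σ))
    (volume.restrict B)) atTop (𝓝 0)
  mem_u : MemLp u (ENNReal.ofReal (p * σ)) (volume.restrict B)
  mem_v : MemLp (fun x => sqrtApply (Q x) (v x)) (ENNReal.ofReal p) (volume.restrict B)
  factor : ∀ᵐ x ∂(volume.restrict B), A x (u x) (v x) = sqrtApply (Q x) (A' x (u x) (v x))
  coercive : ∀ᵐ x ∂(volume.restrict B), a⁻¹ * ‖sqrtApply (Q x) (v x)‖ ^ p -
    h x * max |u x| k ^ p ≤ inner ℝ (sqrtApply (Q x) (v x)) (A' x (u x) (v x))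
  bound_A : ∀ᵐ x ∂(volume.restrict B), ‖A' x (u x) (v x)‖ ≤
    a * ‖sqrtApply (Q x) (v x)‖ ^ (p - 1) + b x * max |u x| k ^ (p - 1)
  bound_B : ∀ᵐ x ∂(volume.restrict B), |Bf x (u x) (v x)| ≤
    c x * ‖sqrtApply (Q x) (v x)‖ ^ (p - 1) + d x * max |u x| k ^ (p - 1)
  coeff_nonneg : ∀ᵐ x ∂(volume.restrict B), 0 ≤ b x ∧ 0 ≤ c x ∧ 0 ≤ d x ∧ 0 ≤ h x
  mem_b : MemLp b (ENNReal.ofReal (p.conjExponent * σ.conjExponent)) (volume.restrict B)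
  mem_c : MemLp c (ENNReal.ofReal (p * σ.conjExponent * (1 + ε))) (volume.restrict B)
  mem_d : MemLp d (ENNReal.ofReal (σ.conjExponent * (1 + ε))) (volume.restrict B)
  mem_h : MemLp h (ENNReal.ofReal (σ.conjExponent * (1 + ε))) (volume.restrict B)
  bound_b : ENNReal.ofReal (r ^ (p - 1)) *
    eLpNorm b (ENNReal.ofReal (p.conjExponent * σ.conjExponent)) (avgMeasure B) ≤ ENNReal.ofReal M₁
  bound_c : ENNReal.ofReal r *
    eLpNorm c (ENNReal.ofReal (p * σ.conjExponent * (1 + ε))) (avgMeasure B) ≤ ENNReal.ofReal M₁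
  bound_d : ENNReal.ofReal (r ^ p) *
    eLpNorm d (ENNReal.ofReal (σ.conjExponent * (1 + ε))) (avgMeasure B) ≤ ENNReal.ofReal M₁
  bound_h : ENNReal.ofReal (r ^ p) *
    eLpNorm h (ENNReal.ofReal (σ.conjExponent * (1 + ε))) (avgMeasure B) ≤ ENNReal.ofReal M₁

/-! ### Powers of cutoff functions and Hölder exponents -/

theorem IsLipCompact.rpow {n : ℕ} {B : Set (Eucl n)} {p : ℝ} (hp : 1 < p) {η : Eucl n → ℝ}
    (hη : IsLipCompact B η) : IsLipCompact B (fun x => η x ^ p) := by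
  obtain ⟨⟨K, hK⟩, hc, hs⟩ := hη
  have hp0 : p ≠ 0 := by linarith
  have h1 : LocallyLipschitz (fun t : ℝ => t ^ p) :=
    ContDiff.locallyLipschitz (𝕂 := ℝ)
      (Real.contDiff_rpow_const_of_le (n := 1) (by exact_mod_cast hp.le))
  have h2 : tsupport (fun x => η x ^ p) ⊆ tsupport η := by
    refine closure_mono fun x hx => ?_
    rw [Function.mem_support] at hx ⊢
    intro h
    exact hx (by simp only [h, Real.zero_rpow hp0])
  have h3 : HasCompactSupport (fun x => η x ^ p) :=
    hc.isCompact.of_isClosed_subset (isClosed_tsupport _) h2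
  exact ⟨exists_lipschitzWith_of_locally (h1.comp hK.locallyLipschitz) h3, h3, h2.trans hs⟩

theorem gradient_rpow {n : ℕ} {p : ℝ} (hp : 1 < p) {η : Eucl n → ℝ} {x : Eucl n}
    (hη : DifferentiableAt ℝ η x) :
    ∇ (fun x => η x ^ p) x = (p * η x ^ (p - 1)) • ∇ η x := by
  have h := (Real.hasDerivAt_rpow_const (x := η x) (Or.inr hp.le)).comp_hasFDerivAt x
    hη.hasFDerivAt
  have h2 : HasFDerivAt (fun x => η x ^ p) _ x := h
  simp only [gradient, h2.fderiv, map_smul]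

theorem holderTriple_ofReal {x y z : ℝ} (hx : 0 < x) (hy : 0 < y) (hz : 0 < z)
    (h : x⁻¹ + y⁻¹ = z⁻¹) :
    ENNReal.HolderTriple (ENNReal.ofReal x) (ENNReal.ofReal y) (ENNReal.ofReal z) := by
  refine ⟨?_⟩
  rw [← ENNReal.ofReal_inv_of_pos hx, ← ENNReal.ofReal_inv_of_pos hy,
    ← ENNReal.ofReal_inv_of_pos hz, ← ENNReal.ofReal_add (by positivity) (by positivity), h]

theorem memLp_mul_ofReal {α : Type*} [MeasurableSpace α] {m : Measure α} {f g : α → ℝ}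
    {x y z : ℝ} (hf : MemLp f (ENNReal.ofReal x) m) (hg : MemLp g (ENNReal.ofReal y) m)
    (hx : 0 < x) (hy : 0 < y) (hz : 0 < z) (h : x⁻¹ + y⁻¹ = z⁻¹) :
    MemLp (fun t => f t * g t) (ENNReal.ofReal z) m := by
  have := holderTriple_ofReal hx hy hz h
  exact hg.mul' hf

theorem memLp_norm_rpow_ofReal {α F : Type*} [MeasurableSpace α] [NormedAddCommGroup F]
    {m : Measure α} {f : α → F} {x θ y : ℝ} (hf : MemLp f (ENNReal.ofReal x) m) (hθ : 0 < θ)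
    (hy : x / θ = y) : MemLp (fun t => ‖f t‖ ^ θ) (ENNReal.ofReal y) m := by
  have := hf.norm_rpow_div (ENNReal.ofReal θ)
  rw [ENNReal.toReal_ofReal hθ.le, ← ENNReal.ofReal_div_of_pos hθ, hy] at this
  exact this

theorem one_le_of_inv_add_inv {s s' : ℝ≥0∞} (hss : s⁻¹ + s'⁻¹ = 1) : 1 ≤ s := by
  rw [← ENNReal.inv_le_one, ← hss]
  exact le_self_add

/-! ### The weak formulation for test functions ζH(u) -/

namespace MoserSetup

variable {n : ℕ} {Ω B : Set (Eucl n)} {Q : Eucl n → Matrix (Fin n) (Fin n) ℝ}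
  {p σ a ε k r CS M₁ : ℝ} {s s' : ℝ≥0∞} {A A' : Eucl n → ℝ → Eucl n → Eucl n}
  {Bf : Eucl n → ℝ → Eucl n → ℝ} {u : Eucl n → ℝ} {v : Eucl n → Eucl n}
  {f : ℕ → Eucl n → ℝ} {b c d h : Eucl n → ℝ}
  (S : MoserSetup Ω B Q p σ a ε k r CS M₁ s s' A A' Bf u v f b c d h)

include S

theorem isProbabilityMeasure : IsProbabilityMeasure (avgMeasure B) := by
  refine ⟨?_⟩
  rw [avgMeasure, Measure.smul_apply, Measure.restrict_apply_univ, smul_eq_mul,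
    ENNReal.inv_mul_cancel S.vol_ne_zero S.vol_ne_top]

theorem isFiniteMeasure : IsFiniteMeasure (volume.restrict B : Measure (Eucl n)) :=
  ⟨by rw [Measure.restrict_apply_univ]; exact S.vol_ne_top.lt_top⟩

theorem memLp_avg {F : Type*} [NormedAddCommGroup F] {g : Eucl n → F} {q : ℝ≥0∞}
    (hg : MemLp g q (volume.restrict B)) : MemLp g q (avgMeasure B) :=
  hg.smul_measure (ENNReal.inv_ne_top.2 S.vol_ne_zero)

theorem memLp_base : MemLp (fun x => max |u x| k) (ENNReal.ofReal (p * σ))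
    (volume.restrict B) := by
  have := S.isFiniteMeasure
  have hk := S.hk
  refine MemLp.of_le (S.mem_u.norm.add (memLp_const k)) ?_ (Eventually.of_forall fun x => ?_)
  · exact ((continuous_abs.comp_aestronglyMeasurable S.mem_u.1).sup
      aestronglyMeasurable_const)
  · have h1 : 0 ≤ max |u x| k := hk.le.trans (le_max_right _ _)
    rw [Real.norm_of_nonneg h1, Pi.add_apply, Real.norm_of_nonneg (by positivity)]
    rw [Real.norm_eq_abs]
    exact max_le (by linarith) (by linarith [abs_nonneg (u x)])

theorem base_pos (x : Eucl n) : 0 < max |u x| k := S.hk.trans_le (le_max_right _ _)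

/-- The majorant of Ã(x, u, ∇u) pairs with gradients in L^p, since 1/(p'σ') + (p-1)/(pσ) = 1/p'. -/
theorem memLp_dominant_A : MemLp (fun x => a * ‖sqrtApply (Q x) (v x)‖ ^ (p - 1) +
    b x * max |u x| k ^ (p - 1)) (ENNReal.ofReal p.conjExponent) (volume.restrict B) := by
  have hp := S.hp
  have hσ := S.hσ
  have hp1 : 0 < p - 1 := by linarith
  have hσ1 : 0 < σ - 1 := by linarith
  have hp0 : 0 < p := by linarith
  have hσ0 : 0 < σ := by linarith
  have e1 : p.conjExponent = p / (p - 1) := rfl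
  have e2 : σ.conjExponent = σ / (σ - 1) := rfl
  have h1 := memLp_norm_rpow_ofReal S.mem_v hp1 (y := p.conjExponent) rfl
  have h2 := memLp_norm_rpow_ofReal S.memLp_base hp1 (y := p * σ / (p - 1)) rfl
  simp_rw [Real.norm_of_nonneg (S.base_pos _).le] at h2
  have h3 := memLp_mul_ofReal S.mem_b h2 (by rw [e1, e2]; positivity) (by positivity)
    (by rw [e1]; positivity : 0 < p.conjExponent) (by rw [e1, e2]; field_simp; ring)
  exact (h1.const_mul a).add h3

/-- The exponent is conjugate to pσ, so the majorant of B(x, u, ∇u) pairs with test functions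
converging in L^(pσ). Both 1/(pσ') + 1/p' and 1/σ' + (p-1)/(pσ) equal 1 - 1/(pσ). -/
theorem memLp_dominant_B : MemLp (fun x => c x * ‖sqrtApply (Q x) (v x)‖ ^ (p - 1) +
    d x * max |u x| k ^ (p - 1)) (ENNReal.ofReal (p * σ / (p * σ - 1))) (volume.restrict B) := by
  have := S.isFiniteMeasure
  have hp := S.hp
  have hσ := S.hσ
  have hε := S.hε
  have hp1 : 0 < p - 1 := by linarith
  have hσ1 : 0 < σ - 1 := by linarith
  have hp0 : 0 < p := by linarith
  have hσ0 : 0 < σ := by linarith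
  have hpσ : 0 < p * σ - 1 := by nlinarith
  have e1 : p.conjExponent = p / (p - 1) := rfl
  have e2 : σ.conjExponent = σ / (σ - 1) := rfl
  have hσ'0 : 0 < σ.conjExponent := by rw [e2]; positivity
  have h1 := memLp_norm_rpow_ofReal S.mem_v hp1 (y := p / (p - 1)) rfl
  have h2 := memLp_norm_rpow_ofReal S.memLp_base hp1 (y := p * σ / (p - 1)) rfl
  simp_rw [Real.norm_of_nonneg (S.base_pos _).le] at h2
  have hc : MemLp c (ENNReal.ofReal (p * σ.conjExponent)) (volume.restrict B) :=
    S.mem_c.mono_exponent (ENNReal.ofReal_le_ofReal (by nlinarith [mul_pos hp0 hσ'0]))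
  have hd : MemLp d (ENNReal.ofReal σ.conjExponent) (volume.restrict B) :=
    S.mem_d.mono_exponent (ENNReal.ofReal_le_ofReal (by nlinarith))
  have h3 := memLp_mul_ofReal hc h1 (by positivity) (by positivity)
    (by positivity : 0 < p * σ / (p * σ - 1)) (by rw [e2]; field_simp; ring)
  have h4 := memLp_mul_ofReal hd h2 (by positivity) (by positivity)
    (by positivity : 0 < p * σ / (p * σ - 1)) (by rw [e2]; field_simp; ring)
  exact h3.add h4

theorem tendsto_sp : Tendsto (fun i => eLpNorm (fun x => f i x - u x) (s * ENNReal.ofReal p)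
    (volume.restrict B)) atTop (𝓝 0) := by
  have := S.isFiniteMeasure
  have hμ : (volume.restrict B : Measure (Eucl n)) ≤ volume.restrict Ω :=
    Measure.restrict_mono S.subset le_rfl
  have h1 : ∀ i, eLpNorm (fun x => f i x - u x) (s * ENNReal.ofReal p) (volume.restrict B) ≤
      eLpNorm (fun x => f i x - u x) (ENNReal.ofReal (p * σ)) (volume.restrict B) *
      volume.restrict B Set.univ ^
        (1 / (s * ENNReal.ofReal p).toReal - 1 / (ENNReal.ofReal (p * σ)).toReal) := fun i =>
    eLpNorm_le_eLpNorm_mul_rpow_measure_univ S.hsσ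
      (((aestronglyMeasurable_of_locallyLipschitzOn S.isOpen (S.lip i)).sub S.lim.1).mono_measure
        hμ)
  have hne : volume.restrict B Set.univ ≠ 0 := by
    rw [Measure.restrict_apply_univ]; exact S.vol_ne_zero
  have h2 := ENNReal.Tendsto.mul_const S.lim_gain (b := volume.restrict B Set.univ ^
        (1 / (s * ENNReal.ofReal p).toReal - 1 / (ENNReal.ofReal (p * σ)).toReal))
    (Or.inr (ENNReal.rpow_ne_top_of_ne_zero hne (measure_ne_top _ _)))
  rw [zero_mul] at h2
  exact tendsto_of_tendsto_of_tendsto_of_le_of_le tendsto_const_nhds h2 (fun _ => zero_le) h1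

theorem isQLimit_comp {ζ : Eucl n → ℝ} (hζ : IsLipCompact B ζ)
    (hE : eLpNorm (fun x => sqrtApply (Q x) (∇ ζ x)) (s' * ENNReal.ofReal p)
      (volume.restrict B) < ⊤)
    {H H' : ℝ → ℝ} (hH : ∀ z, HasDerivAt H (H' z) z) (hH' : Continuous H') {L : ℝ≥0}
    (hL : ∀ z, |H' z| ≤ L) :
    (∀ i, IsLipCompact B (fun x => ζ x * H (f i x))) ∧
    IsQLimit Q p B (fun i x => ζ x * H (f i x)) (fun x => ζ x * H (u x))
      (fun x => (ζ x * H' (u x)) • v x + H (u x) • ∇ ζ x) :=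
  isQLimit_mul_comp S.hp S.hss S.isOpen S.form S.subset S.lip S.lim S.mem_v.2 S.lim_ae
    S.tendsto_sp hζ hE hH hH' hL

theorem weak_comp {ζ : Eucl n → ℝ} (hζ : IsLipCompact B ζ)
    (hE : eLpNorm (fun x => sqrtApply (Q x) (∇ ζ x)) (s' * ENNReal.ofReal p)
      (volume.restrict B) < ⊤)
    {H H' : ℝ → ℝ} (hH : ∀ z, HasDerivAt H (H' z) z) (hH' : Continuous H') {L : ℝ≥0}
    (hL : ∀ z, |H' z| ≤ L) :
    Integrable (fun x => inner ℝ (sqrtApply (Q x) ((ζ x * H' (u x)) • v x + H (u x) • ∇ ζ x))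
      (A' x (u x) (v x)) + ζ x * H (u x) * Bf x (u x) (v x)) (volume.restrict B) ∧
    ∫ x in B, (inner ℝ (sqrtApply (Q x) ((ζ x * H' (u x)) • v x + H (u x) • ∇ ζ x))
      (A' x (u x) (v x)) + ζ x * H (u x) * Bf x (u x) (v x)) = 0 := by
  have hp := S.hp
  have hσ := S.hσ
  have hp1 : 0 < p - 1 := by linarith
  have hp0 : 0 < p := by linarith
  have hσ0 : 0 < σ := by linarith
  have hpσ : 0 < p * σ - 1 := by nlinarith
  have e1 : p.conjExponent = p / (p - 1) := rfl
  have t1 : ENNReal.HolderTriple (ENNReal.ofReal p) (ENNReal.ofReal p.conjExponent) 1 := by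
    have := holderTriple_ofReal (z := 1) hp0 (by rw [e1]; positivity : 0 < p.conjExponent)
      one_pos (by rw [e1]; field_simp; ring)
    rwa [ENNReal.ofReal_one] at this
  have t2 : ENNReal.HolderTriple (ENNReal.ofReal (p * σ))
      (ENNReal.ofReal (p * σ / (p * σ - 1))) 1 := by
    have := holderTriple_ofReal (x := p * σ) (y := p * σ / (p * σ - 1)) (z := 1)
      (by positivity) (by positivity) one_pos (by field_simp; ring)
    rwa [ENNReal.ofReal_one] at this
  have hHL := lipschitzWith_of_hasDerivAt hH hL
  obtain ⟨h1, h2⟩ := S.isQLimit_comp hζ hE hH hH' hL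
  obtain ⟨⟨K, hK⟩, hζc, -⟩ := id hζ
  obtain ⟨Z, hZ⟩ := hζc.exists_bound_of_continuous hK.continuous
  have hZ0 : 0 ≤ Z := (norm_nonneg _).trans (hZ 0)
  refine integral_weak_eq_zero hp S.isOpen S.form S.subset S.sol S.factor S.memLp_dominant_A
    S.memLp_dominant_B S.bound_A S.bound_B h1 h2 ?_ (R := ENNReal.ofReal (p * σ)) ?_
  · filter_upwards [S.lim_ae] with x hx
    exact ((hHL.continuous.tendsto _).comp hx).const_mul _
  · have h3 : ∀ i, eLpNorm (fun x => ζ x * H (f i x) - ζ x * H (u x)) (ENNReal.ofReal (p * σ))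
        (volume.restrict B) ≤ ENNReal.ofReal (Z * L) *
          eLpNorm (fun x => f i x - u x) (ENNReal.ofReal (p * σ)) (volume.restrict B) := by
      intro i
      refine eLpNorm_le_mul_eLpNorm_of_ae_le_mul (Eventually.of_forall fun x => ?_) _
      rw [← mul_sub, norm_mul, mul_assoc]
      exact mul_le_mul (hZ x) (by simpa [Real.dist_eq] using hHL.dist_le_mul (f i x) (u x))
        (norm_nonneg _) hZ0
    have h4 := ENNReal.Tendsto.const_mul (a := ENNReal.ofReal (Z * L)) S.lim_gain
      (Or.inr ENNReal.ofReal_ne_top)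
    rw [mul_zero] at h4
    exact tendsto_of_tendsto_of_tendsto_of_le_of_le tendsto_const_nhds h4 (fun _ => zero_le) h3

end MoserSetup

/-! ### Energy and Sobolev estimates for truncated powers of u -/

namespace MoserSetup

variable {n : ℕ} {Ω B : Set (Eucl n)} {Q : Eucl n → Matrix (Fin n) (Fin n) ℝ}
  {p σ a ε k r CS M₁ : ℝ} {s s' : ℝ≥0∞} {A A' : Eucl n → ℝ → Eucl n → Eucl n}
  {Bf : Eucl n → ℝ → Eucl n → ℝ} {u : Eucl n → ℝ} {v : Eucl n → Eucl n}
  {f : ℕ → Eucl n → ℝ} {b c d h : Eucl n → ℝ}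
  (S : MoserSetup Ω B Q p σ a ε k r CS M₁ s s' A A' Bf u v f b c d h)

include S

theorem aestronglyMeasurable_grad (η : Eucl n → ℝ) :
    AEStronglyMeasurable (fun x => sqrtApply (Q x) (∇ η x)) (volume.restrict B) :=
  aestronglyMeasurable_sqrtApply S.isOpen S.form S.subset
    (measurable_gradient η).aestronglyMeasurable

theorem aestronglyMeasurable_weight {l β : ℝ} (hl : k ≤ l) :
    AEStronglyMeasurable (fun x => truncWeight k l β (u x)) (volume.restrict B) :=
  (continuous_truncWeight S.hk hl).comp_aestronglyMeasurable S.mem_u.1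

theorem energy {η : Eucl n → ℝ} (hη : IsLipCompact B η) (hη0 : ∀ x, 0 ≤ η x)
    (hη1 : ∀ x, η x ≤ 1)
    (hE : eLpNorm (fun x => sqrtApply (Q x) (∇ η x)) (s' * ENNReal.ofReal p)
      (volume.restrict B) < ⊤) {l β : ℝ} (hl : k ≤ l) (hβ : 1 ≤ β)
    {X F V : Eucl n → ℝ}
    (hX : X = fun x => η x * (truncWeight k l β (u x) * max |u x| k))
    (hF : F = fun x => ‖sqrtApply (Q x) (∇ η x)‖ * (truncWeight k l β (u x) * max |u x| k))
    (hV : V = fun x => η x * truncWeight k l β (u x) * ‖sqrtApply (Q x) (v x)‖) :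
    ∫⁻ x, ‖V x‖ₑ ^ p ∂(volume.restrict B) ≤ ENNReal.ofReal (energyConst p a) *
      (∫⁻ x, ‖F x‖ₑ ^ p ∂(volume.restrict B) +
        ∫⁻ x, ‖c x‖ₑ ^ p * ‖X x‖ₑ ^ p ∂(volume.restrict B) +
        ∫⁻ x, ‖d x‖ₑ * ‖X x‖ₑ ^ p ∂(volume.restrict B) +
        ∫⁻ x, ‖h x‖ₑ * ‖X x‖ₑ ^ p ∂(volume.restrict B) +
        ∫⁻ x, ‖b x‖ₑ * ‖F x‖ₑ * ‖X x‖ₑ ^ (p - 1) ∂(volume.restrict B)) := by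
  have hp := S.hp
  have ha := S.ha
  have hp0 : 0 < p := by linarith
  have hp1 : 0 < p - 1 := by linarith
  have hk := S.hk
  have hl0 : 0 < l := hk.trans_le hl
  set w := truncWeight k l β with hw
  have hw0 : ∀ z, 0 < w z := truncWeight_pos hk hl
  have hwc : Continuous w := continuous_truncWeight hk hl
  have hG' : Continuous fun z => w z ^ p := hwc.rpow_const fun z => Or.inl (hw0 z).ne'
  have hwb : ∀ z, |w z ^ p| ≤ (((l ^ (β - 1)) ^ p).toNNReal : ℝ≥0) := fun z => by
    rw [abs_of_nonneg (Real.rpow_nonneg (hw0 z).le _), Real.coe_toNNReal _ (by positivity)]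
    exact Real.rpow_le_rpow (hw0 z).le (truncWeight_le hk hl hβ z) hp0.le
  -- The test function is η^p G(u). Truncation at l bounds G' = ω^p, so G is C¹ and Lipschitz as the
  -- weak formulation requires, while |G(u)| ≤ ū ω^p.
  set G : ℝ → ℝ := fun z => ∫ t in (0 : ℝ)..z, w t ^ p with hG
  have hGd : ∀ z, HasDerivAt G (w z ^ p) z := hasDerivAt_integral_zero hG'
  have hGb : ∀ z, |G z| ≤ max |z| k * w z ^ p := fun z =>
    (abs_integral_zero_le (fun z => Real.rpow_nonneg (hw0 z).le _) (fun z z' hz =>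
      Real.rpow_le_rpow (hw0 z).le (truncWeight_mono hk hl hβ hz) hp0.le) z).trans
      (mul_le_mul_of_nonneg_right (le_max_left _ _) (Real.rpow_nonneg (hw0 z).le _))
  obtain ⟨⟨K, hK⟩, -⟩ := id hη
  have hdiff : ∀ᵐ x ∂(volume.restrict B), DifferentiableAt ℝ η x :=
    ae_restrict_of_ae hK.ae_differentiableAt
  have hgradζ : ∀ᵐ x ∂(volume.restrict B),
      ∇ (fun x => η x ^ p) x = (p * η x ^ (p - 1)) • ∇ η x := by
    filter_upwards [hdiff] with x hx using gradient_rpow hp hx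
  have hηp : ∀ x, η x ^ (p - 1) ≤ 1 := fun x => Real.rpow_le_one (hη0 x) (hη1 x) hp1.le
  have hEζ : eLpNorm (fun x => sqrtApply (Q x) (∇ (fun x => η x ^ p) x)) (s' * ENNReal.ofReal p)
      (volume.restrict B) < ⊤ := by
    refine (eLpNorm_le_mul_eLpNorm_of_ae_le_mul (c := p) ?_ _).trans_lt
      (ENNReal.mul_lt_top ENNReal.ofReal_lt_top hE)
    filter_upwards [hgradζ] with x hx
    rw [hx, sqrtApply_smul, norm_smul, Real.norm_of_nonneg
      (mul_nonneg hp0.le (Real.rpow_nonneg (hη0 x) _))]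
    gcongr
    exact mul_le_of_le_one_right hp0.le (hηp x)
  obtain ⟨hI, hI0⟩ := S.weak_comp (hη.rpow hp) hEζ hGd hG' hwb
  -- measurability
  have mη : AEStronglyMeasurable η (volume.restrict B) := hK.continuous.aestronglyMeasurable
  have mw : AEStronglyMeasurable (fun x => w (u x)) (volume.restrict B) :=
    S.aestronglyMeasurable_weight hl
  have mub := S.memLp_base.1
  have mX : AEStronglyMeasurable X (volume.restrict B) := hX ▸ mη.mul (mw.mul mub)
  have mF : AEStronglyMeasurable F (volume.restrict B) :=
    hF ▸ (S.aestronglyMeasurable_grad η).norm.mul (mw.mul mub)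
  have mV : AEStronglyMeasurable V (volume.restrict B) := hV ▸ (mη.mul mw).mul S.mem_v.1.norm
  have X0 : ∀ x, 0 ≤ X x := fun x => by
    rw [hX]; exact mul_nonneg (hη0 x) (mul_nonneg (hw0 _).le (S.base_pos x).le)
  have F0 : ∀ x, 0 ≤ F x := fun x => by
    rw [hF]; exact mul_nonneg (norm_nonneg _) (mul_nonneg (hw0 _).le (S.base_pos x).le)
  have V0 : ∀ x, 0 ≤ V x := fun x => by
    rw [hV]; exact mul_nonneg (mul_nonneg (hη0 x) (hw0 _).le) (norm_nonneg _)
  have mpow : ∀ {g : Eucl n → ℝ} {q : ℝ}, 0 ≤ q → AEStronglyMeasurable g (volume.restrict B) →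
      AEStronglyMeasurable (fun x => g x ^ q) (volume.restrict B) := fun hq hg =>
    (Real.continuous_rpow_const hq).comp_aestronglyMeasurable hg
  have mc := S.mem_c.1
  have md := S.mem_d.1
  have mh := S.mem_h.1
  have mb := S.mem_b.1
  have mXp := mpow hp0.le mX
  have m1 := mpow hp0.le mF
  have m2 := (mpow hp0.le mc).mul mXp
  have m3 := md.mul mXp
  have m4 := mh.mul mXp
  have m5 := (mb.mul mF).mul (mpow hp1.le mX)
  have key := lintegral_le_of_le_add (m := volume.restrict B) (F := fun x => V x ^ p)
    (R := fun x => energyConst p a * (F x ^ p + c x ^ p * X x ^ p + d x * X x ^ p +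
      h x * X x ^ p + b x * F x * X x ^ (p - 1)))
    (hI.const_mul (2 * a)) (by rw [integral_const_mul, hI0, mul_zero]) (mpow hp0.le mV)
    (((((m1.add m2).add m3).add m4).add m5).const_mul _)
    (fun x => Real.rpow_nonneg (V0 x) _)
    (by
      filter_upwards [S.coeff_nonneg] with x hx
      obtain ⟨hb, hc, hd, hh⟩ := hx
      have := X0 x
      have := F0 x
      have := energyConst_nonneg hp ha
      positivity)
    (by
      filter_upwards [S.coeff_nonneg, S.coercive, S.bound_A, S.bound_B, hgradζ]
        with x hx hco hA hB hg
      obtain ⟨hb, hc, hd, hh⟩ := hx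
      have h1 := energy_pointwise (ν := sqrtApply (Q x) (∇ η x)) (G := G (u x)) hp ha (hη0 x)
        (hw0 (u x)).le (S.base_pos x).le hb hc hd hh (hGb (u x)) hco hA hB
      rw [hg, sqrtApply_add, sqrtApply_smul, ← mul_smul, sqrtApply_smul, hX, hF, hV]
      exact h1)
  have conv : ∀ {t q : ℝ}, 0 ≤ t → 0 ≤ q → ENNReal.ofReal (t ^ q) = ‖t‖ₑ ^ q := by
    intro t q ht hq
    rw [Real.enorm_of_nonneg ht, ENNReal.ofReal_rpow_of_nonneg ht hq]
  simp_rw [conv (V0 _) hp0.le] at key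
  refine key.trans (le_of_eq ?_)
  simp_rw [ENNReal.ofReal_mul (energyConst_nonneg hp ha)]
  rw [lintegral_const_mul' _ _ ENNReal.ofReal_ne_top]
  congr 1
  have e : ∀ᵐ x ∂(volume.restrict B), ENNReal.ofReal (F x ^ p + c x ^ p * X x ^ p +
      d x * X x ^ p + h x * X x ^ p + b x * F x * X x ^ (p - 1)) =
      ‖F x‖ₑ ^ p + ‖c x‖ₑ ^ p * ‖X x‖ₑ ^ p + ‖d x‖ₑ * ‖X x‖ₑ ^ p + ‖h x‖ₑ * ‖X x‖ₑ ^ p +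
        ‖b x‖ₑ * ‖F x‖ₑ * ‖X x‖ₑ ^ (p - 1) := by
    filter_upwards [S.coeff_nonneg] with x hx
    obtain ⟨hb, hc, hd, hh⟩ := hx
    have hX' := X0 x
    have hF' := F0 x
    rw [ENNReal.ofReal_add (by positivity) (by positivity),
      ENNReal.ofReal_add (by positivity) (by positivity),
      ENNReal.ofReal_add (by positivity) (by positivity),
      ENNReal.ofReal_add (by positivity) (by positivity),
      ENNReal.ofReal_mul (by positivity), ENNReal.ofReal_mul hd, ENNReal.ofReal_mul hh,
      ENNReal.ofReal_mul (by positivity), ENNReal.ofReal_mul hb,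
      conv hF' hp0.le, conv hc hp0.le, conv hX' hp0.le, conv hX' hp1.le,
      Real.enorm_of_nonneg hb, Real.enorm_of_nonneg hd, Real.enorm_of_nonneg hh,
      Real.enorm_of_nonneg hF']
  rw [lintegral_congr_ae e]
  have nX := mX.enorm.pow_const p
  rw [lintegral_add_left', lintegral_add_left', lintegral_add_left', lintegral_add_left']
  · exact mF.enorm.pow_const _
  · exact (mF.enorm.pow_const _).add ((mc.enorm.pow_const _).mul nX)
  · exact ((mF.enorm.pow_const _).add ((mc.enorm.pow_const _).mul nX)).add (md.enorm.mul nX)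
  · exact (((mF.enorm.pow_const _).add ((mc.enorm.pow_const _).mul nX)).add
      (md.enorm.mul nX)).add (mh.enorm.mul nX)

/-- The Sobolev inequality is applied to ηH(u) with H' = ω. The function z ↦ ω(z) max(|z|, k) may
have corners and does not fit the C¹ chain rule. Passing from H back to it costs the factor β and
the summand k^β. -/
theorem sobolev_comp {η : Eucl n → ℝ} (hη : IsLipCompact B η) (hη0 : ∀ x, 0 ≤ η x)
    (hη1 : ∀ x, η x ≤ 1)
    (hE : eLpNorm (fun x => sqrtApply (Q x) (∇ η x)) (s' * ENNReal.ofReal p)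
      (volume.restrict B) < ⊤) {l β : ℝ} (hl : k ≤ l) (hβ : 1 ≤ β)
    {X F V : Eucl n → ℝ}
    (hX : X = fun x => η x * (truncWeight k l β (u x) * max |u x| k))
    (hF : F = fun x => ‖sqrtApply (Q x) (∇ η x)‖ * (truncWeight k l β (u x) * max |u x| k))
    (hV : V = fun x => η x * truncWeight k l β (u x) * ‖sqrtApply (Q x) (v x)‖) :
    eLpNorm X (ENNReal.ofReal (p * σ)) (avgMeasure B) ≤ ENNReal.ofReal β * (ENNReal.ofReal CS *
      (ENNReal.ofReal r * (eLpNorm F (ENNReal.ofReal p) (avgMeasure B) +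
        eLpNorm V (ENNReal.ofReal p) (avgMeasure B)) +
        eLpNorm X (ENNReal.ofReal p) (avgMeasure B))) + ENNReal.ofReal (k ^ β) := by
  have hp := S.hp
  have hσ := S.hσ
  have hp0 : 0 < p := by linarith
  have hk := S.hk
  have hl0 : 0 < l := hk.trans_le hl
  have hprob := S.isProbabilityMeasure
  have hP1 : 1 ≤ ENNReal.ofReal p := by
    rw [← ENNReal.ofReal_one]; exact ENNReal.ofReal_le_ofReal hp.le
  have hPσ1 : 1 ≤ ENNReal.ofReal (p * σ) := by
    rw [← ENNReal.ofReal_one]; exact ENNReal.ofReal_le_ofReal (by nlinarith)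
  set w := truncWeight k l β with hw
  have hw0 : ∀ z, 0 < w z := truncWeight_pos hk hl
  have hwc : Continuous w := continuous_truncWeight hk hl
  have hwb : ∀ z, |w z| ≤ ((l ^ (β - 1)).toNNReal : ℝ≥0) := fun z => by
    rw [abs_of_nonneg (hw0 z).le, Real.coe_toNNReal _ (by positivity)]
    exact truncWeight_le hk hl hβ z
  set H : ℝ → ℝ := fun z => ∫ t in (0 : ℝ)..z, w t with hH
  have hHd : ∀ z, HasDerivAt H (w z) z := hasDerivAt_integral_zero hwc
  have hHc : Continuous H := continuous_iff_continuousAt.2 fun z => (hHd z).continuousAt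
  have hHb : ∀ z, |H z| ≤ w z * max |z| k := fun z => by
    rw [mul_comm]
    exact (abs_integral_zero_le (fun z => (hw0 z).le) (fun z z' hz =>
      truncWeight_mono hk hl hβ hz) z).trans
      (mul_le_mul_of_nonneg_right (le_max_left _ _) (hw0 z).le)
  obtain ⟨⟨K, hK⟩, -⟩ := id hη
  have mη : AEStronglyMeasurable η (volume.restrict B) := hK.continuous.aestronglyMeasurable
  have mw : AEStronglyMeasurable (fun x => w (u x)) (volume.restrict B) :=
    S.aestronglyMeasurable_weight hl
  have mub := S.memLp_base.1
  have mF : AEStronglyMeasurable F (avgMeasure B) :=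
    (hF ▸ (S.aestronglyMeasurable_grad η).norm.mul (mw.mul mub) :
      AEStronglyMeasurable F (volume.restrict B)).smul_measure _
  have mV : AEStronglyMeasurable V (avgMeasure B) :=
    (hV ▸ (mη.mul mw).mul S.mem_v.1.norm :
      AEStronglyMeasurable V (volume.restrict B)).smul_measure _
  have mH : AEStronglyMeasurable (fun x => η x * H (u x)) (avgMeasure B) :=
    (mη.mul (hHc.comp_aestronglyMeasurable S.mem_u.1)).smul_measure _
  have F0 : ∀ x, 0 ≤ F x := fun x => by
    rw [hF]; exact mul_nonneg (norm_nonneg _) (mul_nonneg (hw0 _).le (S.base_pos x).le)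
  have V0 : ∀ x, 0 ≤ V x := fun x => by
    rw [hV]; exact mul_nonneg (mul_nonneg (hη0 x) (hw0 _).le) (norm_nonneg _)
  obtain ⟨h1, h2⟩ := S.isQLimit_comp hη hE hHd hwc hwb
  have key := S.sobolev _ _ ⟨_, h1, h2⟩
  have kH : eLpNorm (fun x => η x * H (u x)) (ENNReal.ofReal p) (avgMeasure B) ≤
      eLpNorm X (ENNReal.ofReal p) (avgMeasure B) := by
    refine eLpNorm_mono fun x => ?_
    rw [hX, norm_mul, norm_mul]
    refine mul_le_mul_of_nonneg_left ?_ (norm_nonneg _)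
    rw [Real.norm_of_nonneg (mul_nonneg (hw0 _).le (S.base_pos x).le)]
    exact hHb _
  have kV : eLpNorm (fun x => sqrtApply (Q x) ((η x * w (u x)) • v x + H (u x) • ∇ η x))
      (ENNReal.ofReal p) (avgMeasure B) ≤ eLpNorm F (ENNReal.ofReal p) (avgMeasure B) +
        eLpNorm V (ENNReal.ofReal p) (avgMeasure B) := by
    refine le_trans (eLpNorm_mono (g := F + V) fun x => ?_) (eLpNorm_add_le mF mV hP1)
    rw [Pi.add_apply, Real.norm_of_nonneg (add_nonneg (F0 x) (V0 x)), sqrtApply_add,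
      sqrtApply_smul, sqrtApply_smul, add_comm (F x)]
    refine (norm_add_le _ _).trans (add_le_add ?_ ?_)
    · rw [norm_smul, Real.norm_of_nonneg (mul_nonneg (hη0 x) (hw0 _).le), hV]
    · rw [norm_smul, hF, mul_comm]
      exact mul_le_mul_of_nonneg_left (hHb _) (norm_nonneg _)
  have hβ0 : 0 ≤ β := by linarith
  have kX : eLpNorm X (ENNReal.ofReal (p * σ)) (avgMeasure B) ≤
      ENNReal.ofReal β * eLpNorm (fun x => η x * H (u x)) (ENNReal.ofReal (p * σ))
        (avgMeasure B) + ENNReal.ofReal (k ^ β) := by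
    -- For a probability measure a constant has the same norm in every L^q, so no factor |B|
    -- appears.
    have c1 : eLpNorm (fun _ : Eucl n => k ^ β) (ENNReal.ofReal (p * σ)) (avgMeasure B) =
        ENNReal.ofReal (k ^ β) := by
      rw [eLpNorm_const _ (by simpa using (by positivity : 0 < p * σ)) hprob.neZero.ne,
        measure_univ, ENNReal.one_rpow, mul_one, Real.enorm_of_nonneg (by positivity)]
    have c2 : eLpNorm (fun x => β * ‖η x * H (u x)‖) (ENNReal.ofReal (p * σ)) (avgMeasure B) ≤
        ENNReal.ofReal β * eLpNorm (fun x => η x * H (u x)) (ENNReal.ofReal (p * σ))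
        (avgMeasure B) := by
      refine eLpNorm_le_mul_eLpNorm_of_ae_le_mul (Eventually.of_forall fun x => ?_) _
      rw [norm_mul, norm_norm, Real.norm_of_nonneg hβ0]
    rw [← c1]
    refine le_trans ?_ (add_le_add c2 le_rfl)
    refine le_trans (eLpNorm_mono
      (g := (fun x => β * ‖η x * H (u x)‖) + fun _ : Eucl n => k ^ β) fun x => ?_)
      (eLpNorm_add_le (f := fun x => β * ‖η x * H (u x)‖) (g := fun _ => k ^ β)
        (mH.norm.const_mul β) aestronglyMeasurable_const hPσ1)
    have hkβ : 0 < k ^ β := Real.rpow_pos_of_pos hk _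
    rw [Pi.add_apply, Real.norm_of_nonneg (by positivity : 0 ≤ β * ‖η x * H (u x)‖ + k ^ β), hX,
      Real.norm_of_nonneg (mul_nonneg (hη0 x) (mul_nonneg (hw0 _).le (S.base_pos x).le)),
      norm_mul, Real.norm_of_nonneg (hη0 x), Real.norm_eq_abs]
    have h3 := mul_le_mul_of_nonneg_left (truncWeight_mul_le_integral hk hl hβ (u x)) (hη0 x)
    have h4 : η x * k ^ β ≤ k ^ β := mul_le_of_le_one_left hkβ.le (hη1 x)
    calc η x * (w (u x) * max |u x| k) ≤ η x * (β * |H (u x)| + k ^ β) := h3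
      _ = β * (η x * |H (u x)|) + η x * k ^ β := by ring
      _ ≤ _ := by linarith
  refine kX.trans (add_le_add (mul_le_mul' le_rfl (key.trans (mul_le_mul' le_rfl ?_))) le_rfl)
  exact add_le_add (mul_le_mul' le_rfl kV) kH

end MoserSetup

/-! ### From L^(sp) to L^(pσ): one iteration step -/

namespace MoserSetup

variable {n : ℕ} {Ω B : Set (Eucl n)} {Q : Eucl n → Matrix (Fin n) (Fin n) ℝ}
  {p σ a ε k r CS M₁ : ℝ} {s s' : ℝ≥0∞} {A A' : Eucl n → ℝ → Eucl n → Eucl n}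
  {Bf : Eucl n → ℝ → Eucl n → ℝ} {u : Eucl n → ℝ} {v : Eucl n → Eucl n}
  {f : ℕ → Eucl n → ℝ} {b c d h : Eucl n → ℝ}
  (S : MoserSetup Ω B Q p σ a ε k r CS M₁ s s' A A' Bf u v f b c d h)

include S

/-- Truncation makes ωū a bounded multiple of ū in L^(pσ), so all the norms to be absorbed are
finite. Hölder with s'p for √Q∇η and sp for ωū produces the L^(sp) norm on the right. Only tsupport
η matters there, since η and ∇η vanish elsewhere; this is what lets successive cutoffs nest. -/
theorem step_trunc {η : Eucl n → ℝ} (hη : IsLipCompact B η) (hη0 : ∀ x, 0 ≤ η x)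
    (hη1 : ∀ x, η x ≤ 1) {M₂ : ℝ}
    (hEM : ENNReal.ofReal r * eLpNorm (fun x => sqrtApply (Q x) (∇ η x)) (s' * ENNReal.ofReal p)
      (avgMeasure B) ≤ ENNReal.ofReal M₂) {l β : ℝ} (hl : k ≤ l) (hβ : 1 ≤ β) :
    eLpNorm (fun x => η x * (truncWeight k l β (u x) * max |u x| k)) (ENNReal.ofReal (p * σ))
      (avgMeasure B) ≤
      ENNReal.ofReal ((β * stepConst p a CS M₁) ^ stepExp p ε * max 1 M₂) *
        eLpNorm ((tsupport η).indicator fun x => truncWeight k l β (u x) * max |u x| k)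
          (s * ENNReal.ofReal p) (avgMeasure B) + ENNReal.ofReal (2 * k ^ β) := by
  have hp := S.hp
  have hσ := S.hσ
  have hp0 : 0 < p := by linarith
  have hk := S.hk
  have hr := S.hr
  have hl0 : 0 < l := hk.trans_le hl
  have hprob := S.isProbabilityMeasure
  have hP0 : ENNReal.ofReal p ≠ 0 := by simpa using hp0
  have hr0 : ENNReal.ofReal r ≠ 0 := by simpa using hr
  have hs1 := one_le_of_inv_add_inv S.hss
  have hEavg : eLpNorm (fun x => sqrtApply (Q x) (∇ η x)) (s' * ENNReal.ofReal p)
      (avgMeasure B) < ⊤ := by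
    by_contra hc
    rw [not_lt, top_le_iff] at hc
    rw [hc, ENNReal.mul_top hr0] at hEM
    exact absurd hEM (not_le.2 ENNReal.ofReal_lt_top)
  have hE : eLpNorm (fun x => sqrtApply (Q x) (∇ η x)) (s' * ENNReal.ofReal p)
      (volume.restrict B) < ⊤ :=
    (avgNorm_lt_top_iff _ _ S.vol_ne_zero S.vol_ne_top).1 hEavg
  set w := truncWeight k l β with hw
  have hw0 : ∀ z, 0 < w z := truncWeight_pos hk hl
  have hwl : ∀ z, w z ≤ l ^ (β - 1) := truncWeight_le hk hl hβ
  set P : Eucl n → ℝ := fun x => w (u x) * max |u x| k with hP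
  have hP0' : ∀ x, 0 ≤ P x := fun x => mul_nonneg (hw0 _).le (S.base_pos x).le
  set X : Eucl n → ℝ := fun x => η x * (w (u x) * max |u x| k) with hX
  set F : Eucl n → ℝ := fun x => ‖sqrtApply (Q x) (∇ η x)‖ * (w (u x) * max |u x| k) with hF
  set V : Eucl n → ℝ := fun x => η x * w (u x) * ‖sqrtApply (Q x) (v x)‖ with hV
  obtain ⟨⟨K, hK⟩, -⟩ := id hη
  have mη : AEStronglyMeasurable η (volume.restrict B) := hK.continuous.aestronglyMeasurable
  have mw : AEStronglyMeasurable (fun x => w (u x)) (volume.restrict B) :=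
    S.aestronglyMeasurable_weight hl
  have mP : AEStronglyMeasurable P (volume.restrict B) := mw.mul S.memLp_base.1
  have mE := S.aestronglyMeasurable_grad η
  have mI : AEStronglyMeasurable ((tsupport η).indicator P) (avgMeasure B) :=
    (mP.smul_measure _).indicator (isClosed_tsupport η).measurableSet
  have memP : MemLp P (ENNReal.ofReal (p * σ)) (volume.restrict B) := by
    refine MemLp.of_le_mul (c := l ^ (β - 1)) S.memLp_base mP (Eventually.of_forall fun x => ?_)
    rw [Real.norm_of_nonneg (hP0' x), Real.norm_of_nonneg (S.base_pos x).le]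
    exact mul_le_mul_of_nonneg_right (hwl _) (S.base_pos x).le
  have memX : MemLp X (ENNReal.ofReal (p * σ)) (volume.restrict B) := by
    refine MemLp.of_le memP (mη.mul mP) (Eventually.of_forall fun x => ?_)
    rw [hX, norm_mul, Real.norm_of_nonneg (hη0 x)]
    exact mul_le_of_le_one_left (norm_nonneg _) (hη1 x)
  have memV : MemLp V (ENNReal.ofReal p) (volume.restrict B) := by
    refine MemLp.of_le_mul (c := l ^ (β - 1)) S.mem_v ((mη.mul mw).mul S.mem_v.1.norm)
      (Eventually.of_forall fun x => ?_)
    rw [hV, norm_mul, norm_norm, Real.norm_of_nonneg (mul_nonneg (hη0 x) (hw0 _).le)]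
    gcongr
    exact (mul_le_of_le_one_left (hw0 _).le (hη1 x)).trans (hwl _)
  have memP' : MemLp P (s * ENNReal.ofReal p) (avgMeasure B) :=
    (S.memLp_avg memP).mono_exponent S.hsσ
  set T := eLpNorm ((tsupport η).indicator P) (s * ENNReal.ofReal p) (avgMeasure B) with hT
  have hTT : T ≠ ⊤ := (memP'.indicator (isClosed_tsupport η).measurableSet).2.ne
  have hXT : eLpNorm X (ENNReal.ofReal p) (avgMeasure B) ≤ T := by
    refine le_trans (eLpNorm_mono (g := (tsupport η).indicator P) fun x => ?_)
      (eLpNorm_le_eLpNorm_of_exponent_le (le_mul_of_one_le_left' hs1) mI)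
    by_cases hx : x ∈ tsupport η
    · rw [Set.indicator_of_mem hx, hX, norm_mul, Real.norm_of_nonneg (hη0 x)]
      exact mul_le_of_le_one_left (norm_nonneg _) (hη1 x)
    · simp only [Set.indicator_of_notMem hx, hX, image_eq_zero_of_notMem_tsupport hx, zero_mul,
        le_refl]
  have hFT : ENNReal.ofReal r * eLpNorm F (ENNReal.ofReal p) (avgMeasure B) ≤
      ENNReal.ofReal M₂ * T := by
    have hF' : F = (fun x => ‖sqrtApply (Q x) (∇ η x)‖) • (tsupport η).indicator P := by
      ext x
      rw [Pi.smul_apply', smul_eq_mul]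
      by_cases hx : x ∈ tsupport η
      · rw [Set.indicator_of_mem hx]
      · simp only [Set.indicator_of_notMem hx, hF, gradient_eq_zero_of_notMem_tsupport hx,
          sqrtApply_zero, norm_zero, zero_mul, mul_zero]
    have := holderTriple_mul ((add_comm s'⁻¹ s⁻¹).trans S.hss) hP0 ENNReal.ofReal_ne_top
    rw [hF']
    refine (mul_le_mul' le_rfl (eLpNorm_smul_le_mul_eLpNorm (p := s' * ENNReal.ofReal p)
      (q := s * ENNReal.ofReal p) mI (mE.norm.smul_measure _))).trans ?_
    rw [← mul_assoc, eLpNorm_norm]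
    exact mul_le_mul' hEM le_rfl
  have hen := S.energy hη hη0 hη1 hE hl hβ hX hF hV
  have hen' : ∫⁻ x, ‖V x‖ₑ ^ p ∂(avgMeasure B) ≤ ENNReal.ofReal (energyConst p a) *
      (∫⁻ x, ‖F x‖ₑ ^ p ∂(avgMeasure B) + ∫⁻ x, ‖c x‖ₑ ^ p * ‖X x‖ₑ ^ p ∂(avgMeasure B) +
        ∫⁻ x, ‖d x‖ₑ * ‖X x‖ₑ ^ p ∂(avgMeasure B) + ∫⁻ x, ‖h x‖ₑ * ‖X x‖ₑ ^ p ∂(avgMeasure B) +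
        ∫⁻ x, ‖b x‖ₑ * ‖F x‖ₑ * ‖X x‖ₑ ^ (p - 1) ∂(avgMeasure B)) := by
    simp only [avgMeasure, lintegral_smul_measure, smul_eq_mul, ← mul_add]
    rw [mul_left_comm]
    exact mul_le_mul' le_rfl hen
  have hsob := S.sobolev_comp hη hη0 hη1 hE hl hβ hX hF hV
  exact moser_step_of_energy hp hσ S.ha S.hε S.hM₁ hr hβ (Real.rpow_nonneg hk.le β)
    (memX.1.smul_measure _) ((mE.norm.mul mP).smul_measure _) (S.mem_b.1.smul_measure _)
    (S.mem_c.1.smul_measure _) (S.mem_d.1.smul_measure _) (S.mem_h.1.smul_measure _) hTT hXT hFT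
    (S.memLp_avg memX).2.ne (S.memLp_avg memV).2.ne hen' hsob S.bound_b S.bound_c S.bound_d
    S.bound_h

/-- Take l = k + i. At each point the truncation is eventually inactive, so Fatou's lemma handles
the left side, while ωū ≤ ū^β bounds the right side for every i. The right side may be infinite at
this stage. -/
theorem step {η : Eucl n → ℝ} (hη : IsLipCompact B η) (hη0 : ∀ x, 0 ≤ η x)
    (hη1 : ∀ x, η x ≤ 1) {M₂ : ℝ}
    (hEM : ENNReal.ofReal r * eLpNorm (fun x => sqrtApply (Q x) (∇ η x)) (s' * ENNReal.ofReal p)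
      (avgMeasure B) ≤ ENNReal.ofReal M₂) {β : ℝ} (hβ : 1 ≤ β) :
    eLpNorm (fun x => η x * max |u x| k ^ β) (ENNReal.ofReal (p * σ)) (avgMeasure B) ≤
      ENNReal.ofReal ((β * stepConst p a CS M₁) ^ stepExp p ε * max 1 M₂) *
        eLpNorm ((tsupport η).indicator fun x => max |u x| k ^ β)
          (s * ENNReal.ofReal p) (avgMeasure B) + ENNReal.ofReal (2 * k ^ β) := by
  have hk := S.hk
  obtain ⟨⟨K, hK⟩, -⟩ := id hη
  have mη : AEStronglyMeasurable η (volume.restrict B) := hK.continuous.aestronglyMeasurable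
  have hli : ∀ i : ℕ, k ≤ k + i := fun i => by simp
  have hlim := Lp.eLpNorm_lim_le_liminf_eLpNorm (p := ENNReal.ofReal (p * σ))
    (μ := avgMeasure B)
    (f := fun (i : ℕ) x => η x * (truncWeight k (k + i) β (u x) * max |u x| k))
    (fun i => (mη.mul ((S.aestronglyMeasurable_weight (hli i)).mul S.memLp_base.1)).smul_measure _)
    (fun x => η x * max |u x| k ^ β)
    (Eventually.of_forall fun x => by
      refine tendsto_const_nhds.congr' ?_
      obtain ⟨i₀, hi₀⟩ := exists_nat_ge (max |u x| k)
      filter_upwards [eventually_ge_atTop i₀] with i hi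
      have h1 : max |u x| k ≤ k + i := by
        have : (i₀ : ℝ) ≤ i := by exact_mod_cast hi
        linarith
      rw [truncWeight, min_eq_left h1, ← Real.rpow_add_one (S.base_pos x).ne', sub_add_cancel])
  refine hlim.trans ((liminf_le_liminf (v := fun _ : ℕ => _) (Eventually.of_forall fun i => ?_)).trans
    (le_of_eq (liminf_const _)))
  refine (S.step_trunc hη hη0 hη1 hEM (hli i) hβ).trans
    (add_le_add (mul_le_mul' le_rfl (eLpNorm_mono fun x => ?_)) le_rfl)
  by_cases hx : x ∈ tsupport η
  · rw [Set.indicator_of_mem hx, Set.indicator_of_mem hx,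
      Real.norm_of_nonneg (mul_nonneg (truncWeight_pos hk (hli i) _).le (S.base_pos x).le),
      Real.norm_of_nonneg (Real.rpow_nonneg (S.base_pos x).le _)]
    exact truncWeight_mul_le hk (hli i) hβ _
  · rw [Set.indicator_of_notMem hx, Set.indicator_of_notMem hx]

end MoserSetup

/-! ### The iteration -/

/-- For t > L, Chebyshev's inequality gives ν{|g| ≥ t} ≤ (L/t)^q for arbitrarily large q, so the set
is null. -/
theorem eLpNorm_top_le_of_forall {α F : Type*} [MeasurableSpace α] [NormedAddCommGroup F]
    {ν : Measure α} {g : α → F} (hg : AEStronglyMeasurable g ν) {q : ℕ → ℝ}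
    (hq : Tendsto q atTop atTop) {L : ℝ≥0∞} (hL : ∀ j, eLpNorm g (ENNReal.ofReal (q j)) ν ≤ L) :
    eLpNorm g ⊤ ν ≤ L := by
  rw [eLpNorm_exponent_top]
  refine le_of_forall_gt_imp_ge_of_dense fun t ht => ?_
  rcases eq_or_ne t ⊤ with rfl | htT
  · exact le_top
  have ht0 : t ≠ 0 := (zero_le.trans_lt ht).ne'
  have hlt : t⁻¹ * L < 1 := by
    rw [mul_comm, ← div_eq_mul_inv]
    exact ENNReal.div_lt_of_lt_mul (by rwa [one_mul])
  have hlim : Tendsto (fun j => (t⁻¹ * L) ^ q j) atTop (𝓝 0) :=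
    (ENNReal.tendsto_rpow_atTop_of_base_lt_one hlt).comp hq
  have hb : ∀ᶠ j in atTop, ν {x | t ≤ ‖g x‖ₑ} ≤ (t⁻¹ * L) ^ q j := by
    filter_upwards [hq.eventually_gt_atTop 0] with j hj
    have h1 := meas_ge_le_mul_pow_eLpNorm_enorm (p := ENNReal.ofReal (q j)) ν
      (by simpa using hj) ENNReal.ofReal_ne_top hg ht0 (fun h => absurd h htT)
    rw [ENNReal.toReal_ofReal hj.le, ← ENNReal.mul_rpow_of_nonneg _ _ hj.le] at h1
    refine h1.trans ?_
    gcongr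
    exact hL j
  have h0 : ν {x | t ≤ ‖g x‖ₑ} = 0 := le_antisymm (ge_of_tendsto hlim hb) zero_le
  refine essSup_le_of_ae_le t ?_
  rw [EventuallyLE, ae_iff]
  refine measure_mono_null (fun x hx => ?_) h0
  exact (not_le.1 hx).le

/-- The base of the geometric growth of the constants in the iteration. -/
noncomputable def iterGrowth (p σ ε N s : ℝ) : ℝ := (σ / s) ^ stepExp p ε * max 1 N

/-- The initial constant in the iteration. -/
noncomputable def iterStart (p a ε CS M₁ Ccut N : ℝ) : ℝ :=
  stepConst p a CS M₁ ^ stepExp p ε * ((1 + Ccut) * max 1 N) + 2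

/-- The constant obtained from the iteration. -/
noncomputable def iterConst (p σ a ε CS M₁ Ccut N s : ℝ) : ℝ :=
  Real.exp (∑' j : ℕ, (Real.log (iterStart p a ε CS M₁ Ccut N) +
    j * Real.log (iterGrowth p σ ε N s)) * ((σ / s)⁻¹) ^ j)

theorem stepExp_pos {p ε : ℝ} (hp : 1 < p) (hε : 0 < ε) : 0 < stepExp p ε := by
  unfold stepExp
  have : 0 < min 1 (p * (ε / (1 + ε))) := lt_min one_pos (by positivity)
  positivity

theorem stepConst_nonneg {p a CS M₁ : ℝ} (hp : 1 < p) (ha : 1 < a) (hM₁ : 0 ≤ M₁) :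
    0 ≤ stepConst p a CS M₁ := by
  have := energyConst_nonneg hp ha
  unfold stepConst
  positivity

/-- The logarithm of the j-th factor is (log G + j log L) χ^(-j), which is summable because it is
linear in j times a geometric term. -/
theorem prod_bound_of_recursion {X : ℕ → ℝ≥0∞} {G L χ : ℝ} (hG : 1 ≤ G) (hL : 1 ≤ L) (hχ : 1 < χ)
    (h : ∀ j, X (j + 1) ≤ ENNReal.ofReal ((G * L ^ j) ^ ((χ ^ j)⁻¹)) * X j) (j : ℕ) :
    X j ≤ ENNReal.ofReal (Real.exp (∑' j : ℕ, (Real.log G + j * Real.log L) * (χ⁻¹) ^ j)) *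
      X 0 := by
  set t : ℕ → ℝ := fun j => (Real.log G + j * Real.log L) * (χ⁻¹) ^ j with ht
  have hχ0 : 0 < χ := by linarith
  have hlG := Real.log_nonneg hG
  have hlL := Real.log_nonneg hL
  have ht0 : ∀ j, 0 ≤ t j := fun j => by positivity
  have hχi : ‖χ⁻¹‖ < 1 := by
    rw [Real.norm_of_nonneg (by positivity)]; exact inv_lt_one_of_one_lt₀ hχ
  have hts : Summable t := by
    have h1 : Summable fun j : ℕ => Real.log G * (χ⁻¹) ^ j :=
      (summable_geometric_of_norm_lt_one hχi).mul_left _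
    have h2 : Summable fun j : ℕ => Real.log L * ((j : ℝ) ^ 1 * (χ⁻¹) ^ j) :=
      (summable_pow_mul_geometric_of_norm_lt_one 1 hχi).mul_left _
    refine (h1.add h2).congr fun j => ?_
    rw [ht]; ring
  have key : X j ≤ ENNReal.ofReal (Real.exp (∑ i ∈ Finset.range j, t i)) * X 0 := by
    induction j with
    | zero => simp
    | succ j ih =>
      have e : (G * L ^ j) ^ ((χ ^ j)⁻¹) = Real.exp (t j) := by
        rw [Real.rpow_def_of_pos (by positivity), Real.log_mul (by positivity) (by positivity),
          Real.log_pow, ← inv_pow]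
      rw [Finset.sum_range_succ, add_comm (∑ i ∈ Finset.range j, t i), Real.exp_add, ENNReal.ofReal_mul (Real.exp_pos _).le,
        mul_assoc, ← e]
      exact (h j).trans (mul_le_mul' le_rfl ih)
  refine key.trans (mul_le_mul' (ENNReal.ofReal_le_ofReal (Real.exp_le_exp.2 ?_)) le_rfl)
  exact hts.sum_le_tsum _ fun i _ => ht0 i

/-- The constant of the step with β = (σ/s)^j and cutoff η_(j+1) grows at most geometrically in j.
The summand 2 comes from the additive term 2k^β. -/
theorem iterStep_le {p σ a ε CS M₁ Ccut N s : ℝ} (hp : 1 < p) (ha : 1 < a) (hε : 0 < ε)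
    (hM₁ : 0 ≤ M₁) (hC : 0 < Ccut) (hN : 0 < N) (hs : 0 < s) (hsσ : s < σ) (j : ℕ) :
    ((σ / s) ^ j * stepConst p a CS M₁) ^ stepExp p ε * max 1 (Ccut * N ^ (j + 1)) + 2 ≤
      iterStart p a ε CS M₁ Ccut N * iterGrowth p σ ε N s ^ j := by
  have hχ : 1 < σ / s := (one_lt_div hs).2 hsσ
  have hκ := stepExp_pos hp hε
  have hc := stepConst_nonneg (CS := CS) hp ha hM₁
  have hm : 1 ≤ max 1 N := le_max_left _ _
  have hm0 : 0 ≤ max 1 N := by linarith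
  have e1 : ((σ / s) ^ j * stepConst p a CS M₁) ^ stepExp p ε =
      stepConst p a CS M₁ ^ stepExp p ε * ((σ / s) ^ stepExp p ε) ^ j := by
    rw [Real.mul_rpow (by positivity) hc, ← Real.rpow_natCast, ← Real.rpow_natCast,
      ← Real.rpow_mul (by positivity), ← Real.rpow_mul (by positivity), mul_comm (j : ℝ)]
    ring
  have e2 : max 1 (Ccut * N ^ (j + 1)) ≤ (1 + Ccut) * max 1 N * max 1 N ^ j := by
    have h1 : N ^ (j + 1) ≤ max 1 N ^ (j + 1) := pow_le_pow_left₀ hN.le (le_max_right _ _) _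
    have h2 : 1 ≤ max 1 N ^ (j + 1) := one_le_pow₀ hm
    rw [mul_assoc, ← pow_succ']
    refine max_le (by nlinarith) (by nlinarith)
  have hg1 : 1 ≤ (σ / s) ^ stepExp p ε := Real.one_le_rpow hχ.le hκ.le
  have hg : 1 ≤ iterGrowth p σ ε N s := by
    unfold iterGrowth
    exact one_le_mul_of_one_le_of_one_le hg1 hm
  have h3 : 1 ≤ iterGrowth p σ ε N s ^ j := one_le_pow₀ hg
  rw [e1, iterStart, add_mul]
  refine add_le_add ?_ (by linarith)
  calc stepConst p a CS M₁ ^ stepExp p ε * ((σ / s) ^ stepExp p ε) ^ j *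
        max 1 (Ccut * N ^ (j + 1))
      ≤ stepConst p a CS M₁ ^ stepExp p ε * ((σ / s) ^ stepExp p ε) ^ j *
        ((1 + Ccut) * max 1 N * max 1 N ^ j) := by
        refine mul_le_mul_of_nonneg_left e2 (by positivity)
    _ = _ := by rw [iterGrowth, mul_pow]; ring

theorem MoserSetup.bound {n : ℕ} {Ω B : Set (Eucl n)} {Q : Eucl n → Matrix (Fin n) (Fin n) ℝ}
    {p σ a ε k r CS M₁ : ℝ} {s s' : ℝ≥0∞} {A A' : Eucl n → ℝ → Eucl n → Eucl n}
    {Bf : Eucl n → ℝ → Eucl n → ℝ} {u : Eucl n → ℝ} {v : Eucl n → Eucl n}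
    {f : ℕ → Eucl n → ℝ} {b c d h : Eucl n → ℝ}
    (S : MoserSetup Ω B Q p σ a ε k r CS M₁ s s' A A' Bf u v f b c d h)
    (hsσ : s < ENNReal.ofReal σ) {η : ℕ → Eucl n → ℝ}
    (hη : ∀ j, 1 ≤ j → IsLipCompact B (η j)) (hη0 : ∀ j, 1 ≤ j → ∀ x, 0 ≤ η j x)
    (hη1 : ∀ j, 1 ≤ j → ∀ x, η j x ≤ 1)
    (hsupp : ∀ j, 1 ≤ j → ∀ x ∈ tsupport (η (j + 1)), η j x = 1)
    {B' : Set (Eucl n)} (hB' : NullMeasurableSet B' volume) (hB'B : B' ⊆ B)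
    (hone : ∀ j, 1 ≤ j → ∀ x ∈ B', η j x = 1) {N Ccut : ℝ} (hN : 0 < N) (hC : 0 < Ccut)
    (hEM : ∀ j, 1 ≤ j → ENNReal.ofReal r * eLpNorm (fun x => sqrtApply (Q x) (∇ (η j) x))
      (s' * ENNReal.ofReal p) (avgMeasure B) ≤ ENNReal.ofReal (Ccut * N ^ j)) :
    eLpNorm u ⊤ (volume.restrict B') ≤
      ENNReal.ofReal (iterConst p σ a ε CS M₁ Ccut N s.toReal) *
        (eLpNorm u (s * ENNReal.ofReal p) (avgMeasure B) + ENNReal.ofReal k) := by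
  have hp := S.hp
  have hσ := S.hσ
  have ha := S.ha
  have hε := S.hε
  have hk := S.hk
  have hp0 : 0 < p := by linarith
  have hprob := S.isProbabilityMeasure
  have hs1 := one_le_of_inv_add_inv S.hss
  have hsT : s ≠ ⊤ := (hsσ.trans ENNReal.ofReal_lt_top).ne
  set t := s.toReal with ht
  have hst : s = ENNReal.ofReal t := (ENNReal.ofReal_toReal hsT).symm
  have ht1 : 1 ≤ t := by
    rw [ht, ← ENNReal.toReal_one]; exact ENNReal.toReal_mono hsT hs1
  have ht0 : 0 < t := by linarith
  have htσ : t < σ := by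
    rw [hst] at hsσ; exact (ENNReal.ofReal_lt_ofReal_iff (by linarith)).1 hsσ
  set χ := σ / t with hχd
  have hχ : 1 < χ := (one_lt_div ht0).2 htσ
  have hχ0 : 0 < χ := by linarith
  set ub : Eucl n → ℝ := fun x => max |u x| k with hub
  have ub0 : ∀ x, 0 < ub x := S.base_pos
  have mub : AEStronglyMeasurable ub (volume.restrict B) := S.memLp_base.1
  -- The step with β = χ^j and η_(j+1) starts from U j. Since η_(j+1) = 1 on the support of η_(j+2)
  -- and pσχ^j = tpχ^(j+1), its left side controls U (j+1).
  set U : ℕ → ℝ≥0∞ := fun j => eLpNorm ((tsupport (η (j + 1))).indicator ub)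
    (ENNReal.ofReal (t * p * χ ^ j)) (avgMeasure B) with hU
  -- The maximum with k absorbs the additive term 2k^β, so the recursion becomes purely
  -- multiplicative.
  set X : ℕ → ℝ≥0∞ := fun j => max (U j) (ENNReal.ofReal k) with hX
  have hpow : ∀ (j i : ℕ) (q : ℝ), eLpNorm ((tsupport (η i)).indicator fun x => ub x ^ (χ ^ j))
      (ENNReal.ofReal q) (avgMeasure B) = eLpNorm ((tsupport (η i)).indicator ub)
      (ENNReal.ofReal (q * χ ^ j)) (avgMeasure B) ^ (χ ^ j) := by
    intro j i q
    have hβ : 0 < χ ^ j := by positivity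
    rw [ENNReal.ofReal_mul' hβ.le, ← eLpNorm_norm_rpow _ hβ]
    congr 1
    ext x
    by_cases hx : x ∈ tsupport (η i)
    · rw [Set.indicator_of_mem hx, Set.indicator_of_mem hx, Real.norm_of_nonneg (ub0 x).le]
    · rw [Set.indicator_of_notMem hx, Set.indicator_of_notMem hx, norm_zero,
        Real.zero_rpow hβ.ne']
  have hrec : ∀ j, X (j + 1) ≤ ENNReal.ofReal ((iterStart p a ε CS M₁ Ccut N *
      iterGrowth p σ ε N t ^ j) ^ ((χ ^ j)⁻¹)) * X j := by
    intro j
    have hβ : 0 < χ ^ j := by positivity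
    have hβ1 : 1 ≤ χ ^ j := one_le_pow₀ hχ.le
    set D := (χ ^ j * stepConst p a CS M₁) ^ stepExp p ε * max 1 (Ccut * N ^ (j + 1)) with hD
    have hD0 : 0 ≤ D := by
      have := stepConst_nonneg (CS := CS) hp ha S.hM₁
      positivity
    have hle := iterStep_le (CS := CS) hp ha hε S.hM₁ hC hN ht0 htσ j
    rw [← hD] at hle
    have h1 := S.step (hη (j + 1) (by lia)) (hη0 (j + 1) (by lia)) (hη1 (j + 1) (by lia))
      (hEM (j + 1) (by lia)) hβ1
    rw [hst, ← ENNReal.ofReal_mul ht0.le, hpow j (j + 1) (t * p), ← hD] at h1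
    have h2 : U (j + 1) ^ (χ ^ j) ≤
        eLpNorm (fun x => η (j + 1) x * ub x ^ (χ ^ j)) (ENNReal.ofReal (p * σ))
          (avgMeasure B) := by
      have e : t * p * χ ^ (j + 1) = p * σ * χ ^ j := by
        rw [pow_succ, hχd]; field_simp
      rw [hU]
      simp only
      rw [e, ← hpow]
      refine eLpNorm_mono fun x => ?_
      by_cases hx : x ∈ tsupport (η (j + 1 + 1))
      · rw [Set.indicator_of_mem hx, hsupp (j + 1) (by lia) x hx, one_mul]
      · rw [Set.indicator_of_notMem hx, norm_zero]; exact norm_nonneg _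
    have h3 : X (j + 1) ^ (χ ^ j) ≤ ENNReal.ofReal (D + 2) * X j ^ (χ ^ j) := by
      have hkX : ENNReal.ofReal k ^ (χ ^ j) ≤ X j ^ (χ ^ j) := by
        gcongr; exact le_max_right _ _
      have hUX : U j ^ (χ ^ j) ≤ X j ^ (χ ^ j) := by
        gcongr; exact le_max_left _ _
      have hk2 : ENNReal.ofReal (2 * k ^ (χ ^ j)) = ENNReal.ofReal 2 * ENNReal.ofReal k ^ (χ ^ j) := by
        rw [ENNReal.ofReal_mul zero_le_two, ENNReal.ofReal_rpow_of_pos hk]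
      rw [hk2] at h1
      rw [ENNReal.ofReal_add hD0 zero_le_two, add_mul]
      rcases le_total (U (j + 1)) (ENNReal.ofReal k) with hc | hc
      · rw [show X (j + 1) = ENNReal.ofReal k from max_eq_right hc]
        refine hkX.trans (le_add_left (le_mul_of_one_le_left' ?_))
        rw [← ENNReal.ofReal_one]; exact ENNReal.ofReal_le_ofReal one_le_two
      · rw [show X (j + 1) = U (j + 1) from max_eq_left hc]
        exact (h2.trans h1).trans (add_le_add (mul_le_mul' le_rfl hUX) (mul_le_mul' le_rfl hkX))
    have h4 := ENNReal.rpow_le_rpow (h3.trans (mul_le_mul' (ENNReal.ofReal_le_ofReal hle) le_rfl))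
      (inv_nonneg.2 hβ.le)
    rw [← ENNReal.rpow_mul, mul_inv_cancel₀ hβ.ne', ENNReal.rpow_one,
      ENNReal.mul_rpow_of_nonneg _ _ (inv_nonneg.2 hβ.le), ← ENNReal.rpow_mul,
      mul_inv_cancel₀ hβ.ne', ENNReal.rpow_one,
      ENNReal.ofReal_rpow_of_nonneg (by linarith) (inv_nonneg.2 hβ.le)] at h4
    exact h4
  have hG1 : 1 ≤ iterStart p a ε CS M₁ Ccut N := by
    have := stepConst_nonneg (CS := CS) hp ha S.hM₁
    have h2 : 0 ≤ stepConst p a CS M₁ ^ stepExp p ε * ((1 + Ccut) * max 1 N) := by positivity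
    unfold iterStart
    linarith
  have hL1 : 1 ≤ iterGrowth p σ ε N t :=
    one_le_mul_of_one_le_of_one_le (Real.one_le_rpow hχ.le (stepExp_pos hp hε).le)
      (le_max_left _ _)
  have hX0 : X 0 ≤ eLpNorm u (s * ENNReal.ofReal p) (avgMeasure B) + ENNReal.ofReal k := by
    have hc1 : 1 ≤ s * ENNReal.ofReal p := by
      refine one_le_mul_of_one_le_of_one_le hs1 ?_
      rw [← ENNReal.ofReal_one]; exact ENNReal.ofReal_le_ofReal hp.le
    have hc2 : eLpNorm (fun _ : Eucl n => k) (s * ENNReal.ofReal p) (avgMeasure B) =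
        ENNReal.ofReal k := by
      rw [eLpNorm_const _ (one_pos.trans_le hc1).ne' hprob.neZero.ne, measure_univ,
        ENNReal.one_rpow, mul_one, Real.enorm_of_nonneg hk.le]
    have hmu : AEStronglyMeasurable u (avgMeasure B) := S.mem_u.1.smul_measure _
    refine max_le ?_ le_add_self
    have e : ENNReal.ofReal (t * p * χ ^ 0) = s * ENNReal.ofReal p := by
      rw [pow_zero, mul_one, ENNReal.ofReal_mul ht0.le, ← hst]
    rw [hU]
    simp only
    rw [e, ← hc2, ← eLpNorm_norm u]
    refine le_trans (eLpNorm_mono (g := (fun x => ‖u x‖) + fun _ : Eucl n => k) fun x => ?_)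
      (eLpNorm_add_le hmu.norm aestronglyMeasurable_const hc1)
    refine (norm_indicator_le_norm_self _ x).trans ?_
    rw [Pi.add_apply, Real.norm_of_nonneg (ub0 x).le, Real.norm_of_nonneg (by positivity)]
    exact max_le (by rw [Real.norm_eq_abs]; linarith) (by linarith [norm_nonneg (u x)])
  -- passage to the limit
  have hc0 : (volume B)⁻¹ ≠ 0 := ENNReal.inv_ne_zero.2 S.vol_ne_top
  -- Normalizing by |B| rather than |B'| makes the measures comparable. The essential supremum does
  -- not see the factor.
  have hν : ((volume B)⁻¹ • volume.restrict B' : Measure (Eucl n)) ≤ avgMeasure B :=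
    Measure.le_iff'.2 fun T => by
      rw [avgMeasure, Measure.smul_apply, Measure.smul_apply, smul_eq_mul, smul_eq_mul]
      exact mul_le_mul' le_rfl (Measure.restrict_mono hB'B le_rfl T)
  have hmem : ∀ᵐ x ∂((volume B)⁻¹ • volume.restrict B' : Measure (Eucl n)), x ∈ B' :=
    Measure.ae_smul_measure (ae_restrict_mem₀ hB') _
  have hfin : eLpNorm u ⊤ ((volume B)⁻¹ • volume.restrict B' : Measure (Eucl n)) ≤
      ENNReal.ofReal (iterConst p σ a ε CS M₁ Ccut N t) * X 0 := by
    refine eLpNorm_top_le_of_forall (q := fun j => t * p * χ ^ j)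
      ((S.mem_u.1.smul_measure _).mono_measure hν)
      ((tendsto_pow_atTop_atTop_of_one_lt hχ).const_mul_atTop (by positivity)) fun j => ?_
    refine le_trans (le_trans (eLpNorm_mono_ae (g := (tsupport (η (j + 1))).indicator ub) ?_)
      (eLpNorm_mono_measure _ hν)) ((le_max_left _ _).trans
        (prod_bound_of_recursion hG1 hL1 hχ hrec j))
    filter_upwards [hmem] with x hx
    have : x ∈ tsupport (η (j + 1)) := subset_tsupport _ (by
      rw [Function.mem_support, hone (j + 1) (by lia) x hx]; exact one_ne_zero)
    rw [Set.indicator_of_mem this, Real.norm_of_nonneg (ub0 x).le]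
    exact le_max_left _ _
  rw [eLpNorm_exponent_top, eLpNormEssSup_ennreal_smul_measure hc0,
    ← eLpNorm_exponent_top] at hfin
  exact hfin.trans (mul_le_mul' le_rfl hX0)

/-! ### Scaling of the coefficients and the boundedness of weak solutions -/

/-- Condition D_q is stated for r < 1, whereas r = 1 is admitted here. The bound passes to the limit
from smaller radii. -/
theorem DCond.le_volume {n : ℕ} {Ω : Set (Eucl n)} {ρ : Eucl n → Eucl n → ℝ}
    {r₁ : Eucl n → ℝ} {q c₀ : ℝ} (hD : DCond Ω ρ r₁ q c₀) (hq : 0 < q) {y : Eucl n} (hy : y ∈ Ω)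
    {r : ℝ} (hr : 0 < r) (hr1 : r ≤ 1) (hr' : r < r₁ y) :
    ENNReal.ofReal (c₀ * r ^ q) ≤ volume (qBall Ω ρ y r) := by
  have h1 : Tendsto (fun t : ℝ => ENNReal.ofReal (c₀ * t ^ q)) (𝓝[<] r)
      (𝓝 (ENNReal.ofReal (c₀ * r ^ q))) :=
    ((ENNReal.continuous_ofReal.comp
      (continuous_const.mul (Real.continuous_rpow_const hq.le))).tendsto r).mono_left
        nhdsWithin_le_nhds
  refine le_of_tendsto h1 ?_
  filter_upwards [Ioo_mem_nhdsLT hr] with t ht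
  exact (hD y hy t ht.1 (lt_min (ht.2.trans_le hr1) (ht.2.trans hr'))).trans
    (measure_mono (qBall_mono ht.2.le))

/-- The volume bound gives |B|^(-1/R) ≤ c₀^(-1/R) r^(-q/R), so averaging costs exactly the power q/R
of r. -/
theorem ofReal_rpow_mul_eLpNorm_avgMeasure_le {n : ℕ} {g : Eucl n → ℝ} {α R q c₀ r : ℝ}
    {B : Set (Eucl n)} (hR : 0 < R) (hc₀ : 0 < c₀) (hr : 0 < r)
    (hV : ENNReal.ofReal (c₀ * r ^ q) ≤ volume B)
    (hg : MemLp g (ENNReal.ofReal R) (volume.restrict B)) :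
    ENNReal.ofReal (r ^ α) * eLpNorm g (ENNReal.ofReal R) (avgMeasure B) ≤
      ENNReal.ofReal (c₀ ^ (-R⁻¹) * (r ^ (α - q / R) * lpNormOn g R B)) := by
  have h1 := avgNorm_eq g (ENNReal.ofReal_ne_top (r := R)) B
  have e1 : (1 / ENNReal.ofReal R).toReal = R⁻¹ := by
    rw [one_div, ENNReal.toReal_inv, ENNReal.toReal_ofReal hR.le]
  have h2 : (volume B)⁻¹ ^ R⁻¹ ≤ ENNReal.ofReal (c₀ ^ (-R⁻¹) * r ^ (-(q / R))) := by
    have h3 : (volume B)⁻¹ ≤ ENNReal.ofReal ((c₀ * r ^ q)⁻¹) := by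
      rw [ENNReal.ofReal_inv_of_pos (by positivity)]
      exact ENNReal.inv_le_inv.2 hV
    refine (ENNReal.rpow_le_rpow h3 (by positivity)).trans (le_of_eq ?_)
    rw [ENNReal.ofReal_rpow_of_nonneg (by positivity) (by positivity),
      Real.inv_rpow (by positivity), ← Real.rpow_neg (by positivity),
      Real.mul_rpow hc₀.le (by positivity), ← Real.rpow_mul hr.le]
    congr 3
    ring
  have h4 : eLpNorm g (ENNReal.ofReal R) (volume.restrict B) = ENNReal.ofReal (lpNormOn g R B) :=
    (ENNReal.ofReal_toReal hg.2.ne).symm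
  change _ * avgNorm g (ENNReal.ofReal R) B ≤ _
  rw [h1, e1, h4]
  refine (mul_le_mul' le_rfl (mul_le_mul' h2 le_rfl)).trans (le_of_eq ?_)
  rw [← ENNReal.ofReal_mul (by positivity), ← ENNReal.ofReal_mul (by positivity), sub_eq_add_neg,
    Real.rpow_add hr]
  congr 1
  ring

theorem lpNormOn_nonneg {n : ℕ} (g : Eucl n → ℝ) (R : ℝ) (B : Set (Eucl n)) :
    0 ≤ lpNormOn g R B := ENNReal.toReal_nonneg

theorem lpNormOn_add_const_mul_le {n : ℕ} {b e : Eucl n → ℝ} {R κ : ℝ} {B : Set (Eucl n)}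
    (hR : 1 ≤ R) (hκ : 0 ≤ κ) (hb : MemLp b (ENNReal.ofReal R) (volume.restrict B))
    (he : MemLp e (ENNReal.ofReal R) (volume.restrict B)) :
    lpNormOn (fun x => b x + κ * e x) R B ≤ lpNormOn b R B + κ * lpNormOn e R B := by
  have h1 : eLpNorm (fun x => b x + κ * e x) (ENNReal.ofReal R) (volume.restrict B) ≤
      eLpNorm b (ENNReal.ofReal R) (volume.restrict B) +
        ENNReal.ofReal κ * eLpNorm e (ENNReal.ofReal R) (volume.restrict B) := by
    refine (eLpNorm_add_le hb.1 (he.const_mul κ).1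
      (by rw [← ENNReal.ofReal_one]; exact ENNReal.ofReal_le_ofReal hR)).trans (le_of_eq ?_)
    have := eLpNorm_const_smul κ e (ENNReal.ofReal R) (volume.restrict B)
    rw [Real.enorm_of_nonneg hκ] at this
    rw [← this]
    rfl
  have h2 := ENNReal.toReal_mono (ENNReal.add_ne_top.2 ⟨hb.2.ne,
    ENNReal.mul_ne_top ENNReal.ofReal_ne_top he.2.ne⟩) h1
  rwa [ENNReal.toReal_add hb.2.ne (ENNReal.mul_ne_top ENNReal.ofReal_ne_top he.2.ne),
    ENNReal.toReal_mul, ENNReal.toReal_ofReal hκ] at h2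

theorem ofReal_rpow_mul_eLpNorm_add_le {n : ℕ} {b e : Eucl n → ℝ} {α R q c₀ r κ M : ℝ}
    {B : Set (Eucl n)} (hR : 1 ≤ R) (hc₀ : 0 < c₀) (hr : 0 < r) (hr1 : r ≤ 1) (hκ : 0 ≤ κ)
    (hV : ENNReal.ofReal (c₀ * r ^ q) ≤ volume B) (hα : 0 ≤ α - q / R)
    (hb : MemLp b (ENNReal.ofReal R) (volume.restrict B))
    (he : MemLp e (ENNReal.ofReal R) (volume.restrict B)) (hM : lpNormOn b R B ≤ M)
    (hκe : κ * (r ^ (α - q / R) * lpNormOn e R B) ≤ 1) :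
    ENNReal.ofReal (r ^ α) * eLpNorm (fun x => b x + κ * e x) (ENNReal.ofReal R) (avgMeasure B) ≤
      ENNReal.ofReal ((M + 1) * c₀ ^ (-R⁻¹)) := by
  refine (ofReal_rpow_mul_eLpNorm_avgMeasure_le (by linarith) hc₀ hr hV
    (hb.add (he.const_mul κ))).trans (ENNReal.ofReal_le_ofReal ?_)
  rw [mul_comm (M + 1)]
  refine mul_le_mul_of_nonneg_left ?_ (by positivity)
  have h1 : r ^ (α - q / R) ≤ 1 := Real.rpow_le_one hr.le hr1 hα
  calc r ^ (α - q / R) * lpNormOn (fun x => b x + κ * e x) R B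
      ≤ r ^ (α - q / R) * (lpNormOn b R B + κ * lpNormOn e R B) :=
        mul_le_mul_of_nonneg_left (lpNormOn_add_const_mul_le hR hκ hb he) (by positivity)
    _ = r ^ (α - q / R) * lpNormOn b R B + κ * (r ^ (α - q / R) * lpNormOn e R B) := by ring
    _ ≤ 1 * lpNormOn b R B + 1 :=
        add_le_add (mul_le_mul_of_nonneg_right h1 (lpNormOn_nonneg _ _ _)) hκe
    _ ≤ M + 1 := by linarith

theorem rpow_neg_mul_le_one {r x m X k y : ℝ} (hr : 0 < r) (hm : 0 < m) (hX : 0 ≤ X) (hk : 0 < k)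
    (h : r ^ x * X ^ (1 / m) ≤ k) (hy : y = x * m) : k ^ (-m) * (r ^ y * X) ≤ 1 := by
  have h1 := Real.rpow_le_rpow (by positivity) h hm.le
  rw [Real.mul_rpow (by positivity) (by positivity), ← Real.rpow_mul hr.le, ← Real.rpow_mul hX,
    one_div_mul_cancel hm.ne', Real.rpow_one, ← hy] at h1
  rw [Real.rpow_neg hk.le, inv_mul_le_one₀ (by positivity)]
  exact h1

/-- Each summand of K is at most k. Raising this to the power p - 1 for e and f, and p for g, gives
the three bounds; the powers of r in K are those for which the exponents agree. -/
theorem Kterm_dominates {n : ℕ} {p σ q ε r k : ℝ} {e f g : Eucl n → ℝ} {B : Set (Eucl n)}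
    (hp : 1 < p) (hσ : 1 < σ) (hε : 0 < ε) (hr : 0 < r) (hk : 0 < k)
    (hK : Kterm p σ q ε r e f g B ≤ k) :
    k ^ (1 - p) * (r ^ (p - 1 - q / (p.conjExponent * σ.conjExponent)) *
      lpNormOn e (p.conjExponent * σ.conjExponent) B) ≤ 1 ∧
    k ^ (1 - p) * (r ^ (p - q / (σ.conjExponent * (1 + ε))) *
      lpNormOn f (σ.conjExponent * (1 + ε)) B) ≤ 1 ∧
    k ^ (-p) * (r ^ (p - q / (σ.conjExponent * (1 + ε))) *
      lpNormOn g (σ.conjExponent * (1 + ε)) B) ≤ 1 := by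
  have hp1 : 0 < p - 1 := by linarith
  have hp0 : 0 < p := by linarith
  have hσ1 : 0 < σ - 1 := by linarith
  have hσ0 : 0 < σ := by linarith
  have e1 : p.conjExponent = p / (p - 1) := rfl
  have hσ' : 0 < σ.conjExponent := by
    have : σ.conjExponent = σ / (σ - 1) := rfl
    rw [this]; positivity
  have x1 := lpNormOn_nonneg e (p.conjExponent * σ.conjExponent) B
  have x2 := lpNormOn_nonneg f (σ.conjExponent * (1 + ε)) B
  have x3 := lpNormOn_nonneg g (σ.conjExponent * (1 + ε)) B
  simp only [Kterm] at hK
  rw [mul_add, mul_add, ← mul_assoc, ← mul_assoc, ← Real.rpow_add hr, ← Real.rpow_add hr] at hK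
  generalize lpNormOn e (p.conjExponent * σ.conjExponent) B = X at *
  generalize lpNormOn f (σ.conjExponent * (1 + ε)) B = Y at *
  generalize lpNormOn g (σ.conjExponent * (1 + ε)) B = Z at *
  rw [e1]
  generalize σ.conjExponent = w at *
  have t1 : 0 ≤ r ^ (1 - q / (p * w)) * X ^ (1 / (p - 1)) := by positivity
  have t2 : 0 ≤ r ^ (1 - q / (p * w) + (1 - q / (p * w) + q / w * (ε / (1 + ε))) *
    (1 / (p - 1))) * Y ^ (1 / (p - 1)) := by positivity
  have t3 : 0 ≤ r ^ (1 - q / (p * w) + q / (p * w) * (ε / (1 + ε))) * Z ^ (1 / p) := by positivity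
  have l1 := (le_add_of_nonneg_right t2).trans ((le_add_of_nonneg_right t3).trans hK)
  have l2 := ((le_add_of_nonneg_left t1).trans (le_add_of_nonneg_right t3)).trans hK
  have l3 := (le_add_of_nonneg_left (add_nonneg t1 t2)).trans hK
  refine ⟨?_, ?_, ?_⟩
  · rw [← neg_sub p 1]
    refine rpow_neg_mul_le_one hr hp1 x1 hk l1 ?_
    field_simp
  · rw [← neg_sub p 1]
    refine rpow_neg_mul_le_one hr hp1 x2 hk l2 ?_
    field_simp
    ring
  · refine rpow_neg_mul_le_one hr hp0 x3 hk l3 ?_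
    field_simp
    ring

/-- Cancelling p leaves σ' < s', and conjugation reverses the order; s' = ∞ is allowed. This strict
inequality makes the ratio σ/s of the iteration exceed 1. -/
theorem lt_ofReal_of_conj_lt {p σ : ℝ} {s s' : ℝ≥0∞} (hp : 1 < p) (hσ : 1 < σ)
    (hss : s⁻¹ + s'⁻¹ = 1) (h : ENNReal.ofReal (p * σ.conjExponent) < s' * ENNReal.ofReal p) :
    s < ENNReal.ofReal σ := by
  have hσ1 : 0 < σ - 1 := by linarith
  have hσ0 : 0 < σ := by linarith
  have e2 : σ.conjExponent = σ / (σ - 1) := rfl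
  have h1 : ENNReal.ofReal σ.conjExponent < s' := by
    rw [ENNReal.ofReal_mul (by linarith), mul_comm] at h
    exact lt_of_mul_lt_mul_right' h
  by_contra hc
  rw [not_lt] at hc
  have h2 : s⁻¹ ≤ ENNReal.ofReal σ⁻¹ := by
    rw [ENNReal.ofReal_inv_of_pos hσ0]; exact ENNReal.inv_le_inv.2 hc
  have h3 : s'⁻¹ < ENNReal.ofReal σ.conjExponent⁻¹ := by
    rw [ENNReal.ofReal_inv_of_pos (by rw [e2]; positivity)]
    exact ENNReal.inv_lt_inv.2 h1
  have h4 := ENNReal.add_lt_add_of_le_of_lt (ne_top_of_le_ne_top ENNReal.ofReal_ne_top h2) h2 h3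
  rw [hss, ← ENNReal.ofReal_add (by positivity) (by rw [e2]; positivity)] at h4
  have : σ⁻¹ + σ.conjExponent⁻¹ = 1 := by rw [e2]; field_simp; ring
  rw [this, ENNReal.ofReal_one] at h4
  exact lt_irrefl _ h4

/-- A bound for the scaled coefficients in terms of the structural constants. -/
noncomputable def coeffBound (p σ ε c₀ M : ℝ) : ℝ :=
  -- The 1 accounts for the normalized contribution of e, f or g. The absolute value makes the bound
  -- nonnegative for every real M.
  (|M| + 1) * c₀ ^ (-(p.conjExponent * σ.conjExponent)⁻¹) +
  (|M| + 1) * c₀ ^ (-(p * σ.conjExponent * (1 + ε))⁻¹) +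
  (|M| + 1) * c₀ ^ (-(σ.conjExponent * (1 + ε))⁻¹)

theorem exists_moserSetup {n : ℕ} {p σ a τ N CS Ccut q c₀ ε M k : ℝ} {s s' sStar t t' : ℝ≥0∞}
    (hp : 1 < p) (hσ : 1 < σ) (ha : 1 < a) (hτ : 0 < τ) (hτ1 : τ < 1)
    (hss : s⁻¹ + s'⁻¹ = 1) (hsσ : s < ENNReal.ofReal σ)
    (hq : 0 < q) (hq_le : q ≤ p * σ.conjExponent) (hc₀ : 0 < c₀) (hε : 0 < ε)
    {Ω : Set (Eucl n)} {Q : Eucl n → Matrix (Fin n) (Fin n) ℝ}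
    {ρ : Eucl n → Eucl n → ℝ} {r₁ : Eucl n → ℝ} (hΩ : IsOpen Ω) (hQ : IsDegenerateForm Ω p Q)
    (hρ : IsQuasimetric Ω ρ) (had : AdmissibleRadius Ω ρ r₁) (hSob : SobolevEstimate Ω Q ρ r₁ p σ CS)
    (htt : t⁻¹ + t'⁻¹ = 1) (hcut : CutoffCond Ω Q ρ r₁ p τ N Ccut sStar t)
    (hloc : LocalIntegrabilityCond Ω Q ρ r₁ p t') (hD : DCond Ω ρ r₁ q c₀)
    {b c d e f g h : Eucl n → ℝ} {A : Eucl n → ℝ → Eucl n → Eucl n} {Bf : Eucl n → ℝ → Eucl n → ℝ}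
    (hstr : StructuralCond Ω Q p a p p p b c d e f g h A Bf)
    {u : Eucl n → ℝ} {v : Eucl n → Eucl n} (hsol : IsWeakSolution Ω Q p A Bf u v)
    {y : Eucl n} (hy : y ∈ Ω) {r : ℝ} (hr : 0 < r) (hr1 : r ≤ 1) (hrτ : r < τ * r₁ y)
    (hb : MemLp b (ENNReal.ofReal (p.conjExponent * σ.conjExponent))
      (volume.restrict (qBall Ω ρ y r)))
    (he : MemLp e (ENNReal.ofReal (p.conjExponent * σ.conjExponent))
      (volume.restrict (qBall Ω ρ y r)))
    (hc : MemLp c (ENNReal.ofReal (p * σ.conjExponent * (1 + ε)))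
      (volume.restrict (qBall Ω ρ y r)))
    (hd : MemLp d (ENNReal.ofReal (σ.conjExponent * (1 + ε))) (volume.restrict (qBall Ω ρ y r)))
    (hf : MemLp f (ENNReal.ofReal (σ.conjExponent * (1 + ε))) (volume.restrict (qBall Ω ρ y r)))
    (hg : MemLp g (ENNReal.ofReal (σ.conjExponent * (1 + ε))) (volume.restrict (qBall Ω ρ y r)))
    (hh : MemLp h (ENNReal.ofReal (σ.conjExponent * (1 + ε))) (volume.restrict (qBall Ω ρ y r)))
    (hM : lpNormOn b (p.conjExponent * σ.conjExponent) (qBall Ω ρ y r)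
      + lpNormOn c (p * σ.conjExponent * (1 + ε)) (qBall Ω ρ y r)
      + lpNormOn d (σ.conjExponent * (1 + ε)) (qBall Ω ρ y r)
      + lpNormOn h (σ.conjExponent * (1 + ε)) (qBall Ω ρ y r) ≤ M)
    (hk : 0 < k) (hK : Kterm p σ q ε r e f g (qBall Ω ρ y r) ≤ k) :
    ∃ (A' : Eucl n → ℝ → Eucl n → Eucl n) (w : ℕ → Eucl n → ℝ),
      MoserSetup Ω (qBall Ω ρ y r) Q p σ a ε k r CS (coeffBound p σ ε c₀ M) s s' A A' Bf u v w
        (fun x => b x + k ^ (1 - p) * e x) c (fun x => d x + k ^ (1 - p) * f x)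
        (fun x => h x + k ^ (-p) * g x) := by
  have hp0 : 0 < p := by linarith
  have hp1 : 0 < p - 1 := by linarith
  have hσ1 : 0 < σ - 1 := by linarith
  have hσ0 : 0 < σ := by linarith
  have e1 : p.conjExponent = p / (p - 1) := rfl
  have e2 : σ.conjExponent = σ / (σ - 1) := rfl
  have hp'1 : 1 ≤ p.conjExponent := by rw [e1, one_le_div hp1]; linarith
  have hσ'1 : 1 ≤ σ.conjExponent := by rw [e2, one_le_div hσ1]; linarith
  have hR1 : 1 ≤ p.conjExponent * σ.conjExponent := one_le_mul_of_one_le_of_one_le hp'1 hσ'1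
  have hR3 : 1 ≤ σ.conjExponent * (1 + ε) := one_le_mul_of_one_le_of_one_le hσ'1 (by linarith)
  have hR2 : 1 ≤ p * σ.conjExponent * (1 + ε) := by
    rw [mul_assoc]; exact one_le_mul_of_one_le_of_one_le hp.le hR3
  have hr₁ := (had y hy).1
  have hrr : r < r₁ y := hrτ.trans (mul_lt_of_lt_one_left hr₁ hτ1)
  have hV := hD.le_volume hq hy hr hr1 hrr
  have hV0 := (volume_qBall_pos had hc₀ hD hy hr).ne'
  have hVT := (volume_qBall_lt_top had hy hr hrr).ne
  have hsob := hSob y hy r hr hrr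
  have hBm : NullMeasurableSet (qBall Ω ρ y r) volume := hρ.measurable_ball y hy r hr
  obtain ⟨hnn, A', hA'⟩ := hstr
  obtain ⟨w, hw, hlim⟩ := hsol.1
  obtain ⟨C, hC⟩ := exists_local_gain hp hτ hτ1 hc₀ hΩ hQ hρ had hSob htt hcut hloc hD hy hr hrτ
  set B := qBall Ω ρ y r with hB
  have hBΩ : B ⊆ Ω := qBall_subset
  have hμ : (volume.restrict B : Measure (Eucl n)) ≤ volume.restrict Ω :=
    Measure.restrict_mono hBΩ le_rfl
  have hpσ1 : 1 ≤ ENNReal.ofReal (p * σ) := by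
    rw [← ENNReal.ofReal_one]
    exact ENNReal.ofReal_le_ofReal (one_le_mul_of_one_le_of_one_le hp.le hσ.le)
  obtain ⟨hgain, hu⟩ := MemWQ.tendsto_of_gain hp hΩ hQ hBΩ hpσ1 hC hw hlim
  have hwm : ∀ i, AEStronglyMeasurable (w i) (volume.restrict Ω) := fun i =>
    aestronglyMeasurable_of_locallyLipschitzOn hΩ (hw i).1
  -- A subsequence provides almost everywhere convergence, needed for the dominated convergence of
  -- H'(f_k).
  obtain ⟨ns, hns, hae⟩ := (tendstoInMeasure_of_tendsto_eLpNorm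
    (one_pos.trans_le hpσ1).ne' (fun i => (hwm i).mono_measure hμ) (hlim.1.mono_measure hμ)
    (by simpa [Pi.sub_def] using hgain)).exists_seq_tendsto_ae
  have hxB := ae_restrict_mem₀ hBm
  have hAB := ae_mono hμ hA'
  have hnnB : ∀ᵐ x ∂(volume.restrict B), 0 ≤ b x ∧ 0 ≤ c x ∧ 0 ≤ d x ∧ 0 ≤ e x ∧ 0 ≤ f x ∧
      0 ≤ g x ∧ 0 ≤ h x := hxB.mono fun x hx => hnn x (hBΩ hx)
  -- Multiplying e, f or g by this quantity turns it into a coefficient of max(|u|, k)^(p-1) or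
  -- max(|u|, k)^p.
  have hkp : ∀ {m z : ℝ}, 0 ≤ m → 1 ≤ k ^ (-m) * max |z| k ^ m := fun {m z} hm => by
    rw [Real.rpow_neg hk.le, ← div_eq_inv_mul, one_le_div (by positivity)]
    exact Real.rpow_le_rpow hk.le (le_max_right _ _) hm
  have habs : ∀ {m z : ℝ}, 0 ≤ m → |z| ^ m ≤ max |z| k ^ m := fun {m z} hm =>
    Real.rpow_le_rpow (abs_nonneg _) (le_max_left _ _) hm
  obtain ⟨k1, k2, k3⟩ := Kterm_dominates hp hσ hε hr hk hK
  have n1 := lpNormOn_nonneg b (p.conjExponent * σ.conjExponent) B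
  have n2 := lpNormOn_nonneg c (p * σ.conjExponent * (1 + ε)) B
  have n3 := lpNormOn_nonneg d (σ.conjExponent * (1 + ε)) B
  have n4 := lpNormOn_nonneg h (σ.conjExponent * (1 + ε)) B
  have hMa := le_abs_self M
  have hMa0 := abs_nonneg M
  have hκ1 : 0 ≤ k ^ (1 - p) := by positivity
  have hκ2 : 0 ≤ k ^ (-p) := by positivity
  have m1 : 0 ≤ (|M| + 1) * c₀ ^ (-(p.conjExponent * σ.conjExponent)⁻¹) := by positivity
  have m2 : 0 ≤ (|M| + 1) * c₀ ^ (-(p * σ.conjExponent * (1 + ε))⁻¹) := by positivity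
  have m3 : 0 ≤ (|M| + 1) * c₀ ^ (-(σ.conjExponent * (1 + ε))⁻¹) := by positivity
  -- The hypothesis q ≤ pσ' makes the powers of r left after averaging nonnegative, hence harmless
  -- for r ≤ 1.
  have α1 : 0 ≤ p - 1 - q / (p.conjExponent * σ.conjExponent) := by
    rw [sub_nonneg, div_le_iff₀ (by linarith)]
    have : (p - 1) * (p.conjExponent * σ.conjExponent) = p * σ.conjExponent := by
      rw [e1]; field_simp
    linarith
  have hεσ : 0 ≤ p * σ.conjExponent * ε := by positivity
  have α2 : 0 ≤ 1 - q / (p * σ.conjExponent * (1 + ε)) := by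
    rw [sub_nonneg, div_le_iff₀ (by linarith)]
    linarith
  have α3 : 0 ≤ p - q / (σ.conjExponent * (1 + ε)) := by
    rw [sub_nonneg, div_le_iff₀ (by linarith)]
    linarith
  have hle : ∀ {x : ℝ}, x ≤ coeffBound p σ ε c₀ M → ENNReal.ofReal x ≤
    ENNReal.ofReal (coeffBound p σ ε c₀ M) := fun hx => ENNReal.ofReal_le_ofReal hx
  refine ⟨A', fun i => w (ns i), hp, hσ, ha, hε, hk, hr, by unfold coeffBound; linarith, hss,
    ?_, hΩ, hQ, hBΩ, hV0, hVT, hsob, hsol, fun i => (hw _).1,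
    ⟨hlim.1, hlim.2.1, hlim.2.2.1.comp hns.tendsto_atTop, hlim.2.2.2.comp hns.tendsto_atTop⟩,
    hae, hgain.comp hns.tendsto_atTop, ⟨hlim.1.mono_measure hμ, hu⟩, ?_, ?_, ?_, ?_, ?_, ?_,
    hb.add (he.const_mul _), hc, hd.add (hf.const_mul _), hh.add (hg.const_mul _), ?_, ?_, ?_, ?_⟩
  · rw [mul_comm, ENNReal.ofReal_mul hp0.le]
    exact mul_le_mul' le_rfl hsσ.le
  · have hsm : ∀ {z : Eucl n → Eucl n}, AEStronglyMeasurable z (volume.restrict Ω) →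
        AEStronglyMeasurable (fun x => sqrtApply (Q x) (z x)) (volume.restrict Ω) :=
      fun hz => aestronglyMeasurable_sqrtApply hΩ hQ le_rfl hz
    have hP1 : 1 ≤ ENNReal.ofReal p := by
      rw [← ENNReal.ofReal_one]; exact ENNReal.ofReal_le_ofReal hp.le
    obtain ⟨i, hi⟩ := (hlim.2.2.2.eventually_lt_const one_pos).exists
    have hgi := (measurable_gradient (w i)).aestronglyMeasurable (μ := volume.restrict Ω)
    have h1 : MemLp (fun x => sqrtApply (Q x) (∇ (w i) x)) (ENNReal.ofReal p)
        (volume.restrict Ω) := ⟨hsm hgi, (le_wNorm_right Q hp0 Ω _ _).trans_lt (hw i).2⟩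
    have h2 : MemLp (fun x => sqrtApply (Q x) (∇ (w i) x - v x)) (ENNReal.ofReal p)
        (volume.restrict Ω) := ⟨hsm (hgi.sub hlim.2.1), hi.trans ENNReal.one_lt_top⟩
    refine MemLp.mono_measure hμ ((h1.sub h2).ae_eq (Eventually.of_forall fun x => ?_))
    simp only [Pi.sub_apply, ← sqrtApply_sub, sub_sub_cancel]
  · filter_upwards [hAB] with x hx using (hx (u x) (v x)).1
  · filter_upwards [hAB, hnnB] with x hx hn
    obtain ⟨z1, z2, -, -⟩ := hx (u x) (v x)
    rw [z1, inner_sqrtApply] at z2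
    have z3 := mul_le_mul_of_nonneg_left (habs (z := u x) hp0.le) hn.2.2.2.2.2.2
    have z4 := mul_le_mul_of_nonneg_left (hkp (z := u x) hp0.le) hn.2.2.2.2.2.1
    linarith
  · filter_upwards [hAB, hnnB] with x hx hn
    obtain ⟨-, -, z2, -⟩ := hx (u x) (v x)
    have z3 := mul_le_mul_of_nonneg_left (habs (z := u x) hp1.le) hn.1
    have z4 := mul_le_mul_of_nonneg_left (hkp (z := u x) hp1.le) hn.2.2.2.1
    rw [neg_sub] at z4
    linarith
  · filter_upwards [hAB, hnnB] with x hx hn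
    obtain ⟨-, -, -, z2⟩ := hx (u x) (v x)
    have z3 := mul_le_mul_of_nonneg_left (habs (z := u x) hp1.le) hn.2.2.1
    have z4 := mul_le_mul_of_nonneg_left (hkp (z := u x) hp1.le) hn.2.2.2.2.1
    rw [neg_sub] at z4
    linarith
  · filter_upwards [hnnB] with x hn
    obtain ⟨n1, n2, n3, n4, n5, n6, n7⟩ := hn
    exact ⟨by positivity, n2, by positivity, by positivity⟩
  · exact (ofReal_rpow_mul_eLpNorm_add_le hR1 hc₀ hr hr1 hκ1 hV α1 hb he (M := |M|) (by linarith)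
      k1).trans (hle (by unfold coeffBound; linarith))
  -- The coefficient c receives no inhomogeneous term, so the general bound is used with zero
  -- perturbation.
  · have := ofReal_rpow_mul_eLpNorm_add_le (e := fun _ => 0) (κ := 0) (α := 1) hR2 hc₀ hr hr1
      le_rfl hV α2 hc MemLp.zero' (M := |M|) (by linarith) (by simp)
    simp only [Real.rpow_one, mul_zero, add_zero] at this
    exact this.trans (hle (by unfold coeffBound; linarith))
  · exact (ofReal_rpow_mul_eLpNorm_add_le hR3 hc₀ hr hr1 hκ1 hV α3 hd hf (M := |M|) (by linarith)
      k2).trans (hle (by unfold coeffBound; linarith))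
  · exact (ofReal_rpow_mul_eLpNorm_add_le hR3 hc₀ hr hr1 hκ2 hV α3 hh hg (M := |M|) (by linarith)
      k3).trans (hle (by unfold coeffBound; linarith))

/-! ### The estimate for fixed k, and the passage to k = K -/

theorem eLpNorm_top_le_of_isWeakSolution {n : ℕ} {p σ a τ N CS Ccut q c₀ ε M k : ℝ}
    {s s' sStar t t' : ℝ≥0∞}
    (hp : 1 < p) (hσ : 1 < σ) (ha : 1 < a) (hτ : 0 < τ) (hτ1 : τ < 1) (hN : 0 < N)
    (hCcut : 0 < Ccut) (hss : s⁻¹ + s'⁻¹ = 1) (hsStar : sStar = s' * ENNReal.ofReal p)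
    (hsσ : s < ENNReal.ofReal σ)
    (hq : 0 < q) (hq_le : q ≤ p * σ.conjExponent) (hc₀ : 0 < c₀) (hε : 0 < ε)
    {Ω : Set (Eucl n)} {Q : Eucl n → Matrix (Fin n) (Fin n) ℝ}
    {ρ : Eucl n → Eucl n → ℝ} {r₁ : Eucl n → ℝ} (hΩ : IsOpen Ω) (hQ : IsDegenerateForm Ω p Q)
    (hρ : IsQuasimetric Ω ρ) (had : AdmissibleRadius Ω ρ r₁) (hSob : SobolevEstimate Ω Q ρ r₁ p σ CS)
    (htt : t⁻¹ + t'⁻¹ = 1) (hcut : CutoffCond Ω Q ρ r₁ p τ N Ccut sStar t)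
    (hloc : LocalIntegrabilityCond Ω Q ρ r₁ p t') (hD : DCond Ω ρ r₁ q c₀)
    {b c d e f g h : Eucl n → ℝ} {A : Eucl n → ℝ → Eucl n → Eucl n} {Bf : Eucl n → ℝ → Eucl n → ℝ}
    (hstr : StructuralCond Ω Q p a p p p b c d e f g h A Bf)
    {u : Eucl n → ℝ} {v : Eucl n → Eucl n} (hsol : IsWeakSolution Ω Q p A Bf u v)
    {y : Eucl n} (hy : y ∈ Ω) {r : ℝ} (hr : 0 < r) (hr1 : r ≤ 1) (hrτ : r < τ * r₁ y)
    (hb : MemLp b (ENNReal.ofReal (p.conjExponent * σ.conjExponent))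
      (volume.restrict (qBall Ω ρ y r)))
    (he : MemLp e (ENNReal.ofReal (p.conjExponent * σ.conjExponent))
      (volume.restrict (qBall Ω ρ y r)))
    (hc : MemLp c (ENNReal.ofReal (p * σ.conjExponent * (1 + ε)))
      (volume.restrict (qBall Ω ρ y r)))
    (hd : MemLp d (ENNReal.ofReal (σ.conjExponent * (1 + ε))) (volume.restrict (qBall Ω ρ y r)))
    (hf : MemLp f (ENNReal.ofReal (σ.conjExponent * (1 + ε))) (volume.restrict (qBall Ω ρ y r)))
    (hg : MemLp g (ENNReal.ofReal (σ.conjExponent * (1 + ε))) (volume.restrict (qBall Ω ρ y r)))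
    (hh : MemLp h (ENNReal.ofReal (σ.conjExponent * (1 + ε))) (volume.restrict (qBall Ω ρ y r)))
    (hM : lpNormOn b (p.conjExponent * σ.conjExponent) (qBall Ω ρ y r)
      + lpNormOn c (p * σ.conjExponent * (1 + ε)) (qBall Ω ρ y r)
      + lpNormOn d (σ.conjExponent * (1 + ε)) (qBall Ω ρ y r)
      + lpNormOn h (σ.conjExponent * (1 + ε)) (qBall Ω ρ y r) ≤ M)
    (hk : 0 < k) (hK : Kterm p σ q ε r e f g (qBall Ω ρ y r) ≤ k) :
    MemLp u (s * ENNReal.ofReal p) (volume.restrict (qBall Ω ρ y r)) ∧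
    eLpNorm u ⊤ (volume.restrict (qBall Ω ρ y (τ * r))) ≤
      ENNReal.ofReal (iterConst p σ a ε CS (coeffBound p σ ε c₀ M) Ccut N s.toReal) *
        (avgNorm u (s * ENNReal.ofReal p) (qBall Ω ρ y r) + ENNReal.ofReal k) := by
  obtain ⟨A', w, S⟩ := exists_moserSetup hp hσ ha hτ hτ1 hss hsσ hq hq_le hc₀ hε hΩ hQ hρ had hSob
    htt hcut hloc hD hstr hsol hy hr hr1 hrτ hb he hc hd hf hg hh hM hk hK
  have := S.isFiniteMeasure
  refine ⟨S.mem_u.mono_exponent S.hsσ, ?_⟩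
  have hrr : r < r₁ y := hrτ.trans (mul_lt_of_lt_one_left (had y hy).1 hτ1)
  obtain ⟨η, hη, -⟩ := hcut y hy r hr hrr
  refine S.bound hsσ (fun j hj => hη.isLipCompact ((had y hy).2 r hr hrr).1 hj) hη.nonneg hη.le_one
    (fun j hj x hx => (hη.supp_succ j hj x hx).2)
    (hρ.measurable_ball y hy _ (by positivity)) (qBall_mono (by nlinarith))
    (fun j hj x hx => (hη.eq_one j hj x hx).2) hN hCcut fun j hj => ?_
  rw [← hsStar]
  refine (mul_le_mul' le_rfl (hη.grad_bound j hj)).trans (le_of_eq ?_)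
  rw [← ENNReal.ofReal_mul hr.le, mul_div_cancel₀ _ hr.ne']

theorem corollary1p6 (n : ℕ)
    -- all the parameters on which the constant `C` may depend
    (p σ a τ N CS Ccut q c₀ ε M : ℝ) (s s' sStar : ℝ≥0∞)
    (hp : 1 < p) (hσ : 1 < σ) (ha : 1 < a) (hτ : 0 < τ) (hτ1 : τ < 1)
    (hN : 0 < N) (hCS : 0 < CS) (hCcut : 0 < Ccut)
    (hss : s⁻¹ + s'⁻¹ = 1) (hsStar : sStar = s' * ENNReal.ofReal p)
    (hsStar_gt : ENNReal.ofReal (p * σ.conjExponent) < sStar)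
    (hq : 0 < q) (hq_le : q ≤ p * σ.conjExponent) (hc₀ : 0 < c₀) (hε : 0 < ε) :
    ∃ C : ℝ, 0 < C ∧
      ∀ (Ω : Set (Eucl n)) (Q : Eucl n → Matrix (Fin n) (Fin n) ℝ)
        (ρ : Eucl n → Eucl n → ℝ) (r₁ : Eucl n → ℝ) (t t' : ℝ≥0∞),
        IsOpen Ω → IsDegenerateForm Ω p Q →
        IsQuasimetric Ω ρ → EuclidFiner Ω ρ → AdmissibleRadius Ω ρ r₁ →
        SobolevEstimate Ω Q ρ r₁ p σ CS →
        t⁻¹ + t'⁻¹ = 1 →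
        CutoffCond Ω Q ρ r₁ p τ N Ccut sStar t →
        LocalIntegrabilityCond Ω Q ρ r₁ p t' →
        DCond Ω ρ r₁ q c₀ →
      ∀ (b c d e f g h : Eucl n → ℝ)
        (A : Eucl n → ℝ → Eucl n → Eucl n) (B : Eucl n → ℝ → Eucl n → ℝ),
        StructuralCond Ω Q p a p p p b c d e f g h A B →
      ∀ (u : Eucl n → ℝ) (v : Eucl n → Eucl n), IsWeakSolution Ω Q p A B u v →
      ∀ y ∈ Ω, ∀ r : ℝ, 0 < r → r ≤ 1 → r < τ * r₁ y →
        MemLp b (ENNReal.ofReal (p.conjExponent * σ.conjExponent))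
          (volume.restrict (qBall Ω ρ y r)) →
        MemLp e (ENNReal.ofReal (p.conjExponent * σ.conjExponent))
          (volume.restrict (qBall Ω ρ y r)) →
        MemLp c (ENNReal.ofReal (p * σ.conjExponent * (1 + ε)))
          (volume.restrict (qBall Ω ρ y r)) →
        MemLp d (ENNReal.ofReal (σ.conjExponent * (1 + ε)))
          (volume.restrict (qBall Ω ρ y r)) →
        MemLp f (ENNReal.ofReal (σ.conjExponent * (1 + ε)))
          (volume.restrict (qBall Ω ρ y r)) →
        MemLp g (ENNReal.ofReal (σ.conjExponent * (1 + ε)))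
          (volume.restrict (qBall Ω ρ y r)) →
        MemLp h (ENNReal.ofReal (σ.conjExponent * (1 + ε)))
          (volume.restrict (qBall Ω ρ y r)) →
        lpNormOn b (p.conjExponent * σ.conjExponent) (qBall Ω ρ y r)
            + lpNormOn c (p * σ.conjExponent * (1 + ε)) (qBall Ω ρ y r)
            + lpNormOn d (σ.conjExponent * (1 + ε)) (qBall Ω ρ y r)
            + lpNormOn h (σ.conjExponent * (1 + ε)) (qBall Ω ρ y r) ≤ M →
        -- the right-hand side is finite, and the estimate holds
        MemLp u (s * ENNReal.ofReal p) (volume.restrict (qBall Ω ρ y r)) ∧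
        eLpNorm u ⊤ (volume.restrict (qBall Ω ρ y (τ * r))) ≤
          ENNReal.ofReal C *
            (avgNorm u (s * ENNReal.ofReal p) (qBall Ω ρ y r) +
              ENNReal.ofReal (Kterm p σ q ε r e f g (qBall Ω ρ y r))) ∧
        -- the case `s = 1`
        (sStar = ⊤ →
          eLpNorm u ⊤ (volume.restrict (qBall Ω ρ y (τ * r))) ≤
            ENNReal.ofReal C *
              (avgNorm u (ENNReal.ofReal p) (qBall Ω ρ y r) +
                ENNReal.ofReal (Kterm p σ q ε r e f g (qBall Ω ρ y r)))) := by
  have hsσ := lt_ofReal_of_conj_lt hp hσ hss (hsStar ▸ hsStar_gt)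
  set C := iterConst p σ a ε CS (coeffBound p σ ε c₀ M) Ccut N s.toReal with hC
  refine ⟨C, Real.exp_pos _, ?_⟩
  intro Ω Q ρ r₁ t t' hΩ hQ hρ _ had hSob htt hcut hloc hD b c d e f g h A B hstr u v hsol y hy r hr
    hr1 hrτ hb he hc hd hf hg hh hM
  have hK0 : 0 ≤ Kterm p σ q ε r e f g (qBall Ω ρ y r) := by
    have x1 := lpNormOn_nonneg e (p.conjExponent * σ.conjExponent) (qBall Ω ρ y r)
    have x2 := lpNormOn_nonneg f (σ.conjExponent * (1 + ε)) (qBall Ω ρ y r)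
    have x3 := lpNormOn_nonneg g (σ.conjExponent * (1 + ε)) (qBall Ω ρ y r)
    simp only [Kterm]
    positivity
  have key : ∀ {k : ℝ}, 0 < k → Kterm p σ q ε r e f g (qBall Ω ρ y r) ≤ k → _ := fun hk hK =>
    eLpNorm_top_le_of_isWeakSolution (M := M) hp hσ ha hτ hτ1 hN hCcut hss hsStar hsσ hq hq_le hc₀ hε
      hΩ hQ hρ had hSob htt hcut hloc hD hstr hsol hy hr hr1 hrτ hb he hc hd hf hg hh hM hk hK
  set K := Kterm p σ q ε r e f g (qBall Ω ρ y r) with hKdef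
  have hmem := (key (k := K + 1) (by linarith) (by linarith)).1
  have hbound : eLpNorm u ⊤ (volume.restrict (qBall Ω ρ y (τ * r))) ≤ ENNReal.ofReal C *
      (avgNorm u (s * ENNReal.ofReal p) (qBall Ω ρ y r) + ENNReal.ofReal K) := by
    -- The iteration needs k > 0, while K may vanish. As C does not depend on k, the estimate for
    -- all k > K passes to the limit.
    have hlim : Tendsto (fun k : ℝ => ENNReal.ofReal C *
        (avgNorm u (s * ENNReal.ofReal p) (qBall Ω ρ y r) + ENNReal.ofReal k)) (𝓝[>] K)
        (𝓝 (ENNReal.ofReal C *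
          (avgNorm u (s * ENNReal.ofReal p) (qBall Ω ρ y r) + ENNReal.ofReal K))) :=
      (ENNReal.Tendsto.const_mul (tendsto_const_nhds.add
        (ENNReal.continuous_ofReal.tendsto K)) (Or.inr ENNReal.ofReal_ne_top)).mono_left
          nhdsWithin_le_nhds
    refine ge_of_tendsto hlim ?_
    filter_upwards [self_mem_nhdsWithin] with k hk
    exact (key (hK0.trans_lt hk) (le_of_lt hk)).2
  refine ⟨hmem, hbound, fun hT => ?_⟩
  have hs' : s' = ⊤ := by
    by_contra hne
    rw [hsStar] at hT
    exact ENNReal.mul_ne_top hne ENNReal.ofReal_ne_top hT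
  have hs : s = 1 := by
    rwa [hs', ENNReal.inv_top, add_zero, ENNReal.inv_eq_one] at hss
  rwa [hs, one_mul] at hbound
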